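/- **Setting.** Let $m,\rho,\sigma>0$, fix a sign $\pm$ with $\sigma\pm\rho\neq 0$, and put $D=m\rho^2$, $\epsilon=\sigma/(\sigma\pm\rho)$. On $so(n)$ use $\langle X,Y\rangle=-\tfrac12\operatorname{tr}(XY)$, and write $x\wedge y=xy^T-yx^T$ for $x,y\in\mathbb R^n$. Let $a_1,\dots,a_n>0$, $A=\operatorname{diag}(a_1,\dots,a_n)$, and let $\mathbb I:so(n)\to so(n)$ be the special inertia operator $\mathbb I(E_i\wedge E_j)=(a_ia_j-D)\,E_i\wedge E_j$, where $E_1,\dots,E_n$ is the standard basis of $\mathbb R^n$. The rubber Chaplygin ball (mass $m$, radius $\rho$) rolling over a fixed sphere of radius $\sigma$ in $\mathbb R^n$ is the nonholonomic system on $\{(g,\mathbf r): g\in SO(n),\ \mathbf r\in\mathbb R^n,\ (\mathbf r,\mathbf r)=(\sigma\pm\rho)^2\}\cong SO(n)\times S^{n-1}$ with Lagrangian $L=\tfrac12\langle\mathbb I\omega,\omega\rangle+\tfrac12 m(\dot{\mathbf r},\dot{\mathbf r})$, $\omega=g^{-1}\dot g$, and constraints (with $\Omega=\dot g g^{-1}$,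 $\mathbf\Gamma=\mathbf r/(\sigma\pm\rho)$) $$\dot{\mathbf r}=\pm\rho\,\Omega\mathbf\Gamma,\qquad \langle\Omega,x\wedge y\rangle=0\ \text{ for all } x,y\perp\mathbf\Gamma ,$$ its motions being the solutions of the Lagrange–d'Alembert equations. The constraints define a principal connection of the bundle $(g,\mathbf r)\mapsto\gamma=g^{-1}\mathbf\Gamma\in S^{n-1}$ with respect to the diagonal left $SO(n)$-action. The reduced Lagrangian $L_{red}(\dot\gamma,\gamma)$ on $TS^{n-1}$ is $L$ evaluated at the horizontal lift of $\dot\gamma$; with $p=\partial L_{red}/\partial\dot\gamma$ the reduced system lives on $$T^*S^{n-1}=\{(\gamma,p)\in\mathbb R^{2n}:(\gamma,\gamma)=1,\ (\gamma,p)=0\}.$$ **Theorem.** The reduced flow on $T^*S^{n-1}$ is given by $$\dot\gamma=\frac{\epsilon^2}{(\gamma,A\gamma)}\bigl(A^{-1}p-(p,A^{-1}\gamma)\gamma\bigr),$$ $$\dot p=\frac{\epsilon(1-\epsilon)}{(\gamma,A\gamma)^2}\bigl((A^{-1}p,p)A\gamma+(p,A^{-1}\gamma)(A\gamma,\gamma)p\bigr)-\frac{\epsilon}{(\gamma,A\gamma)}(p,A^{-1}p)\,\gamma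 .$$ That is, for every motion $(g,\mathbf r)$ of the ball, the momentum $p$ is uniquely determined along it and $(\gamma,p)$ solves these equations on $T^*S^{n-1}$; conversely, for every solution $(\gamma,p)$ on $T^*S^{n-1}$ over an open interval and every configuration over $\gamma(t_0)$, there is a motion of the ball through that configuration at time $t_0$ which projects to $(\gamma,p)$. The equations define a complete flow on $T^*S^{n-1}$, and this flow preserves the measure $$(A\gamma,\gamma)^{\frac{n-2}{2\epsilon}+2-n}\,\mathbf w^{n-1},$$ where $\mathbf w=dp_1\wedge d\gamma_1+\dots+dp_n\wedge d\gamma_n\,|_{T^*S^{n-1}}$ is the canonical symplectic form. -/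

import Mathlib

open Matrix MeasureTheory

-- The norm on matrices is only used to differentiate; all norms give the same derivatives.
attribute [local instance] Matrix.normedAddCommGroup Matrix.normedSpace

noncomputable section

/-! ### Linear algebra of `so(n)` -/

/-- The bivector `x ∧ y = x yᵀ - y xᵀ`, a skew-symmetric matrix. -/
def wedge {n : ℕ} (x y : Fin n → ℝ) : Matrix (Fin n) (Fin n) ℝ :=
  vecMulVec x y - vecMulVec y x

/-- The invariant scalar product `⟨X, Y⟩ = -(1/2) tr (X Y)` on `so(n)`. -/
def killing {n : ℕ} (X Y : Matrix (Fin n) (Fin n) ℝ) : ℝ :=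
  -(1 / 2) * (X * Y).trace

/-- The special inertia operator, given in the basis `E_i ∧ E_j` of `so(n)` by
`E_i ∧ E_j ↦ (a_i a_j - D) E_i ∧ E_j` (see `specialInertia_wedge`); it acts entrywise. -/
def specialInertia {n : ℕ} (a : Fin n → ℝ) (D : ℝ) (X : Matrix (Fin n) (Fin n) ℝ) :
    Matrix (Fin n) (Fin n) ℝ :=
  Matrix.of fun i j => (a i * a j - D) * X i j

theorem specialInertia_wedge {n : ℕ} (a : Fin n → ℝ) (D : ℝ) (i j : Fin n) :
    specialInertia a D (wedge (Pi.single i 1) (Pi.single j 1)) =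
      (a i * a j - D) • wedge (Pi.single i 1) (Pi.single j 1) := by
  ext k l
  simp only [specialInertia, wedge, vecMulVec_apply, Matrix.of_apply, Matrix.sub_apply,
    Matrix.smul_apply, Pi.single_apply, smul_eq_mul]
  split_ifs <;> subst_vars <;> ring

/-! ### The rubber Chaplygin ball rolling over a sphere in `ℝⁿ` -/

/-- The data of the problem: mass `mass` and radius `ρ` of the rolling ball, radius `σ` of the
fixed sphere, and the parameters `a` of the inertia operator. The sign `sgn = 1` is rolling over
the outer surface; `sgn = -1` is rolling over the inner surface (`σ > ρ`), or a spherical shell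
rolling with the fixed sphere in its interior (`σ < ρ`). -/
structure RubberBall (n : ℕ) where
  mass : ℝ
  ρ : ℝ
  σ : ℝ
  sgn : ℝ
  a : Fin n → ℝ
  mass_pos : 0 < mass
  ρ_pos : 0 < ρ
  σ_pos : 0 < σ
  sgn_eq : sgn = 1 ∨ sgn = -1
  ne_zero : σ + sgn * ρ ≠ 0
  a_pos : ∀ i, 0 < a i

/-- The linear space containing the configuration space: pairs `(g, r)` of a matrix and a
vector. -/
abbrev Amb (n : ℕ) : Type := Matrix (Fin n) (Fin n) ℝ × (Fin n → ℝ)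

/-- For a Lagrangian `L (q, q̇)` and a curve `q`, the value on `δ` of
`d/dt (∂L/∂q̇) - ∂L/∂q` at time `t`. -/
def eulerLagrange {C : Type*} [NormedAddCommGroup C] [NormedSpace ℝ C]
    (L : C → C → ℝ) (q : ℝ → C) (t : ℝ) (δ : C) : ℝ :=
  deriv (fun τ => fderiv ℝ (L (q τ)) (deriv q τ) δ) t
    - fderiv ℝ (fun x => L x (deriv q t)) (q t) δ

namespace RubberBall

variable {n : ℕ} (B : RubberBall n)

/-- `D = m ρ²`. -/
def D : ℝ := B.mass * B.ρ ^ 2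

/-- `ε = σ / (σ ± ρ)`. -/
def ε : ℝ := B.σ / (B.σ + B.sgn * B.ρ)

/-- `A = diag (a_1, …, a_n)`. -/
def A : Matrix (Fin n) (Fin n) ℝ := Matrix.diagonal B.a

/-- The configuration space `SO(n) × S^{n-1}`: the rotation matrix `g` of the ball and the
position `r` of its centre, `(r, r) = (σ ± ρ)²`. -/
def config : Set (Amb n) :=
  {q | q.1 ∈ Matrix.specialOrthogonalGroup (Fin n) ℝ ∧
    q.2 ⬝ᵥ q.2 = (B.σ + B.sgn * B.ρ) ^ 2}

/-- The unit normal `Γ = r / (σ ± ρ)` at the contact point, in the fixed frame. -/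
def Γ (q : Amb n) : Fin n → ℝ := (B.σ + B.sgn * B.ρ)⁻¹ • q.2

/-- The constraint distribution at `q = (g, r)`: the velocities `u = (ġ, ṙ)` such that
`Ω = ġ g⁻¹` is in `so(n)` (so `ġ` is tangent to `SO(n)`), there is no slipping,
`ṙ = ± ρ Ω Γ`, and no twisting: `⟨Ω, x ∧ y⟩ = 0` for all `x, y` orthogonal to `Γ`. -/
def distribution (q : Amb n) : Set (Amb n) :=
  {u | (u.1 * q.1⁻¹)ᵀ = -(u.1 * q.1⁻¹) ∧
    u.2 = (B.sgn * B.ρ) • ((u.1 * q.1⁻¹) *ᵥ B.Γ q) ∧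
    ∀ x y : Fin n → ℝ, x ⬝ᵥ B.Γ q = 0 → y ⬝ᵥ B.Γ q = 0 →
      killing (u.1 * q.1⁻¹) (wedge x y) = 0}

/-- The Lagrangian `(1/2) ⟨𝕀 ω, ω⟩ + (1/2) m (ṙ, ṙ)`, where `ω = g⁻¹ ġ` is the angular velocity
in the body frame. It is written with `gᵀ`, which is `g⁻¹` on `SO(n)`. -/
def lagrangian (q u : Amb n) : ℝ :=
  1 / 2 * killing (specialInertia B.a B.D (q.1ᵀ * u.1)) (q.1ᵀ * u.1)
    + 1 / 2 * B.mass * (u.2 ⬝ᵥ u.2)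

/-- A motion of the rubber Chaplygin ball on the time set `J`: a `C²` curve in the configuration
space that satisfies the constraints and the Lagrange-d'Alembert equations, i.e. the reaction
force annihilates the constraint distribution. -/
def IsMotionOn (J : Set ℝ) (q : ℝ → Amb n) : Prop :=
  ContDiffOn ℝ 2 q J ∧
    ∀ t ∈ J, q t ∈ B.config ∧ deriv q t ∈ B.distribution (q t) ∧
      ∀ δ ∈ B.distribution (q t), eulerLagrange B.lagrangian q t δ = 0

/-- The projection `π (g, r) = g⁻¹ r / (σ ± ρ) = g⁻¹ Γ` of the principal `SO(n)`-bundle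
`SO(n) × S^{n-1} → S^{n-1}`. It is written with `gᵀ`, which is `g⁻¹` on `SO(n)`. -/
def proj (q : Amb n) : Fin n → ℝ := q.1ᵀ *ᵥ B.Γ q

/-- `p ∈ T*S^{n-1}`, over the point `π q`, is the momentum `∂L_red/∂γ̇` of the reduced system at
the state `(q, u)`, `u` in the constraint distribution. As `dπ` maps the distribution at `q` onto
the tangent space of the sphere, with the horizontal lift as its inverse, and the reduced
Lagrangian is `L_red (γ̇, γ) = L` at the horizontal lift of `γ̇`, this says
`(p, dπ η) = (∂L/∂q̇) (η)` for all `η` in the distribution. -/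
def IsReducedMomentum (q u : Amb n) (p : Fin n → ℝ) : Prop :=
  p ⬝ᵥ B.proj q = 0 ∧
    ∀ η ∈ B.distribution q, p ⬝ᵥ fderiv ℝ B.proj q η = fderiv ℝ (B.lagrangian q) u η

/-! ### The explicit equations -/

/-- `γ̇ = ε² / (γ, Aγ) (A⁻¹ p - (p, A⁻¹ γ) γ)`. -/
def fieldγ (γ p : Fin n → ℝ) : Fin n → ℝ :=
  (B.ε ^ 2 / (γ ⬝ᵥ B.A *ᵥ γ)) • (B.A⁻¹ *ᵥ p - (p ⬝ᵥ B.A⁻¹ *ᵥ γ) • γ)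

/-- `ṗ = ε (1 - ε) / (γ, Aγ)² ((A⁻¹ p, p) Aγ + (p, A⁻¹ γ) (Aγ, γ) p) - ε / (γ, Aγ) (p, A⁻¹ p) γ`. -/
def fieldp (γ p : Fin n → ℝ) : Fin n → ℝ :=
  (B.ε * (1 - B.ε) / (γ ⬝ᵥ B.A *ᵥ γ) ^ 2) •
      (((B.A⁻¹ *ᵥ p) ⬝ᵥ p) • B.A *ᵥ γ + ((p ⬝ᵥ B.A⁻¹ *ᵥ γ) * ((B.A *ᵥ γ) ⬝ᵥ γ)) • p)
    - (B.ε / (γ ⬝ᵥ B.A *ᵥ γ) * (p ⬝ᵥ B.A⁻¹ *ᵥ p)) • γ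

/-- The density `(Aγ, γ)^{(n-2)/(2ε) + 2 - n}`. -/
def density (γ : Fin n → ℝ) : ℝ :=
  ((B.A *ᵥ γ) ⬝ᵥ γ) ^ (((n : ℝ) - 2) / (2 * B.ε) + 2 - n)

end RubberBall

/-! ### The cotangent bundle of the sphere -/

/-- `T*S^{n-1}`, realized in `ℝ²ⁿ` by `(γ, γ) = 1`, `(γ, p) = 0`; points are pairs `(γ, p)`. -/
def cotSphere (n : ℕ) : Set ((Fin n → ℝ) × (Fin n → ℝ)) :=
  {z | z.1 ⬝ᵥ z.1 = 1 ∧ z.1 ⬝ᵥ z.2 = 0}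

/-- The symplectic form `w = ∑ dp_i ∧ dγ_i` on the space `ℝ²ⁿ` of pairs `(γ, p)`. -/
def canonicalForm {n : ℕ} (v v' : (Fin n → ℝ) × (Fin n → ℝ)) : ℝ :=
  ∑ i, (v.2 i * v'.1 i - v.1 i * v'.2 i)

/-- The `k`-th exterior power `b ∧ ⋯ ∧ b` of an alternating form `b` of degree two, on
`2k` vectors, which are indexed by `Fin k × Fin 2`. -/
def formPow {E : Type*} (b : E → E → ℝ) (k : ℕ) (v : Fin k × Fin 2 → E) : ℝ :=
  ((2 : ℝ) ^ k)⁻¹ * ∑ s : Equiv.Perm (Fin k × Fin 2),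
    ((Equiv.Perm.sign s : ℤ) : ℝ) * ∏ i : Fin k, b (v (s (i, 0))) (v (s (i, 1)))

/-- `ν` is the measure `|Θ|` on the submanifold `M` of `E` defined by the form `Θ` of top degree:
in each local `C¹` parametrization `x : U → M` it has the density `|Θ (∂₁x, …, ∂_d x)|` with
respect to Lebesgue measure. -/
def IsMeasureOfForm {E ι : Type*} [NormedAddCommGroup E] [NormedSpace ℝ E] [MeasurableSpace E]
    [Fintype ι] [DecidableEq ι] (M : Set E) (Θ : E → (ι → E) → ℝ) (ν : Measure M) : Prop :=
  ∀ (U : Set (ι → ℝ)) (x : (ι → ℝ) → E), IsOpen U → ContDiffOn ℝ 1 x U → Set.InjOn x U →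
    Set.MapsTo x U M → (∀ u ∈ U, Function.Injective (fderiv ℝ x u)) →
    ∀ S : Set (ι → ℝ), MeasurableSet S → S ⊆ U →
      ν (Subtype.val ⁻¹' (x '' S)) =
        ∫⁻ u in S, ENNReal.ofReal |Θ (x u) (fun i => fderiv ℝ x u (Pi.single i 1))|

namespace RubberBall

variable {n : ℕ} (B : RubberBall n)

/-- `(γ, p)` is, on the time set `J`, a curve on `T*S^{n-1}` that solves the explicit
equations. -/
def IsSolutionOn (J : Set ℝ) (γ p : ℝ → Fin n → ℝ) : Prop :=
  ∀ t ∈ J, (γ t, p t) ∈ cotSphere n ∧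
    HasDerivAt γ (B.fieldγ (γ t) (p t)) t ∧ HasDerivAt p (B.fieldp (γ t) (p t)) t

/-- `Φ` is the (complete) flow of the explicit equations on `T*S^{n-1}`. -/
def IsFlow (Φ : ℝ → cotSphere n → cotSphere n) : Prop :=
  ∀ z, Φ 0 z = z ∧
    B.IsSolutionOn Set.univ (fun t => (Φ t z).1.1) (fun t => (Φ t z).1.2)

/-- The volume form `(Aγ, γ)^{(n-2)/(2ε) + 2 - n} w^{n-1}` at the point `z = (γ, p)`. -/
def volumeForm (z : (Fin n → ℝ) × (Fin n → ℝ))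
    (v : Fin (n - 1) × Fin 2 → (Fin n → ℝ) × (Fin n → ℝ)) : ℝ :=
  B.density z.1 * formPow canonicalForm (n - 1) v

end RubberBall

end

/-! ### Global solutions and flows of Lipschitz fields -/

section GlobalODE

open Set Metric
open scoped NNReal Topology

variable {E : Type*} [NormedAddCommGroup E] [NormedSpace ℝ E]

/-! Reduction. A skew matrix Ω that vanishes on pairs of vectors orthogonal to Γ equals (ΩΓ) ∧ Γ. An
admissible velocity is therefore given by one vector w ⊥ γ: the body angular velocity is w ∧ γ and ṙ
= ±ρ g w (`mem_distribution_iff`). Differentiating γ = g⁻¹Γ gives γ̇ = -ε w. The inertia operator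
sends w ∧ γ to Aw ∧ Aγ - D w ∧ γ, and the term with D cancels against the kinetic energy of the
centre because D = mρ². Hence p = -ε⁻¹((γ, Aγ)Aw - (w, Aγ)Aγ), and inverting this on (γ, p) = 0
gives the first equation. On the horizontal vector of x ⊥ γ the Euler-Lagrange expression is -ε (x,
ṗ - F), with F the right hand side of the second equation (`eulerLagrange_lift`); the component of ṗ
along γ comes from differentiating (γ, p) = 0. Conversely, a solution determines w = -ε⁻¹γ̇; solving
ġ = g (w ∧ γ) in SO(n) and putting r = (σ ± ρ) gγ gives the motion.

Completeness and invariant measure. The field is extended to the pairs (x, y) with x ≠ 0 so that it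
commutes with the symplectic maps (x, y) ↦ (eʳx, e⁻ʳ(y + sx)) (`ambientField_scaleShear`). The
extension conserves (x, x), (x, y) and an energy. Bounds on these, with (x, x) away from zero,
confine (x, y) to a compact set, so a cutoff function of them makes the field C¹ with compact
support, hence complete, without changing the trajectories on which the cutoff is one. The
divergence of the extension is a multiple of the logarithmic derivative of (x, Ax) along it, and the
exponent of the density is the one for which the two cancel. Liouville's theorem
(`measurePreserving_flow`) applies.

Descent to T*S^{n-1}. The maps with 0 < r, s < 1 sweep out a tube around T*S^{n-1} on which the flow
moves only the point of T*S^{n-1} and the density does not depend on r, s. So the weighted volume of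
the tube over a set is an invariant measure (`measurePreserving_explicitFlow`). The r and s
directions span the symplectic complement of the tangent space. In a symplectic frame adapted to
this splitting the Jacobian of the tube is, up to sign and a constant, w^{n-1} on the tangent frame
(`abs_det_tubeDeriv`). The constants need not be evaluated, since multiples of an invariant measure
are invariant. -/

theorem exists_ode_solution_Icc [CompleteSpace E] {f : ℝ → E → E} {a b t₀ : ℝ}
    (ht₀ : t₀ ∈ Icc a b) {K L : ℝ≥0} (hK : ∀ t ∈ Icc a b, LipschitzWith K (f t))
    (hL : ∀ t ∈ Icc a b, ∀ x, ‖f t x‖ ≤ L) (hc : ∀ x, ContinuousOn (f · x) (Icc a b)) (x₀ : E) :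
    ∃ α : ℝ → E, α t₀ = x₀ ∧
      ∀ t ∈ Icc a b, HasDerivWithinAt α (f t (α t)) (Icc a b) t := by
  have hm : 0 ≤ max (b - t₀) (t₀ - a) := le_max_of_le_left (sub_nonneg.2 ht₀.2)
  refine IsPicardLindelof.exists_eq_forall_mem_Icc_hasDerivWithinAt₀ (t₀ := ⟨t₀, ht₀⟩)
    -- This radius is the largest distance that a curve of speed at most `L` can travel in the
    -- interval, so Picard–Lindelöf applies to the whole interval at once.
    (a := L * (max (b - t₀) (t₀ - a)).toNNReal) (L := L) (K := K)
    ⟨fun t ht => (hK t ht).lipschitzOnWith, fun x _ => hc x, fun t ht x _ => hL t ht x, ?_⟩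
  simp [Real.coe_toNNReal _ hm]

theorem ode_solution_eq {f : ℝ → E → E} {a b a' b' t₀ t : ℝ} {K : ℝ≥0}
    (hK : ∀ t ∈ Icc a b, LipschitzWith K (f t)) {α β : ℝ → E}
    (hα : ∀ t ∈ Ioo a b, HasDerivAt α (f t (α t)) t)
    (hβ : ∀ t ∈ Ioo a' b', HasDerivAt β (f t (β t)) t)
    (h₀ : t₀ ∈ Ioo a b ∩ Ioo a' b') (h : α t₀ = β t₀) (ht : t ∈ Ioo a b ∩ Ioo a' b') :
    α t = β t := by
  rw [Ioo_inter_Ioo] at h₀ ht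
  have h1 : Ioo (max a a') (min b b') ⊆ Ioo a b :=
    Ioo_subset_Ioo (le_max_left _ _) (min_le_left _ _)
  have h2 : Ioo (max a a') (min b b') ⊆ Ioo a' b' :=
    Ioo_subset_Ioo (le_max_right _ _) (min_le_right _ _)
  exact ODE_solution_unique_of_mem_Ioo (v := f) (s := fun _ => univ) (K := K)
    (fun s hs => (hK s (Ioo_subset_Icc_self (h1 hs))).lipschitzOnWith) h₀
    (fun s hs => ⟨hα s (h1 hs), mem_univ _⟩) (fun s hs => ⟨hβ s (h2 hs), mem_univ _⟩) h ht

theorem exists_Icc_subset_of_isOpen {J : Set ℝ} (hJ : IsOpen J) (hJ' : J.OrdConnected)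
    {t₀ t : ℝ} (h₀ : t₀ ∈ J) (ht : t ∈ J) :
    ∃ a b, Icc a b ⊆ J ∧ t₀ ∈ Ioo a b ∧ t ∈ Ioo a b := by
  have key : ∀ s ∈ J, ∃ l ∈ J, ∃ u ∈ J, l < s ∧ s < u := by
    intro s hs
    obtain ⟨l, u, ⟨h1, h2⟩, h3⟩ := mem_nhds_iff_exists_Ioo_subset.1 (hJ.mem_nhds hs)
    refine ⟨(l + s) / 2, h3 ⟨?_, ?_⟩, (s + u) / 2, h3 ⟨?_, ?_⟩, ?_, ?_⟩ <;> linarith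
  obtain ⟨l, hl, -, -, hl', -⟩ := key (min t₀ t) (by rcases min_choice t₀ t with h | h <;> rwa [h])
  obtain ⟨-, -, u, hu, -, hu'⟩ := key (max t₀ t) (by rcases max_choice t₀ t with h | h <;> rwa [h])
  exact ⟨l, u, hJ'.out hl hu, ⟨(lt_min_iff.1 hl').1, (max_lt_iff.1 hu').1⟩,
    ⟨(lt_min_iff.1 hl').2, (max_lt_iff.1 hu').2⟩⟩

/-- Global solutions, on an open interval, of an ordinary differential equation whose right hand
side is bounded and Lipschitz, uniformly on compact time intervals. -/
theorem exists_ode_solution [CompleteSpace E] {f : ℝ → E → E} {J : Set ℝ} (hJ : IsOpen J)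
    (hJ' : J.OrdConnected)
    (hf : ∀ a b, Icc a b ⊆ J → ∃ K L : ℝ≥0, ∀ t ∈ Icc a b,
      LipschitzWith K (f t) ∧ ∀ x, ‖f t x‖ ≤ L)
    (hc : ∀ x, ContinuousOn (f · x) J) {t₀ : ℝ} (ht₀ : t₀ ∈ J) (x₀ : E) :
    ∃ α : ℝ → E, α t₀ = x₀ ∧ ∀ t ∈ J, HasDerivAt α (f t (α t)) t := by
  have key : ∀ t : J, ∃ (a b : ℝ) (α : ℝ → E), Icc a b ⊆ J ∧ t₀ ∈ Ioo a b ∧ t.1 ∈ Ioo a b ∧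
      α t₀ = x₀ ∧ ∀ s ∈ Ioo a b, HasDerivAt α (f s (α s)) s := by
    rintro ⟨t, ht⟩
    obtain ⟨a, b, hab, h1, h2⟩ := exists_Icc_subset_of_isOpen hJ hJ' ht₀ ht
    obtain ⟨K, L, hKL⟩ := hf a b hab
    obtain ⟨α, hα, hα'⟩ := exists_ode_solution_Icc (Ioo_subset_Icc_self h1)
      (fun t ht => (hKL t ht).1) (fun t ht => (hKL t ht).2) (fun x => (hc x).mono hab) x₀
    exact ⟨a, b, α, hab, h1, h2, hα, fun s hs =>
      (hα' s (Ioo_subset_Icc_self hs)).hasDerivAt (Icc_mem_nhds hs.1 hs.2)⟩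
  choose a b α hab h0 h1 h2 h3 using key
  classical
  -- The value at `t` is that of the local solution chosen for `t`; by uniqueness neighbouring
  -- choices agree, so the glued curve is again a solution.
  let β : ℝ → E := fun t => if h : t ∈ J then α ⟨t, h⟩ t else x₀
  have hβ : ∀ (t : J), ∀ s ∈ Ioo (a t) (b t), β s = α t s := by
    intro t s hs
    have hsJ : s ∈ J := hab t (Ioo_subset_Icc_self hs)
    obtain ⟨K, L, hKL⟩ := hf _ _ (hab ⟨s, hsJ⟩)
    simp only [β, hsJ, dif_pos]
    exact ode_solution_eq (fun t ht => (hKL t ht).1) (h3 _) (h3 t) ⟨h0 _, h0 t⟩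
      (by rw [h2, h2]) ⟨h1 ⟨s, hsJ⟩, hs⟩
  refine ⟨β, by rw [hβ ⟨t₀, ht₀⟩ t₀ (h0 _), h2], fun t ht => ?_⟩
  rw [hβ ⟨t, ht⟩ t (h1 _)]
  refine (h3 ⟨t, ht⟩ t (h1 _)).congr_of_eventuallyEq ?_
  filter_upwards [Ioo_mem_nhds (h1 ⟨t, ht⟩).1 (h1 ⟨t, ht⟩).2] with s hs using hβ _ s hs

theorem integralCurve_unique {Y : E → E} {K : ℝ≥0} (hY : LipschitzWith K Y) {α β : ℝ → E}
    (hα : ∀ t, HasDerivAt α (Y (α t)) t) (hβ : ∀ t, HasDerivAt β (Y (β t)) t) {t₀ : ℝ}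
    (h : α t₀ = β t₀) : α = β :=
  ODE_solution_unique_univ (v := fun _ => Y) (s := fun _ => univ)
    (fun _ => hY.lipschitzOnWith) (fun t => ⟨hα t, mem_univ _⟩) (fun t => ⟨hβ t, mem_univ _⟩) h

/-- A bounded Lipschitz vector field is complete. -/
theorem exists_flow [CompleteSpace E] {Y : E → E} {K L : ℝ≥0} (hY : LipschitzWith K Y)
    (hL : ∀ x, ‖Y x‖ ≤ L) :
    ∃ φ : ℝ → E → E, (∀ x, φ 0 x = x) ∧ ∀ x t, HasDerivAt (fun s => φ s x) (Y (φ t x)) t := by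
  have := fun x₀ : E => exists_ode_solution (f := fun _ => Y) isOpen_univ ordConnected_univ
    (fun a b _ => ⟨K, L, fun t _ => ⟨hY, hL⟩⟩) (fun x => continuousOn_const) (mem_univ 0) x₀
  choose α h0 h1 using this
  exact ⟨fun t x => α x t, h0, fun x t => h1 x t (mem_univ t)⟩

section Flow

variable {Y : E → E} {K : ℝ≥0} {φ : ℝ → E → E}

theorem flow_add (hY : LipschitzWith K Y) (h0 : ∀ x, φ 0 x = x)
    (h1 : ∀ x t, HasDerivAt (fun s => φ s x) (Y (φ t x)) t) (s t : ℝ) (x : E) :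
    φ (s + t) x = φ s (φ t x) := by
  have h2 : ∀ r, HasDerivAt (fun r => φ (r + t) x) (Y (φ (r + t) x)) r := fun r =>
    (h1 x (r + t)).comp_add_const r t
  exact congrFun (integralCurve_unique hY h2 (h1 (φ t x)) (t₀ := 0) (by simp [h0])) s

/-- Grönwall's inequality for positive times, time reversal for negative ones. In the proof of
Liouville's theorem this replaces differentiability of the flow in the initial point. -/
theorem flow_lipschitzWith (hY : LipschitzWith K Y) (h0 : ∀ x, φ 0 x = x)
    (h1 : ∀ x t, HasDerivAt (fun s => φ s x) (Y (φ t x)) t) (t : ℝ) :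
    ∃ C : ℝ≥0, LipschitzWith C (φ t) := by
  have key : ∀ (Z : E → E) (ψ : ℝ → E → E), LipschitzWith K Z → (∀ x, ψ 0 x = x) →
      (∀ x t, HasDerivAt (fun s => ψ s x) (Z (ψ t x)) t) → ∀ t, 0 ≤ t →
      ∃ C : ℝ≥0, LipschitzWith C (ψ t) := by
    intro Z ψ hZ h0 h1 t ht
    refine ⟨(Real.exp (K * t)).toNNReal, LipschitzWith.of_dist_le_mul fun x y => ?_⟩
    rw [Real.coe_toNNReal _ (Real.exp_pos _).le, mul_comm]
    have hc : ∀ x, Continuous fun s => ψ s x := fun x =>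
      continuous_iff_continuousAt.2 fun s => (h1 x s).continuousAt
    have := dist_le_of_trajectories_ODE (v := fun _ => Z) (a := 0) (b := t) (fun _ => hZ)
      (hc x).continuousOn (fun s _ => (h1 x s).hasDerivWithinAt) (hc y).continuousOn
      (fun s _ => (h1 y s).hasDerivWithinAt) (by rw [h0, h0]) t ⟨ht, le_rfl⟩
    simpa using this
  rcases le_total 0 t with ht | ht
  · exact key Y φ hY h0 h1 t ht
  · have := key (fun x => -Y x) (fun s => φ (-s)) hY.neg (by simpa using h0) (fun x s => by
      simpa [Function.comp_def] using (h1 x (-s)).scomp s (hasDerivAt_neg s)) (-t) (by linarith)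
    simpa using this

end Flow

end GlobalODE

/-! ### Liouville's theorem in weak form -/

section Liouville

open Set Filter
open scoped NNReal Topology

variable {E : Type*} [NormedAddCommGroup E] [NormedSpace ℝ E]

/-- The divergence of a vector field on a normed space. -/
noncomputable def divergence (X : E → E) (x : E) : ℝ :=
  LinearMap.trace ℝ E (fderiv ℝ X x : E →ₗ[ℝ] E)

theorem divergence_eq_sum [FiniteDimensional ℝ E] {ι : Type*} [Fintype ι] [DecidableEq ι]
    (b : Module.Basis ι ℝ E) (X : E → E) (x : E) :
    divergence X x = ∑ i, b.coord i (fderiv ℝ X x (b i)) := by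
  simp [divergence, LinearMap.trace_eq_matrix_trace ℝ b, Matrix.trace, LinearMap.toMatrix_apply]

variable [FiniteDimensional ℝ E] [MeasurableSpace E] [BorelSpace E] {μ : Measure E}
  [μ.IsAddHaarMeasure] {Y : E → E} {w : E → ℝ} {K L : ℝ≥0} {φ : ℝ → E → E}

/-- Differentiation under the integral gives ∫ dG(Y) w, which is -∫ G div(wY) = 0 by parts. Test
functions are only Lipschitz because they will be composed with the flow; Rademacher's theorem
supplies dG almost everywhere. -/
theorem hasDerivAt_integral_comp_flow_zero (hY : LipschitzWith K Y) (hL : ∀ x, ‖Y x‖ ≤ L)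
    (h0 : ∀ x, φ 0 x = x) (h1 : ∀ x t, HasDerivAt (fun s => φ s x) (Y (φ t x)) t)
    (hw : Continuous w) (hws : HasCompactSupport w) (hwY : ContDiff ℝ 1 fun x => w x • Y x)
    (hdiv : ∀ x, divergence (fun x => w x • Y x) x = 0) {C : ℝ≥0} {G : E → ℝ}
    (hG : LipschitzWith C G) :
    HasDerivAt (fun h => ∫ x, G (φ h x) * w x ∂μ) 0 0 := by
  let b := Module.finBasis ℝ E
  let g : Fin (Module.finrank ℝ E) → E → ℝ := fun i x => b.coord i (w x • Y x)
  have hg : ∀ i, ContDiff ℝ 1 (g i) := fun i =>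
    (LinearMap.toContinuousLinearMap (b.coord i)).contDiff.comp hwY
  have hgs : ∀ i, HasCompactSupport (g i) := fun i => by
    refine hws.mono' fun x hx => subset_tsupport _ ?_
    contrapose! hx
    simp_all [g]
  -- Directional derivatives make the integrand dG(Y) w measurable and defined at every point.
  let F' : E → ℝ := fun x => ∑ i, lineDeriv ℝ G x (b i) * g i x
  have hF' : ∀ x, DifferentiableAt ℝ G x → F' x = fderiv ℝ G x (Y x) * w x := by
    intro x hx
    conv_rhs => rw [← b.sum_repr (Y x)]
    simp only [F', g, hx.lineDeriv_eq_fderiv, map_sum, map_smul, Finset.sum_mul, smul_eq_mul,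
      Module.Basis.coord_apply]
    exact Finset.sum_congr rfl fun i _ => by ring
  have hphi : ∀ x, LipschitzWith L fun h => φ h x := fun x =>
    lipschitzWith_of_nnnorm_deriv_le (fun t => (h1 x t).differentiableAt) fun t => by
      rw [(h1 x t).deriv]; exact hL _
  have hcont : ∀ h, Continuous (φ h) := fun h =>
    let ⟨_, hC⟩ := flow_lipschitzWith hY h0 h1 h
    hC.continuous
  have hcs : ∀ {f : E → ℝ}, HasCompactSupport fun x => f x * w x := fun {f} =>
    hws.mul_left
  have hderiv : HasDerivAt (fun h => ∫ x, G (φ h x) * w x ∂μ) (∫ x, F' x ∂μ) 0 := by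
    refine (hasDerivAt_integral_of_dominated_loc_of_lip (bound := fun x => C * L * |w x|)
      (s := univ) univ_mem ?_ ?_ ?_ ?_ ?_ ?_).2
    · exact Eventually.of_forall fun h =>
        ((hG.continuous.comp (hcont h)).mul hw).aestronglyMeasurable
    · exact ((hG.continuous.comp (hcont 0)).mul hw).integrable_of_hasCompactSupport hcs
    · refine (Finset.measurable_sum _ fun i _ => ?_).aestronglyMeasurable
      exact (measurable_lineDeriv hG.continuous).mul (hg i).continuous.measurable
    · refine Eventually.of_forall fun x => LipschitzOnWith.of_dist_le_mul fun s _ t _ => ?_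
      have h2 := (hG.comp (hphi x)).dist_le_mul s t
      rw [Real.dist_eq, ← sub_mul, abs_mul, Real.coe_nnabs,
        abs_of_nonneg (show (0 : ℝ) ≤ C * L * |w x| by positivity)]
      rw [Real.dist_eq] at h2
      calc _ ≤ (C * L : ℝ≥0) * dist s t * |w x| := by gcongr; exact h2
        _ = _ := by push_cast; ring
    · exact (hw.abs.integrable_of_hasCompactSupport (hws.comp_left abs_zero)).const_mul _
    · filter_upwards [hG.ae_differentiableAt (μ := μ)] with x hx
      rw [hF' x hx]
      have h2 : HasFDerivAt G (fderiv ℝ G x) (φ 0 x) := by rw [h0]; exact hx.hasFDerivAt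
      have h3 := h1 x 0
      rw [h0] at h3
      exact (h2.comp_hasDerivAt 0 h3).mul_const _
  have hzero : ∫ x, F' x ∂μ = 0 := by
    have hdg : ∀ i x, fderiv ℝ (g i) x (b i) =
        b.coord i (fderiv ℝ (fun x => w x • Y x) x (b i)) := by
      intro i x
      have := ((LinearMap.toContinuousLinearMap (b.coord i)).hasFDerivAt.comp x
        ((hwY.differentiable (by norm_num)) x).hasFDerivAt).fderiv
      exact congrArg (fun l => l (b i)) this
    have hint : ∀ i, Integrable (fun x => fderiv ℝ (g i) x (b i) * G x) μ := fun i => by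
      refine Continuous.integrable_of_hasCompactSupport ?_ ?_
      · exact (((hg i).continuous_fderiv (by norm_num)).clm_apply continuous_const).mul
          hG.continuous
      · exact HasCompactSupport.mul_right ((hgs i).fderiv_apply (𝕜 := ℝ) (b i))
    calc ∫ x, F' x ∂μ = ∑ i, ∫ x, lineDeriv ℝ G x (b i) * g i x ∂μ := by
          refine integral_finsetSum _ fun i _ => Integrable.bdd_mul (c := C * ‖b i‖)
            ((hg i).continuous.integrable_of_hasCompactSupport (hgs i))
            (measurable_lineDeriv hG.continuous).aestronglyMeasurable
            (Eventually.of_forall fun x => norm_lineDeriv_le_of_lipschitz ℝ hG)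
      _ = ∑ i, ∫ x, -(fderiv ℝ (g i) x (b i) * G x) ∂μ := by
          refine Finset.sum_congr rfl fun i _ => ?_
          obtain ⟨D, hD⟩ := (hg i).lipschitzWith_of_hasCompactSupport (hgs i) (by norm_num)
          rw [hG.integral_lineDeriv_mul_eq hD (hgs i)]
          refine integral_congr_ae (Eventually.of_forall fun x => ?_)
          simp [((hg i).differentiable (by norm_num) x).lineDeriv_eq_fderiv]
      _ = ∫ x, ∑ i, -(fderiv ℝ (g i) x (b i) * G x) ∂μ :=
          (integral_finsetSum _ fun i _ => (hint i).neg).symm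
      _ = ∫ x, -(divergence (fun x => w x • Y x) x * G x) ∂μ := by
          refine integral_congr_ae (Eventually.of_forall fun x => ?_)
          simp only [hdg, divergence_eq_sum b, Finset.sum_mul, Finset.sum_neg_distrib]
      _ = 0 := by simp [hdiv]
  rwa [hzero] at hderiv

/-- By the group law the derivative at time `t` is the derivative at time zero for `G ∘ φ t`, which
is again Lipschitz. -/
theorem integral_comp_flow (hY : LipschitzWith K Y) (hL : ∀ x, ‖Y x‖ ≤ L)
    (h0 : ∀ x, φ 0 x = x) (h1 : ∀ x t, HasDerivAt (fun s => φ s x) (Y (φ t x)) t)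
    (hw : Continuous w) (hws : HasCompactSupport w) (hwY : ContDiff ℝ 1 fun x => w x • Y x)
    (hdiv : ∀ x, divergence (fun x => w x • Y x) x = 0) {C : ℝ≥0} {G : E → ℝ}
    (hG : LipschitzWith C G) (t : ℝ) :
    ∫ x, G (φ t x) * w x ∂μ = ∫ x, G x * w x ∂μ := by
  have key : ∀ t, HasDerivAt (fun t => ∫ x, G (φ t x) * w x ∂μ) 0 t := by
    intro t
    obtain ⟨D, hD⟩ := flow_lipschitzWith hY h0 h1 t
    have h2 := hasDerivAt_integral_comp_flow_zero (μ := μ) hY hL h0 h1 hw hws hwY hdiv (hG.comp hD)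
    have h3 : (fun t => ∫ x, G (φ t x) * w x ∂μ) =
        fun s => ∫ x, (G ∘ φ t) (φ (s - t) x) * w x ∂μ := by
      funext s
      simp only [Function.comp, ← flow_add hY h0 h1, add_sub_cancel]
    rw [h3]
    have h4 : HasDerivAt (fun s => ∫ x, (G ∘ φ t) (φ s x) * w x ∂μ) 0 (t - t) := by
      rw [sub_self]; exact h2
    exact h4.comp_sub_const t t
  have := is_const_of_deriv_eq_zero (fun t => (key t).differentiableAt) (fun t => (key t).deriv) t 0
  simpa [h0] using this

/-- **Liouville's theorem**: the flow of `Y` preserves the measure with density `w` if the field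
`w Y` has zero divergence. -/
theorem measurePreserving_flow (hY : LipschitzWith K Y) (hL : ∀ x, ‖Y x‖ ≤ L)
    (h0 : ∀ x, φ 0 x = x) (h1 : ∀ x t, HasDerivAt (fun s => φ s x) (Y (φ t x)) t)
    (hw : Continuous w) (hw0 : ∀ x, 0 ≤ w x) (hws : HasCompactSupport w)
    (hwY : ContDiff ℝ 1 fun x => w x • Y x)
    (hdiv : ∀ x, divergence (fun x => w x • Y x) x = 0) (t : ℝ) :
    MeasurePreserving (φ t) (μ.withDensity fun x => ENNReal.ofReal (w x))
      (μ.withDensity fun x => ENNReal.ofReal (w x)) := by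
  obtain ⟨D, hD⟩ := flow_lipschitzWith hY h0 h1 t
  have hm : Measurable (φ t) := hD.continuous.measurable
  refine ⟨hm, ?_⟩
  set ν := μ.withDensity fun x => ENNReal.ofReal (w x) with hν
  have hfin : IsFiniteMeasure ν := isFiniteMeasure_withDensity_ofReal
    (hw.integrable_of_hasCompactSupport hws).2
  have hfin' : IsFiniteMeasure (ν.map (φ t)) := Measure.isFiniteMeasure_map _ _
  -- Closed sets generate the Borel sets, and their indicators are limits of Lipschitz thickened
  -- indicators, whose integrals are invariant.
  have key : ∀ F : Set E, IsClosed F → ν.map (φ t) F = ν F := by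
    intro F hF
    have h2 := tendsto_one_div_add_atTop_nhds_zero_nat (𝕜 := ℝ)
    have h3 : ∀ n : ℕ, 0 < 1 / ((n : ℝ) + 1) := fun n => by positivity
    refine tendsto_nhds_unique (tendsto_lintegral_thickenedIndicator_of_isClosed _ hF h3 h2) ?_
    refine (tendsto_lintegral_thickenedIndicator_of_isClosed _ hF h3 h2).congr fun n => ?_
    set f := thickenedIndicator (h3 n) F
    have hf : LipschitzWith (1 * _) fun x => (f x : ℝ) :=
      NNReal.isometry_coe.lipschitz.comp (lipschitzWith_thickenedIndicator (h3 n) F)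
    have hi : ∀ g : E → ℝ, ∫ x, g x ∂ν = ∫ x, g x * w x ∂μ := fun g => by
      rw [hν, integral_withDensity_eq_integral_toReal_smul (by fun_prop)
        (Eventually.of_forall fun _ => ENNReal.ofReal_lt_top)]
      refine integral_congr_ae (Eventually.of_forall fun x => ?_)
      simp [ENNReal.toReal_ofReal (hw0 x), mul_comm]
    rw [← ENNReal.toReal_eq_toReal_iff' (BoundedContinuousFunction.lintegral_lt_top_of_nnreal ν f).ne
      (BoundedContinuousFunction.lintegral_lt_top_of_nnreal _ f).ne,
      BoundedContinuousFunction.toReal_lintegral_coe_eq_integral,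
      BoundedContinuousFunction.toReal_lintegral_coe_eq_integral,
      integral_map hm.aemeasurable hf.continuous.aestronglyMeasurable, hi, hi]
    exact (integral_comp_flow hY hL h0 h1 hw hws hwY hdiv hf t).symm
  refine ext_of_generate_finite _ ?_ isPiSystem_isClosed (fun F hF => key F hF)
    (key univ isClosed_univ)
  rw [BorelSpace.measurable_eq (α := E), borel_eq_generateFrom_isClosed]

end Liouville

/-! ### Derivatives of bilinear and quadratic maps -/

section Bilinear

variable {E F G : Type*} [NormedAddCommGroup E] [NormedSpace ℝ E] [FiniteDimensional ℝ E]
  [NormedAddCommGroup F] [NormedSpace ℝ F] [FiniteDimensional ℝ F]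
  [NormedAddCommGroup G] [NormedSpace ℝ G]

theorem IsBilinearMap.hasDerivAt {f : E → F → G} (hf : IsBilinearMap ℝ f) {u : ℝ → E} {v : ℝ → F}
    {u' : E} {v' : F} {t : ℝ} (hu : HasDerivAt u u' t) (hv : HasDerivAt v v' t) :
    HasDerivAt (fun s => f (u s) (v s)) (f (u t) v' + f u' (v t)) t :=
  by
  have h := hf.toContinuousBilinearMap.isBoundedBilinearMap.hasFDerivAt (u t, v t)
  exact h.comp_hasDerivAt t (hu.prodMk hv)

theorem IsBilinearMap.contDiff {f : E → F → G} (hf : IsBilinearMap ℝ f) {k : WithTop ℕ∞} :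
    ContDiff ℝ k fun z : E × F => f z.1 z.2 :=
  hf.toContinuousBilinearMap.isBoundedBilinearMap.contDiff

theorem IsBilinearMap.hasFDerivAt_quadratic {b : E → E → ℝ} (hb : IsBilinearMap ℝ b)
    (hs : ∀ x y, b x y = b y x) (c : ℝ) (x : E) :
    HasFDerivAt (fun x => 1 / 2 * b x x + c) (hb.toContinuousBilinearMap x) x := by
  have h := (hb.toContinuousBilinearMap.hasFDerivAt_of_bilinear (hasFDerivAt_id x)
    (hasFDerivAt_id x)).const_mul (1 / 2 : ℝ)
  refine (h.add_const c).congr_fderiv ?_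
  ext y
  have h1 : hb.toContinuousBilinearMap y x = hb.toContinuousBilinearMap x y := hs y x
  simp [ContinuousLinearMap.precompR, ContinuousLinearMap.precompL, h1]
  ring

/-- Applied twice to the Lagrangian: it is quadratic in the velocity and, up to a constant,
quadratic in the matrix of the configuration. -/
theorem IsBilinearMap.fderiv_quadratic {b : E → E → ℝ} (hb : IsBilinearMap ℝ b)
    (hs : ∀ x y, b x y = b y x) (c : ℝ) (x y : E) :
    fderiv ℝ (fun x => 1 / 2 * b x x + c) x y = b x y := by
  rw [(hb.hasFDerivAt_quadratic hs c x).fderiv]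
  rfl

end Bilinear

/-! ### Bivectors and the inertia operator -/

section MatrixAlgebra

variable {n : ℕ}

theorem isBilinearMap_dotProduct :
    IsBilinearMap ℝ fun x y : Fin n → ℝ => x ⬝ᵥ y where
  add_left _ _ _ := add_dotProduct _ _ _
  smul_left _ _ _ := smul_dotProduct _ _ _
  add_right _ _ _ := dotProduct_add _ _ _
  smul_right _ _ _ := dotProduct_smul _ _ _

theorem isBilinearMap_mulVec :
    IsBilinearMap ℝ fun (X : Matrix (Fin n) (Fin n) ℝ) (y : Fin n → ℝ) => X *ᵥ y where
  add_left _ _ _ := add_mulVec _ _ _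
  smul_left _ _ _ := smul_mulVec _ _ _
  add_right _ _ _ := mulVec_add _ _ _
  smul_right _ _ _ := mulVec_smul _ _ _

theorem isBilinearMap_matrixMul :
    IsBilinearMap ℝ fun X Y : Matrix (Fin n) (Fin n) ℝ => X * Y where
  add_left _ _ _ := add_mul _ _ _
  smul_left _ _ _ := smul_mul_assoc _ _ _
  add_right _ _ _ := mul_add _ _ _
  smul_right _ _ _ := mul_smul_comm _ _ _

theorem wedge_mulVec (x y z : Fin n → ℝ) :
    wedge x y *ᵥ z = (y ⬝ᵥ z) • x - (x ⬝ᵥ z) • y := by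
  simp [wedge, sub_mulVec, vecMulVec_mulVec]

theorem wedge_transpose (x y : Fin n → ℝ) : (wedge x y)ᵀ = -wedge x y := by
  simp [wedge, transpose_vecMulVec]

theorem mul_wedge_mul_transpose (g : Matrix (Fin n) (Fin n) ℝ) (x y : Fin n → ℝ) :
    g * wedge x y * gᵀ = wedge (g *ᵥ x) (g *ᵥ y) := by
  simp [wedge, mul_sub, sub_mul, mul_vecMulVec, vecMulVec_mul, vecMul_transpose]

theorem killing_comm (X Y : Matrix (Fin n) (Fin n) ℝ) : killing X Y = killing Y X := by
  rw [killing, killing, trace_mul_comm]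

theorem isBilinearMap_killing :
    IsBilinearMap ℝ fun X Y : Matrix (Fin n) (Fin n) ℝ => killing X Y where
  add_left _ _ _ := by simp [killing, add_mul, mul_add]; try ring
  smul_left _ _ _ := by simp [killing]; try ring
  add_right _ _ _ := by simp [killing, mul_add]; try ring
  smul_right _ _ _ := by simp [killing]; try ring

theorem specialInertia_add (a : Fin n → ℝ) (D : ℝ) (X Y : Matrix (Fin n) (Fin n) ℝ) :
    specialInertia a D (X + Y) = specialInertia a D X + specialInertia a D Y := by
  ext i j
  simp [specialInertia, mul_add]

theorem specialInertia_smul (a : Fin n → ℝ) (D c : ℝ) (X : Matrix (Fin n) (Fin n) ℝ) :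
    specialInertia a D (c • X) = c • specialInertia a D X := by
  ext i j
  simp [specialInertia, mul_left_comm]

theorem killing_specialInertia_comm (a : Fin n → ℝ) (D : ℝ) (X Y : Matrix (Fin n) (Fin n) ℝ) :
    killing (specialInertia a D X) Y = killing (specialInertia a D Y) X := by
  rw [killing_comm (specialInertia a D Y)]
  simp only [killing, Matrix.trace, diag_apply, mul_apply, specialInertia, of_apply]
  congr 1
  exact Finset.sum_congr rfl fun i _ => Finset.sum_congr rfl fun j _ => by ring

theorem killing_wedge_left (x y : Fin n → ℝ) (X : Matrix (Fin n) (Fin n) ℝ) :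
    killing (wedge x y) X = 1 / 2 * (x ⬝ᵥ X *ᵥ y - y ⬝ᵥ X *ᵥ x) := by
  simp only [killing, wedge, sub_mul, trace_sub, vecMulVec_mul, trace_vecMulVec]
  rw [dotProduct_comm x, dotProduct_comm y, ← dotProduct_mulVec, ← dotProduct_mulVec]
  ring

theorem dotProduct_mulVec_of_skew {X : Matrix (Fin n) (Fin n) ℝ} (hX : Xᵀ = -X)
    (x y : Fin n → ℝ) : x ⬝ᵥ X *ᵥ y = -(y ⬝ᵥ X *ᵥ x) := by
  rw [dotProduct_mulVec, ← mulVec_transpose, hX, neg_mulVec, neg_dotProduct, dotProduct_comm]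

theorem killing_wedge_of_skew {X : Matrix (Fin n) (Fin n) ℝ} (hX : Xᵀ = -X) (x y : Fin n → ℝ) :
    killing X (wedge x y) = x ⬝ᵥ X *ᵥ y := by
  rw [killing_comm, killing_wedge_left, dotProduct_mulVec_of_skew hX y x]
  ring

/-- Split both arguments of (x, Xy) into components along and orthogonal to `u`; only the mixed
terms survive. This is how the no-twist constraint leaves ΩΓ as the only freedom. -/
theorem eq_wedge_of_skew {X : Matrix (Fin n) (Fin n) ℝ} (hX : Xᵀ = -X) {u : Fin n → ℝ}
    (hu : u ⬝ᵥ u = 1) (h : ∀ x y : Fin n → ℝ, x ⬝ᵥ u = 0 → y ⬝ᵥ u = 0 → x ⬝ᵥ X *ᵥ y = 0) :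
    X = wedge (X *ᵥ u) u := by
  have key : ∀ x y : Fin n → ℝ, x ⬝ᵥ X *ᵥ y = x ⬝ᵥ wedge (X *ᵥ u) u *ᵥ y := by
    intro x y
    have h1 := h (x - (x ⬝ᵥ u) • u) (y - (y ⬝ᵥ u) • u) (by simp [sub_dotProduct, hu])
      (by simp [sub_dotProduct, hu])
    have h2 : u ⬝ᵥ X *ᵥ u = 0 := by linarith [dotProduct_mulVec_of_skew hX u u]
    have h3 := dotProduct_mulVec_of_skew hX u y
    have h4 : X *ᵥ u ⬝ᵥ y = y ⬝ᵥ X *ᵥ u := dotProduct_comm _ _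
    have h5 := dotProduct_comm u y
    simp only [sub_dotProduct, mulVec_sub, dotProduct_sub, mulVec_smul, dotProduct_smul,
      smul_dotProduct, smul_eq_mul, h2, h3] at h1
    simp only [wedge_mulVec, dotProduct_sub, dotProduct_smul, smul_eq_mul, h4, h5]
    linarith
  ext i j
  simpa using key (Pi.single i 1) (Pi.single j 1)

theorem mul_dotProduct_left (a x y : Fin n → ℝ) : (a * x) ⬝ᵥ y = x ⬝ᵥ (a * y) := by
  simp only [dotProduct, Pi.mul_apply]
  exact Finset.sum_congr rfl fun i _ => by ring

/-- The factor a_i a_j is absorbed by the two vectors of the bivector. This is the property of the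
special inertia operator on which the reduction rests. -/
theorem specialInertia_apply_wedge (a : Fin n → ℝ) (D : ℝ) (x y : Fin n → ℝ) :
    specialInertia a D (wedge x y) = wedge (a * x) (a * y) - D • wedge x y := by
  ext i j
  simp [specialInertia, wedge, vecMulVec_apply]
  ring

end MatrixAlgebra

/-! ### The constraint distribution and its horizontal vectors -/

namespace RubberBall

variable {n : ℕ} (B : RubberBall n)

theorem A_mulVec (x : Fin n → ℝ) : B.A *ᵥ x = B.a * x := by
  ext i
  simp [A, mulVec_diagonal]

theorem A_inv_mulVec (x : Fin n → ℝ) : B.A⁻¹ *ᵥ x = B.a⁻¹ * x := by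
  have h : B.A⁻¹ = diagonal B.a⁻¹ := by
    refine inv_eq_right_inv ?_
    rw [A, diagonal_mul_diagonal, ← diagonal_one]
    congr 1
    ext i
    simp [(B.a_pos i).ne']
  ext i
  simp [h, mulVec_diagonal]

theorem a_inv_mul (x : Fin n → ℝ) : B.a⁻¹ * (B.a * x) = x := by
  ext i
  simp [(B.a_pos i).ne']

theorem a_mul_inv (x : Fin n → ℝ) : B.a * (B.a⁻¹ * x) = x := by
  ext i
  simp [(B.a_pos i).ne']

theorem dotProduct_a_mul_pos {x : Fin n → ℝ} (hx : x ≠ 0) : 0 < x ⬝ᵥ (B.a * x) := by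
  obtain ⟨i, hi⟩ := Function.ne_iff.1 hx
  refine Finset.sum_pos' (fun j _ => ?_) ⟨i, Finset.mem_univ _, ?_⟩
  · have := B.a_pos j
    simp only [Pi.mul_apply]
    nlinarith [mul_nonneg this.le (mul_self_nonneg (x j))]
  · have := mul_pos (B.a_pos i) (mul_self_pos.2 hi)
    simp only [Pi.mul_apply]
    linarith

theorem ε_ne_zero : B.ε ≠ 0 := div_ne_zero B.σ_pos.ne' B.ne_zero

theorem one_sub_ε : 1 - B.ε = B.sgn * B.ρ / (B.σ + B.sgn * B.ρ) := by
  have := B.ne_zero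
  rw [ε]
  field_simp
  ring

theorem sgn_mul_sgn : B.sgn * B.sgn = 1 := by
  rcases B.sgn_eq with h | h <;> rw [h] <;> norm_num

section Config

variable {B} {q : Amb n} (hq : q ∈ B.config)
include hq

theorem mul_transpose_of_config : q.1 * q.1ᵀ = 1 :=
  (mem_orthogonalGroup_iff _ _).1 (mem_specialOrthogonalGroup_iff.1 hq.1).1

theorem transpose_mul_of_config : q.1ᵀ * q.1 = 1 :=
  mul_eq_one_comm.1 (mul_transpose_of_config hq)

theorem inv_of_config : q.1⁻¹ = q.1ᵀ := inv_eq_right_inv (mul_transpose_of_config hq)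

theorem Γ_dotProduct_self : B.Γ q ⬝ᵥ B.Γ q = 1 := by
  have h := B.ne_zero
  rw [Γ, smul_dotProduct, dotProduct_smul, hq.2, smul_eq_mul, smul_eq_mul]
  field_simp

theorem mulVec_proj : q.1 *ᵥ B.proj q = B.Γ q := by
  rw [proj, mulVec_mulVec, mul_transpose_of_config hq, one_mulVec]

theorem transpose_mulVec_dotProduct (x y : Fin n → ℝ) :
    (q.1ᵀ *ᵥ x) ⬝ᵥ (q.1ᵀ *ᵥ y) = x ⬝ᵥ y := by
  rw [dotProduct_mulVec, vecMul_transpose, mulVec_mulVec, mul_transpose_of_config hq, one_mulVec]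

theorem mulVec_dotProduct_mulVec (x y : Fin n → ℝ) :
    (q.1 *ᵥ x) ⬝ᵥ (q.1 *ᵥ y) = x ⬝ᵥ y := by
  rw [dotProduct_mulVec, ← mulVec_transpose, mulVec_mulVec, transpose_mul_of_config hq, one_mulVec]

theorem proj_dotProduct_self : B.proj q ⬝ᵥ B.proj q = 1 := by
  rw [proj, transpose_mulVec_dotProduct hq, Γ_dotProduct_self hq]

end Config

/-- The velocity in the constraint distribution at `q` with angular velocity `w ∧ γ` in the body
frame. -/
noncomputable def lift (q : Amb n) (w : Fin n → ℝ) : Amb n :=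
  (q.1 * wedge w (B.proj q), (B.sgn * B.ρ) • q.1 *ᵥ w)

variable {B}

/-- The constraints force Ω = (ΩΓ) ∧ Γ; conjugation by `q.1` carries this to the body frame with w =
g⁻¹ΩΓ. -/
theorem mem_distribution_iff {q : Amb n} (hq : q ∈ B.config) (u : Amb n) :
    u ∈ B.distribution q ↔ ∃ w, w ⬝ᵥ B.proj q = 0 ∧ u = B.lift q w := by
  rw [distribution, inv_of_config hq]
  constructor
  · rintro ⟨h1, h2, h3⟩
    have h4 := eq_wedge_of_skew h1 (Γ_dotProduct_self hq) fun x y hx hy => by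
      rw [← killing_wedge_of_skew h1]; exact h3 x y hx hy
    generalize hv : (u.1 * q.1ᵀ) *ᵥ B.Γ q = v at h2 h4
    have h5 : B.Γ q ⬝ᵥ v = 0 := by rw [← hv]; linarith [dotProduct_mulVec_of_skew h1 (B.Γ q) (B.Γ q)]
    refine ⟨q.1ᵀ *ᵥ v, ?_, Prod.ext ?_ ?_⟩
    · rw [proj, transpose_mulVec_dotProduct hq, dotProduct_comm, h5]
    · have h6 := mul_wedge_mul_transpose q.1 (q.1ᵀ *ᵥ v) (B.proj q)
      rw [mulVec_mulVec, mul_transpose_of_config hq, one_mulVec, mulVec_proj hq, ← h4] at h6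
      have h7 := congrArg (· * q.1) h6
      simp only [Matrix.mul_assoc, transpose_mul_of_config hq, mul_one] at h7
      exact h7.symm
    · rw [h2]
      simp [lift, mulVec_mulVec, mul_transpose_of_config hq]
  · rintro ⟨w, hw, rfl⟩
    have h1 : (B.lift q w).1 * q.1ᵀ = wedge (q.1 *ᵥ w) (B.Γ q) := by
      rw [lift, mul_wedge_mul_transpose, mulVec_proj hq]
    have h2 : q.1 *ᵥ w ⬝ᵥ B.Γ q = 0 := by
      rw [← mulVec_proj hq, mulVec_dotProduct_mulVec hq, hw]
    rw [Set.mem_ofPred_eq, h1]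
    refine ⟨wedge_transpose _ _, ?_, fun x y hx hy => ?_⟩
    · rw [wedge_mulVec, Γ_dotProduct_self hq, h2]
      simp [lift]
    · rw [killing_wedge_of_skew (wedge_transpose _ _), wedge_mulVec, dotProduct_comm (B.Γ q), hy]
      simp [hx]

theorem transpose_mul_lift_fst {q : Amb n} (hq : q ∈ B.config) (w : Fin n → ℝ) :
    q.1ᵀ * (B.lift q w).1 = wedge w (B.proj q) := by
  rw [lift, ← Matrix.mul_assoc, transpose_mul_of_config hq, one_mul]

theorem isBilinearMap_proj :
    IsBilinearMap ℝ fun (X : Matrix (Fin n) (Fin n) ℝ) (y : Fin n → ℝ) =>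
      Xᵀ *ᵥ ((B.σ + B.sgn * B.ρ)⁻¹ • y) where
  add_left _ _ _ := by rw [transpose_add, add_mulVec]
  smul_left _ _ _ := by rw [transpose_smul, smul_mulVec]
  add_right _ _ _ := by rw [smul_add, mulVec_add]
  smul_right _ _ _ := by rw [smul_comm, mulVec_smul]

theorem contDiff_proj {k : WithTop ℕ∞} : ContDiff ℝ k B.proj := isBilinearMap_proj.contDiff

theorem fderiv_proj (q η : Amb n) :
    fderiv ℝ B.proj q η = η.1ᵀ *ᵥ B.Γ q + q.1ᵀ *ᵥ ((B.σ + B.sgn * B.ρ)⁻¹ • η.2) := by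
  have h : HasFDerivAt B.proj _ q :=
    (isBilinearMap_proj (B := B)).toContinuousBilinearMap.isBoundedBilinearMap.hasFDerivAt q
  rw [h.fderiv]
  exact add_comm _ _

/-- The rotation contributes -(w ∧ γ)γ = -w, and the motion of the centre contributes (1 - ε) w
because ±ρ/(σ ± ρ) = 1 - ε. -/
theorem fderiv_proj_lift {q : Amb n} (hq : q ∈ B.config) {w : Fin n → ℝ}
    (hw : w ⬝ᵥ B.proj q = 0) : fderiv ℝ B.proj q (B.lift q w) = -B.ε • w := by
  rw [fderiv_proj, lift]
  simp only [transpose_mul, wedge_transpose, ← mulVec_mulVec, mulVec_smul, neg_mulVec]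
  have h1 : q.1ᵀ *ᵥ B.Γ q = B.proj q := rfl
  rw [h1, wedge_mulVec, proj_dotProduct_self hq, hw, mulVec_mulVec, transpose_mul_of_config hq,
    one_mulVec, smul_smul]
  have h2 : (B.σ + B.sgn * B.ρ)⁻¹ * (B.sgn * B.ρ) = 1 - B.ε := by
    rw [one_sub_ε, div_eq_inv_mul]
  rw [h2]
  module

theorem fderiv_lagrangian (q u η : Amb n) :
    fderiv ℝ (B.lagrangian q) u η =
      killing (specialInertia B.a B.D (q.1ᵀ * u.1)) (q.1ᵀ * η.1) + B.mass * (u.2 ⬝ᵥ η.2) := by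
  have hb : IsBilinearMap ℝ fun u η : Amb n =>
      killing (specialInertia B.a B.D (q.1ᵀ * u.1)) (q.1ᵀ * η.1) + B.mass * (u.2 ⬝ᵥ η.2) := by
    constructor <;> intros
    · simp only [Prod.fst_add, Prod.snd_add, Matrix.mul_add, specialInertia_add,
        isBilinearMap_killing.add_left, add_dotProduct]
      ring
    · simp only [Prod.smul_fst, Prod.smul_snd, mul_smul_comm, specialInertia_smul,
        isBilinearMap_killing.smul_left, smul_dotProduct, smul_eq_mul]
      ring
    · simp only [Prod.fst_add, Prod.snd_add, Matrix.mul_add,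
        isBilinearMap_killing.add_right, dotProduct_add]
      ring
    · simp only [Prod.smul_fst, Prod.smul_snd, mul_smul_comm,
        isBilinearMap_killing.smul_right, dotProduct_smul, smul_eq_mul]
      ring
  have hs : ∀ u η : Amb n,
      killing (specialInertia B.a B.D (q.1ᵀ * u.1)) (q.1ᵀ * η.1) + B.mass * (u.2 ⬝ᵥ η.2) =
      killing (specialInertia B.a B.D (q.1ᵀ * η.1)) (q.1ᵀ * u.1) + B.mass * (η.2 ⬝ᵥ u.2) := fun u η => by
    rw [killing_specialInertia_comm, dotProduct_comm]
  have h := hb.fderiv_quadratic hs 0 u η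
  rw [← h]
  congr 2
  funext x
  simp only [lagrangian]
  ring

theorem fderiv_lagrangian_config (q u δ : Amb n) :
    fderiv ℝ (fun x => B.lagrangian x u) q δ =
      killing (specialInertia B.a B.D (q.1ᵀ * u.1)) (δ.1ᵀ * u.1) := by
  have hb : IsBilinearMap ℝ fun q δ : Amb n =>
      killing (specialInertia B.a B.D (q.1ᵀ * u.1)) (δ.1ᵀ * u.1) := by
    constructor <;> intros
    · simp only [Prod.fst_add, transpose_add, Matrix.add_mul, specialInertia_add,
        isBilinearMap_killing.add_left]
    · simp only [Prod.smul_fst, transpose_smul, smul_mul_assoc, specialInertia_smul,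
        isBilinearMap_killing.smul_left]
    · simp only [Prod.fst_add, transpose_add, Matrix.add_mul, isBilinearMap_killing.add_right]
    · simp only [Prod.smul_fst, transpose_smul, smul_mul_assoc, isBilinearMap_killing.smul_right]
  have hs : ∀ q δ : Amb n, killing (specialInertia B.a B.D (q.1ᵀ * u.1)) (δ.1ᵀ * u.1) =
      killing (specialInertia B.a B.D (δ.1ᵀ * u.1)) (q.1ᵀ * u.1) := fun q δ =>
    killing_specialInertia_comm _ _ _ _
  have h := hb.fderiv_quadratic hs (1 / 2 * B.mass * (u.2 ⬝ᵥ u.2)) q δ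
  rw [← h]
  rfl

end RubberBall

/-! ### The Legendre transformation and the Lagrange-d'Alembert equations -/

namespace RubberBall

open scoped Topology

variable {n : ℕ} (B : RubberBall n)

/-- The vector `(γ, Aγ) Aw - (w, Aγ) Aγ`, which is `(Aw ∧ Aγ) γ`. -/
noncomputable def inertiaVec (γ w : Fin n → ℝ) : Fin n → ℝ :=
  (γ ⬝ᵥ (B.a * γ)) • (B.a * w) - (w ⬝ᵥ (B.a * γ)) • (B.a * γ)

variable {B}

theorem dotProduct_a_mul_comm (x y : Fin n → ℝ) : x ⬝ᵥ (B.a * y) = y ⬝ᵥ (B.a * x) := by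
  rw [← mul_dotProduct_left, dotProduct_comm]

theorem inertiaVec_dotProduct (γ w : Fin n → ℝ) : B.inertiaVec γ w ⬝ᵥ γ = 0 := by
  simp only [inertiaVec, sub_dotProduct, smul_dotProduct, mul_dotProduct_left, smul_eq_mul]
  ring

/-- The translational energy contributes mρ²(w, w') = D(w, w'), which cancels the term with D in the
rotational part; only Aw ∧ Aγ remains. -/
theorem fderiv_lagrangian_lift {q : Amb n} (hq : q ∈ B.config) {w w' : Fin n → ℝ}
    (hw : w ⬝ᵥ B.proj q = 0) :
    fderiv ℝ (B.lagrangian q) (B.lift q w) (B.lift q w') =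
      w' ⬝ᵥ B.inertiaVec (B.proj q) w := by
  rw [fderiv_lagrangian, transpose_mul_lift_fst hq, transpose_mul_lift_fst hq,
    specialInertia_apply_wedge, sub_eq_add_neg, ← neg_smul, isBilinearMap_killing.add_left,
    isBilinearMap_killing.smul_left, killing_wedge_of_skew (wedge_transpose _ _),
    killing_wedge_of_skew (wedge_transpose _ _)]
  simp only [wedge_mulVec, lift, smul_dotProduct, dotProduct_smul, mulVec_dotProduct_mulVec hq,
    proj_dotProduct_self hq, hw, D, inertiaVec, mul_dotProduct_left, smul_eq_mul, dotProduct_sub]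
  rw [dotProduct_comm w w']
  linear_combination (B.mass * B.ρ ^ 2 * (w' ⬝ᵥ w)) * B.sgn_mul_sgn

theorem isReducedMomentum_lift_iff {q : Amb n} (hq : q ∈ B.config) {w : Fin n → ℝ}
    (hw : w ⬝ᵥ B.proj q = 0) (p : Fin n → ℝ) :
    B.IsReducedMomentum q (B.lift q w) p ↔ p = -B.ε⁻¹ • B.inertiaVec (B.proj q) w := by
  have hε := B.ε_ne_zero
  have key : ∀ w', w' ⬝ᵥ B.proj q = 0 →
      (p ⬝ᵥ fderiv ℝ B.proj q (B.lift q w') =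
        fderiv ℝ (B.lagrangian q) (B.lift q w) (B.lift q w') ↔
        (p + B.ε⁻¹ • B.inertiaVec (B.proj q) w) ⬝ᵥ w' = 0) := by
    intro w' hw'
    rw [fderiv_proj_lift hq hw', fderiv_lagrangian_lift hq hw, dotProduct_smul, add_dotProduct,
      smul_dotProduct, dotProduct_comm w', smul_eq_mul, smul_eq_mul]
    constructor <;> intro h
    · field_simp
      linarith
    · field_simp at h
      linarith
  constructor
  · rintro ⟨h1, h2⟩
    have h3 : (p + B.ε⁻¹ • B.inertiaVec (B.proj q) w) ⬝ᵥ B.proj q = 0 := by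
      rw [add_dotProduct, h1, smul_dotProduct, inertiaVec_dotProduct, smul_zero, add_zero]
    -- The difference of the two candidates is itself orthogonal to γ, hence an admissible test
    -- vector, so its square vanishes.
    have h4 := (key _ h3).1 (h2 _ ((mem_distribution_iff hq _).2 ⟨_, h3, rfl⟩))
    rw [dotProduct_self_eq_zero] at h4
    rw [eq_neg_of_add_eq_zero_left h4, neg_smul]
  · rintro rfl
    refine ⟨by rw [smul_dotProduct, inertiaVec_dotProduct, smul_zero], fun η hη => ?_⟩
    obtain ⟨w', hw', rfl⟩ := (mem_distribution_iff hq _).1 hη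
    exact (key w' hw').2 (by simp)

section Legendre

variable {γ w p : Fin n → ℝ}

theorem a_inv_mul_inertiaVec (γ w : Fin n → ℝ) : B.a⁻¹ * B.inertiaVec γ w =
    (γ ⬝ᵥ (B.a * γ)) • w - (w ⬝ᵥ (B.a * γ)) • γ := by
  simp [inertiaVec, mul_sub, a_inv_mul]

/-- Inverse Legendre transformation: A⁻¹ turns the momentum into a combination of w and γ, and the
pairing with A⁻¹γ yields the coefficient of γ to be removed. -/
theorem fieldγ_momentum (hγ : γ ⬝ᵥ γ = 1) (hw : w ⬝ᵥ γ = 0) :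
    B.fieldγ γ (-B.ε⁻¹ • B.inertiaVec γ w) = -B.ε • w := by
  have hε := B.ε_ne_zero
  have hα : 0 < γ ⬝ᵥ (B.a * γ) := B.dotProduct_a_mul_pos (by rintro rfl; simp at hγ)
  have h1 : (B.inertiaVec γ w) ⬝ᵥ (B.a⁻¹ * γ) = -(w ⬝ᵥ (B.a * γ)) := by
    rw [← mul_dotProduct_left, a_inv_mul_inertiaVec]
    simp [sub_dotProduct, hγ, hw]
  rw [fieldγ, A_inv_mulVec, A_inv_mulVec, A_mulVec, mul_smul_comm, a_inv_mul_inertiaVec,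
    smul_dotProduct, h1]
  ext i
  simp
  field_simp
  ring

/-- In terms of w the denominators (γ, Aγ) disappear; in this form the field is compared with the
Euler-Lagrange expression. -/
theorem fieldp_momentum (hγ : γ ⬝ᵥ γ = 1) (hw : w ⬝ᵥ γ = 0) :
    B.fieldp γ (-B.ε⁻¹ • B.inertiaVec γ w) =
      ((w ⬝ᵥ (-B.ε⁻¹ • B.inertiaVec γ w))) • γ - ((1 - B.ε) / B.ε) •
        ((w ⬝ᵥ (B.a * γ)) • (B.a * w) - (w ⬝ᵥ (B.a * w)) • (B.a * γ)) := by
  have hε := B.ε_ne_zero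
  have hα : 0 < γ ⬝ᵥ (B.a * γ) := B.dotProduct_a_mul_pos (by rintro rfl; simp at hγ)
  have h1 : (B.inertiaVec γ w) ⬝ᵥ (B.a⁻¹ * γ) = -(w ⬝ᵥ (B.a * γ)) := by
    rw [← mul_dotProduct_left, a_inv_mul_inertiaVec]
    simp [sub_dotProduct, hγ, hw]
  have h2 : ((γ ⬝ᵥ (B.a * γ)) • w - (w ⬝ᵥ (B.a * γ)) • γ) ⬝ᵥ B.inertiaVec γ w =
      (γ ⬝ᵥ (B.a * γ)) ^ 2 * (w ⬝ᵥ (B.a * w)) - (γ ⬝ᵥ (B.a * γ)) * (w ⬝ᵥ (B.a * γ)) ^ 2 := by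
    simp only [inertiaVec, sub_dotProduct, dotProduct_sub, smul_dotProduct, dotProduct_smul,
      smul_eq_mul, dotProduct_a_mul_comm γ w]
    ring
  have h3 : w ⬝ᵥ B.inertiaVec γ w =
      (γ ⬝ᵥ (B.a * γ)) * (w ⬝ᵥ (B.a * w)) - (w ⬝ᵥ (B.a * γ)) ^ 2 := by
    simp only [inertiaVec, dotProduct_sub, dotProduct_smul, smul_eq_mul]
    ring
  have h4 : B.inertiaVec γ w ⬝ᵥ ((γ ⬝ᵥ (B.a * γ)) • w - (w ⬝ᵥ (B.a * γ)) • γ) =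
      (γ ⬝ᵥ (B.a * γ)) ^ 2 * (w ⬝ᵥ (B.a * w)) - (γ ⬝ᵥ (B.a * γ)) * (w ⬝ᵥ (B.a * γ)) ^ 2 := by
    rw [dotProduct_comm, h2]
  rw [fieldp, A_inv_mulVec, A_inv_mulVec, A_mulVec, mul_smul_comm, a_inv_mul_inertiaVec]
  simp only [smul_dotProduct, dotProduct_smul, h1, h2, h3, h4, mul_dotProduct_left, smul_eq_mul]
  ext i
  simp [inertiaVec]
  field_simp
  ring

theorem momentum_fieldγ (hγ : γ ⬝ᵥ γ = 1) (hp : γ ⬝ᵥ p = 0) :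
    -B.ε⁻¹ • B.inertiaVec γ (-B.ε⁻¹ • B.fieldγ γ p) = p := by
  have hε := B.ε_ne_zero
  have hα : 0 < γ ⬝ᵥ (B.a * γ) := B.dotProduct_a_mul_pos (by rintro rfl; simp at hγ)
  have h1 : (B.a⁻¹ * p) ⬝ᵥ (B.a * γ) = 0 := by
    rw [mul_dotProduct_left, a_inv_mul, dotProduct_comm, hp]
  rw [inertiaVec, fieldγ, A_inv_mulVec, A_inv_mulVec, A_mulVec]
  simp only [mul_smul_comm, mul_sub, a_mul_inv, smul_dotProduct, sub_dotProduct, h1]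
  ext i
  simp
  field_simp
  ring

theorem fieldγ_dotProduct (hγ : γ ⬝ᵥ γ = 1) : B.fieldγ γ p ⬝ᵥ γ = 0 := by
  rw [fieldγ, A_inv_mulVec, A_inv_mulVec, smul_dotProduct, sub_dotProduct, smul_dotProduct, hγ,
    mul_dotProduct_left, dotProduct_comm p, mul_dotProduct_left]
  simp

end Legendre

theorem hasDerivAt_momentum {γ w : ℝ → Fin n → ℝ} {γ' w' : Fin n → ℝ} {t : ℝ}
    (hγ : HasDerivAt γ γ' t) (hw : HasDerivAt w w' t) :
    HasDerivAt (fun τ => -B.ε⁻¹ • B.inertiaVec (γ τ) (w τ))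
      (-B.ε⁻¹ • ((γ t ⬝ᵥ (B.a * γ t)) • (B.a * w') +
        (γ t ⬝ᵥ (B.a * γ') + γ' ⬝ᵥ (B.a * γ t)) • (B.a * w t) -
        ((w t ⬝ᵥ (B.a * γ t)) • (B.a * γ') +
          (w t ⬝ᵥ (B.a * γ') + w' ⬝ᵥ (B.a * γ t)) • (B.a * γ t)))) t :=
  (((isBilinearMap_dotProduct.hasDerivAt hγ (hγ.const_mul B.a)).smul (hw.const_mul B.a)).sub
    ((isBilinearMap_dotProduct.hasDerivAt hw (hγ.const_mul B.a)).smul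
      (hγ.const_mul B.a))).const_smul (-B.ε⁻¹)

theorem _root_.eulerLagrange_eq {C : Type*} [NormedAddCommGroup C] [NormedSpace ℝ C]
    {L : C → C → ℝ} {q v : ℝ → C} {t θ' : ℝ} {δ : C} (hq : ∀ᶠ τ in 𝓝 t, HasDerivAt q (v τ) τ)
    (hθ : HasDerivAt (fun τ => fderiv ℝ (L (q τ)) (v τ) δ) θ' t) :
    eulerLagrange L q t δ = θ' - fderiv ℝ (fun x => L x (v t)) (q t) δ := by
  rw [eulerLagrange, hq.self_of_nhds.deriv]
  congr 1
  refine (hθ.congr_of_eventuallyEq ?_).deriv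
  filter_upwards [hq] with τ hτ
  rw [hτ.deriv]

/-- The momentum is paired with the projected test vector -εx, which explains the factor. What the
Euler-Lagrange expression contains besides -ε(x, ṗ) is the nonholonomic force, and it agrees with
the explicit right hand side. -/
theorem eulerLagrange_lift {q : ℝ → Amb n} {w : ℝ → Fin n → ℝ} {w' : Fin n → ℝ} {t : ℝ}
    (hq : ∀ᶠ τ in 𝓝 t, q τ ∈ B.config ∧ w τ ⬝ᵥ B.proj (q τ) = 0 ∧
      HasDerivAt q (B.lift (q τ) (w τ)) τ)
    (hw : HasDerivAt w w' t) :
    ∃ p' : Fin n → ℝ,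
      HasDerivAt (fun τ => -B.ε⁻¹ • B.inertiaVec (B.proj (q τ)) (w τ)) p' t ∧
      ∀ x, x ⬝ᵥ B.proj (q t) = 0 → eulerLagrange B.lagrangian q t (B.lift (q t) x) =
        -B.ε * (x ⬝ᵥ (p' - B.fieldp (B.proj (q t))
          (-B.ε⁻¹ • B.inertiaVec (B.proj (q t)) (w t)))) := by
  obtain ⟨hqt, hwt, hdq⟩ := hq.self_of_nhds
  have hγ : HasDerivAt (fun τ => B.proj (q τ)) (-B.ε • w t) t :=
    (((contDiff_proj (B := B) (k := 1)).differentiable (by norm_num)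
      (q t)).hasFDerivAt.comp_hasDerivAt t hdq).congr_deriv (fderiv_proj_lift hqt hwt)
  refine ⟨_, hasDerivAt_momentum hγ hw, fun x hx => ?_⟩
  have hγγ := proj_dotProduct_self hqt
  set Z := wedge x (B.proj (q t)) with hZ
  -- The test velocity is frozen in the ambient space while the configuration moves, so in the body
  -- frame at time `τ` it is read through `(H τ)ᵀ`. At `t` this curve passes through the identity
  -- with velocity w ∧ γ.
  set H : ℝ → Matrix (Fin n) (Fin n) ℝ := fun τ => (q t).1ᵀ * (q τ).1 with hH
  have hHt : H t = 1 := transpose_mul_of_config hqt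
  have hH' : HasDerivAt H (wedge (w t) (B.proj (q t))) t := by
    refine (isBilinearMap_matrixMul.hasDerivAt (hasDerivAt_const t (q t).1ᵀ)
      hdq.fst).congr_deriv ?_
    rw [transpose_mul_lift_fst hqt, Matrix.zero_mul, add_zero]
  have hHv : ∀ {v : ℝ → Fin n → ℝ} {v' : Fin n → ℝ}, HasDerivAt v v' t →
      HasDerivAt (fun τ => H τ *ᵥ v τ) (v' + wedge (w t) (B.proj (q t)) *ᵥ v t) t := by
    intro v v' hv
    have h := isBilinearMap_mulVec.hasDerivAt hH' hv
    simpa [hHt] using h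
  have hZv : ∀ {v : ℝ → Fin n → ℝ} {v' : Fin n → ℝ}, HasDerivAt v v' t →
      HasDerivAt (fun τ => Z *ᵥ v τ) (Z *ᵥ v') t := by
    intro v v' hv
    simpa using isBilinearMap_mulVec.hasDerivAt (hasDerivAt_const t Z) hv
  have hθ : (fun τ => fderiv ℝ (B.lagrangian (q τ)) (B.lift (q τ) (w τ))
      (B.lift (q t) x)) =ᶠ[𝓝 t]
      fun τ => 1 / 2 * ((H τ *ᵥ (B.a * w τ)) ⬝ᵥ (Z *ᵥ (B.a * B.proj (q τ))) -
        (H τ *ᵥ (B.a * B.proj (q τ))) ⬝ᵥ (Z *ᵥ (B.a * w τ))) -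
        B.D * (1 / 2 * ((H τ *ᵥ w τ) ⬝ᵥ (Z *ᵥ B.proj (q τ)) -
        (H τ *ᵥ B.proj (q τ)) ⬝ᵥ (Z *ᵥ w τ))) + B.D * ((H τ *ᵥ w τ) ⬝ᵥ x) := by
    filter_upwards [hq] with τ hτ
    obtain ⟨h1, h2, h3⟩ := hτ
    have h4 : ∀ u v : Fin n → ℝ, killing (wedge u v) ((q τ).1ᵀ * (B.lift (q t) x).1) =
        1 / 2 * ((H τ *ᵥ u) ⬝ᵥ (Z *ᵥ v) - (H τ *ᵥ v) ⬝ᵥ (Z *ᵥ u)) := by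
      intro u v
      have h5 : (q τ).1ᵀ * (B.lift (q t) x).1 = (H τ)ᵀ * Z := by
        simp [hH, hZ, lift, Matrix.mul_assoc]
      rw [killing_wedge_left, h5]
      simp only [← mulVec_mulVec, dotProduct_mulVec _ (H τ)ᵀ, vecMul_transpose]
    rw [fderiv_lagrangian, transpose_mul_lift_fst h1, specialInertia_apply_wedge,
      sub_eq_add_neg, ← neg_smul, isBilinearMap_killing.add_left, isBilinearMap_killing.smul_left,
      h4, h4]
    have h6 : (B.lift (q τ) (w τ)).2 ⬝ᵥ (B.lift (q t) x).2 =
        B.ρ ^ 2 * ((H τ *ᵥ w τ) ⬝ᵥ x) := by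
      have h7 : (H τ *ᵥ w τ) ⬝ᵥ x = ((q τ).1 *ᵥ w τ) ⬝ᵥ ((q t).1 *ᵥ x) := by
        rw [hH, ← mulVec_mulVec, dotProduct_comm, dotProduct_mulVec, vecMul_transpose,
          dotProduct_comm]
      rw [h7]
      simp only [lift, smul_dotProduct, dotProduct_smul, smul_eq_mul]
      linear_combination (B.ρ ^ 2 * (((q τ).1 *ᵥ w τ) ⬝ᵥ ((q t).1 *ᵥ x))) * B.sgn_mul_sgn
    rw [h6, D]
    simp only [smul_eq_mul]
    ring
  have haw := hw.const_mul B.a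
  have haγ := hγ.const_mul B.a
  have hder := (((isBilinearMap_dotProduct.hasDerivAt (hHv haw) (hZv haγ)).sub
    (isBilinearMap_dotProduct.hasDerivAt (hHv haγ) (hZv haw))).const_mul (1 / 2)).sub
    ((((isBilinearMap_dotProduct.hasDerivAt (hHv hw) (hZv hγ)).sub
    (isBilinearMap_dotProduct.hasDerivAt (hHv hγ) (hZv hw))).const_mul (1 / 2)).const_mul B.D) |>.add
    ((isBilinearMap_dotProduct.hasDerivAt (hHv hw) (hasDerivAt_const t x)).const_mul B.D)
  have hpot : fderiv ℝ (fun y => B.lagrangian y (B.lift (q t) (w t))) (q t) (B.lift (q t) x) =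
      -killing (wedge (B.a * w t) (B.a * B.proj (q t)) - B.D • wedge (w t) (B.proj (q t)))
        (Z * wedge (w t) (B.proj (q t))) := by
    have h5 : (B.lift (q t) x).1ᵀ * (B.lift (q t) (w t)).1 =
        -(Z * wedge (w t) (B.proj (q t))) := by
      rw [← Matrix.neg_mul, hZ, ← wedge_transpose, ← transpose_mul_lift_fst hqt (w t),
        lift, transpose_mul, Matrix.mul_assoc]
    rw [fderiv_lagrangian_config, transpose_mul_lift_fst hqt,
      specialInertia_apply_wedge, h5, ← neg_one_smul ℝ, isBilinearMap_killing.smul_right]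
    simp
  refine (eulerLagrange_eq (hq.mono fun _ h => h.2.2) (hder.congr_of_eventuallyEq hθ)).trans
    ((congrArg (_ - ·) hpot).trans ?_)
  rw [fieldp_momentum hγγ hwt, sub_eq_add_neg (wedge _ _), ← neg_smul, isBilinearMap_killing.add_left,
    isBilinearMap_killing.smul_left, killing_wedge_left, killing_wedge_left]
  have hε := B.ε_ne_zero
  generalize B.proj (q t) = γ at *
  generalize w t = v at *
  have hwt' : γ ⬝ᵥ v = 0 := by rw [dotProduct_comm, hwt]
  have hx' : γ ⬝ᵥ x = 0 := by rw [dotProduct_comm, hx]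
  simp only [← mulVec_mulVec, hHt, one_mulVec, hZ, wedge_mulVec, dotProduct_add, dotProduct_sub,
    dotProduct_smul, add_dotProduct, sub_dotProduct, smul_dotProduct, mul_smul_comm,
    mul_dotProduct_left, smul_eq_mul, dotProduct_zero, hγγ, hwt, hwt', hx, hx',
    dotProduct_a_mul_comm γ v, dotProduct_a_mul_comm γ x, dotProduct_a_mul_comm v x,
    dotProduct_a_mul_comm γ w', dotProduct_a_mul_comm w' x,
    dotProduct_comm v x, dotProduct_comm w' x]
  field_simp
  ring

end RubberBall

/-! ### Reconstruction of the rotation from the angular velocity -/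

section LinearODE

open Set
open scoped NNReal Topology

/-- Solutions of a linear equation on an open interval, when all the time changes of a solution
remain in the unit ball. -/
theorem exists_linear_ode_solution {E : Type*} [NormedAddCommGroup E] [NormedSpace ℝ E]
    [FiniteDimensional ℝ E] {L : ℝ → E →L[ℝ] E} {J : Set ℝ} (hJ : IsOpen J)
    (hJ' : J.OrdConnected) (hL : ContinuousOn L J) {t₀ : ℝ} (ht₀ : t₀ ∈ J) {x₀ : E}
    (hbound : ∀ (c : ℝ → ℝ) (x : ℝ → E), x t₀ = x₀ →
      (∀ t ∈ J, HasDerivAt x (c t • L t (x t)) t) → ∀ t ∈ J, ‖x t‖ ≤ 1) :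
    ∃ x : ℝ → E, x t₀ = x₀ ∧ ∀ t ∈ J, HasDerivAt x (L t (x t)) t := by
  have : ProperSpace E := FiniteDimensional.proper_real E
  let φ : ContDiffBump (0 : E) := ⟨1, 2, by norm_num, by norm_num⟩
  have hφ : ContDiff ℝ 1 fun x : E => φ x • x := φ.contDiff.smul contDiff_id
  have hφs : HasCompactSupport fun x : E => φ x • x := φ.hasCompactSupport.smul_right
  obtain ⟨C, hC⟩ := hφ.lipschitzWith_of_hasCompactSupport hφs (by norm_num)
  obtain ⟨M, hM⟩ := hφs.exists_bound_of_continuous hφ.continuous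
  have hM0 : 0 ≤ M := (norm_nonneg _).trans (hM 0)
  -- The truncated field is bounded and Lipschitz. Its solution is a time change with coefficient
  -- φ(x(t)), so `hbound` keeps it in the unit ball, where φ is one and the truncation has no
  -- effect.
  obtain ⟨x, hx0, hx⟩ := exists_ode_solution (f := fun t x => L t (φ x • x)) hJ hJ'
    (by
      intro a b hab
      obtain ⟨c, hc⟩ := isCompact_Icc.exists_bound_of_continuousOn (hL.mono hab)
      refine ⟨c.toNNReal * C, c.toNNReal * M.toNNReal, fun t ht => ?_⟩
      have hct : ‖L t‖₊ ≤ c.toNNReal := NNReal.le_toNNReal_of_coe_le (hc t ht)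
      refine ⟨((L t).lipschitz.comp hC).weaken (by gcongr), fun x => ?_⟩
      calc ‖L t (φ x • x)‖ ≤ ‖L t‖ * ‖φ x • x‖ := (L t).le_opNorm _
        _ ≤ c.toNNReal * M.toNNReal := by
          gcongr
          · exact hct
          · rw [Real.coe_toNNReal _ hM0]; exact hM x)
    (fun x => hL.clm_apply continuousOn_const) ht₀ x₀
  refine ⟨x, hx0, fun t ht => ?_⟩
  have h1 := hbound (fun t => φ (x t)) x hx0 (fun t ht => by simpa using hx t ht) t ht
  have h2 : φ (x t) = 1 := φ.one_of_mem_closedBall (by simpa using h1)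
  simpa [h2] using hx t ht

end LinearODE

section MatrixODE

open Set
open scoped Topology

variable {n : ℕ}

theorem isBilinearMap_mul_transpose :
    IsBilinearMap ℝ fun X Y : Matrix (Fin n) (Fin n) ℝ => X * Yᵀ where
  add_left _ _ _ := add_mul _ _ _
  smul_left _ _ _ := smul_mul_assoc _ _ _
  add_right _ _ _ := by rw [transpose_add, mul_add]
  smul_right _ _ _ := by rw [transpose_smul, mul_smul_comm]

/-- The norm is the largest absolute value of an entry, and every row has Euclidean length one. -/
theorem norm_le_one_of_mul_transpose {X : Matrix (Fin n) (Fin n) ℝ} (hX : X * Xᵀ = 1) :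
    ‖X‖ ≤ 1 := by
  rw [Matrix.norm_le_iff zero_le_one]
  intro i j
  have h1 : ∑ k, X i k * X i k = 1 := by
    have := congrFun (congrFun hX i) i
    simpa [mul_apply] using this
  have h2 : X i j * X i j ≤ 1 := by
    rw [← h1]
    exact Finset.single_le_sum (f := fun k => X i k * X i k) (fun k _ => mul_self_nonneg _)
      (Finset.mem_univ j)
  rw [Real.norm_eq_abs]
  exact abs_le_one_iff_mul_self_le_one.2 h2

/-- Skewness of ω makes the derivative of X Xᵀ vanish for any scalar factor `c`; this generality
covers the truncated equation. -/
theorem mul_transpose_const {J : Set ℝ} (hJ : IsOpen J) (hJ' : J.OrdConnected)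
    {X ω : ℝ → Matrix (Fin n) (Fin n) ℝ} {c : ℝ → ℝ} (hω : ∀ t, (ω t)ᵀ = -ω t) {t₀ : ℝ}
    (ht₀ : t₀ ∈ J) (h₀ : X t₀ * (X t₀)ᵀ = 1)
    (hX : ∀ t ∈ J, HasDerivAt X (c t • (X t * ω t)) t) : ∀ t ∈ J, X t * (X t)ᵀ = 1 := by
  have key : ∀ t ∈ J, HasDerivAt (fun t => X t * (X t)ᵀ) 0 t := fun t ht => by
    refine (isBilinearMap_mul_transpose.hasDerivAt (hX t ht) (hX t ht)).congr_deriv ?_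
    simp [transpose_smul, transpose_mul, hω, Matrix.mul_assoc]
  intro t ht
  rw [← h₀]
  exact hJ.is_const_of_deriv_eq_zero hJ'.isPreconnected
    (fun t ht => (key t ht).differentiableAt.differentiableWithinAt)
    (fun t ht => (key t ht).deriv) ht ht₀

theorem exists_rotation {J : Set ℝ} (hJ : IsOpen J) (hJ' : J.OrdConnected)
    {ω : ℝ → Matrix (Fin n) (Fin n) ℝ} (hω : ∀ t, (ω t)ᵀ = -ω t) (hωc : ContinuousOn ω J) {t₀ : ℝ}
    (ht₀ : t₀ ∈ J) {g₀ : Matrix (Fin n) (Fin n) ℝ}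
    (hg₀ : g₀ ∈ Matrix.specialOrthogonalGroup (Fin n) ℝ) :
    ∃ g : ℝ → Matrix (Fin n) (Fin n) ℝ, g t₀ = g₀ ∧
      (∀ t ∈ J, g t ∈ Matrix.specialOrthogonalGroup (Fin n) ℝ) ∧
      ∀ t ∈ J, HasDerivAt g (g t * ω t) t := by
  have h₀ : g₀ * g₀ᵀ = 1 := (mem_orthogonalGroup_iff _ _).1 (mem_specialOrthogonalGroup_iff.1 hg₀).1
  let b := (isBilinearMap_matrixMul (n := n)).toContinuousBilinearMap
  obtain ⟨g, hg0, hg⟩ := exists_linear_ode_solution (L := fun t => b.flip (ω t)) hJ hJ'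
    (b.flip.continuous.comp_continuousOn hωc) ht₀ (x₀ := g₀) (by
      intro c x hx0 hx t ht
      exact norm_le_one_of_mul_transpose
        (mul_transpose_const hJ hJ' hω ht₀ (by rw [hx0, h₀]) hx t ht))
  have hgg := mul_transpose_const (c := fun _ => 1) hJ hJ' hω ht₀ (by rw [hg0, h₀])
    (fun t ht => (hg t ht).congr_deriv (one_smul ℝ _).symm)
  refine ⟨g, hg0, fun t ht => ?_, hg⟩
  refine mem_specialOrthogonalGroup_iff.2 ⟨(mem_orthogonalGroup_iff _ _).2 (hgg t ht), ?_⟩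
  -- The determinant is ±1 and continuous on a connected set, so it keeps its value 1 at `t₀`.
  have hsq : ∀ s ∈ J, (g s).det ^ 2 = 1 := fun s hs => by
    have := congrArg Matrix.det (hgg s hs)
    rw [det_mul, det_transpose, det_one] at this
    rw [pow_two, this]
  have hcont : ContinuousOn (fun s => (g s).det) J := by
    have hgc : ContinuousOn g J := fun s hs => (hg s hs).continuousAt.continuousWithinAt
    exact (continuous_id.matrix_det).comp_continuousOn hgc
  have := hJ'.isPreconnected.eq_of_sq_eq hcont continuousOn_const (g := fun _ => (1 : ℝ))
    (fun s hs => by simpa using hsq s hs) (fun _ => one_ne_zero) ht₀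
    (by simp only [hg0]; exact (mem_specialOrthogonalGroup_iff.1 hg₀).2)
  exact this ht

theorem isBilinearMap_wedge : IsBilinearMap ℝ fun x y : Fin n → ℝ => wedge x y where
  add_left _ _ _ := by ext; simp [wedge, vecMulVec_apply]; ring
  smul_left _ _ _ := by ext; simp [wedge, vecMulVec_apply]; ring
  add_right _ _ _ := by ext; simp [wedge, vecMulVec_apply]; ring
  smul_right _ _ _ := by ext; simp [wedge, vecMulVec_apply]; ring

end MatrixODE

/-! ### Motions of the ball and solutions of the reduced equations -/

section ContDiff

variable {n : ℕ} {E : Type*} [NormedAddCommGroup E] [NormedSpace ℝ E]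

@[fun_prop]
theorem ContDiffAt.dotProduct {k : WithTop ℕ∞} {f g : E → Fin n → ℝ} {x : E}
    (hf : ContDiffAt ℝ k f x) (hg : ContDiffAt ℝ k g x) :
    ContDiffAt ℝ k (fun y => f y ⬝ᵥ g y) x :=
  (isBilinearMap_dotProduct.contDiff.contDiffAt).comp x (hf.prodMk hg)

end ContDiff

namespace RubberBall

open scoped Topology

variable {n : ℕ} {B : RubberBall n}

theorem contDiffAt_fieldγ {k : WithTop ℕ∞} {z : (Fin n → ℝ) × (Fin n → ℝ)} (hz : z.1 ≠ 0) :
    ContDiffAt ℝ k (fun z : (Fin n → ℝ) × (Fin n → ℝ) => B.fieldγ z.1 z.2) z := by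
  have := (B.dotProduct_a_mul_pos hz).ne'
  simp only [fieldγ, A_mulVec, A_inv_mulVec]
  fun_prop (disch := assumption)

theorem contDiffAt_fieldp {k : WithTop ℕ∞} {z : (Fin n → ℝ) × (Fin n → ℝ)} (hz : z.1 ≠ 0) :
    ContDiffAt ℝ k (fun z : (Fin n → ℝ) × (Fin n → ℝ) => B.fieldp z.1 z.2) z := by
  have := (B.dotProduct_a_mul_pos hz).ne'
  have := pow_ne_zero 2 this
  simp only [fieldp, A_mulVec, A_inv_mulVec]
  fun_prop (disch := assumption)

theorem existsUnique_reducedMomentum {q u : Amb n} (hq : q ∈ B.config)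
    (hu : u ∈ B.distribution q) : ∃! p : Fin n → ℝ, B.IsReducedMomentum q u p := by
  obtain ⟨w, hw, rfl⟩ := (mem_distribution_iff hq u).1 hu
  exact ⟨_, (isReducedMomentum_lift_iff hq hw _).2 rfl,
    fun p hp => (isReducedMomentum_lift_iff hq hw p).1 hp⟩

theorem eq_of_dotProduct_eq {γ u v : Fin n → ℝ} (h : γ ⬝ᵥ (u - v) = 0)
    (h' : ∀ x, x ⬝ᵥ γ = 0 → x ⬝ᵥ (u - v) = 0) : u = v := by
  have h1 := h' (u - v) (by rw [dotProduct_comm, h])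
  exact sub_eq_zero.1 (dotProduct_self_eq_zero.1 h1)

theorem isSolutionOn_of_isMotionOn {J : Set ℝ} {q : ℝ → Amb n} {p : ℝ → Fin n → ℝ}
    (hJ : IsOpen J) (hq : B.IsMotionOn J q)
    (hp : ∀ t ∈ J, B.IsReducedMomentum (q t) (deriv q t) (p t)) :
    B.IsSolutionOn J (fun t => B.proj (q t)) p := by
  obtain ⟨hq2, hq⟩ := hq
  have hd : ∀ t ∈ J, HasDerivAt q (deriv q t) t := fun t ht =>
    ((hq2.differentiableOn (by norm_num)).differentiableAt (hJ.mem_nhds ht)).hasDerivAt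
  have hdd : ∀ t ∈ J, DifferentiableAt ℝ (deriv q) t := fun t ht =>
    (((contDiffOn_succ_iff_deriv_of_isOpen (n := 1) hJ).1 hq2).2.2.differentiableOn
      (by norm_num)).differentiableAt (hJ.mem_nhds ht)
  -- Since (w ∧ γ)γ = w, the horizontal vector is recovered by a formula that is differentiable
  -- along a C² motion.
  let w : ℝ → Fin n → ℝ := fun t => ((q t).1ᵀ * (deriv q t).1) *ᵥ B.proj (q t)
  have hw : ∀ t ∈ J, w t ⬝ᵥ B.proj (q t) = 0 ∧ deriv q t = B.lift (q t) (w t) := by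
    intro t ht
    obtain ⟨hc, hu, -⟩ := hq t ht
    obtain ⟨v, hv, hv'⟩ := (mem_distribution_iff hc _).1 hu
    have : w t = v := by
      simp only [w]
      rw [hv', transpose_mul_lift_fst hc, wedge_mulVec, proj_dotProduct_self hc, hv]
      simp
    rw [this]
    exact ⟨hv, hv'⟩
  have hpw : ∀ t ∈ J, p t = -B.ε⁻¹ • B.inertiaVec (B.proj (q t)) (w t) := fun t ht => by
    have h := hp t ht
    rw [(hw t ht).2] at h
    exact (isReducedMomentum_lift_iff (hq t ht).1 (hw t ht).1 _).1 h
  intro t ht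
  obtain ⟨hc, -, hEL⟩ := hq t ht
  have hγγ := proj_dotProduct_self hc
  obtain ⟨hwt, hqw⟩ := hw t ht
  have hev : ∀ᶠ τ in 𝓝 t, q τ ∈ B.config ∧ w τ ⬝ᵥ B.proj (q τ) = 0 ∧
      HasDerivAt q (B.lift (q τ) (w τ)) τ := by
    filter_upwards [hJ.mem_nhds ht] with τ hτ
    exact ⟨(hq τ hτ).1, (hw τ hτ).1, (hd τ hτ).congr_deriv (hw τ hτ).2⟩
  have hγ : HasDerivAt (fun τ => B.proj (q τ)) (-B.ε • w t) t :=
    (((contDiff_proj (B := B) (k := 1)).differentiable (by norm_num)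
      (q t)).hasFDerivAt.comp_hasDerivAt t hev.self_of_nhds.2.2).congr_deriv
      (fderiv_proj_lift hc hwt)
  obtain ⟨w', hw'⟩ : ∃ w', HasDerivAt w w' t := by
    have hb : IsBilinearMap ℝ fun X Y : Matrix (Fin n) (Fin n) ℝ => Xᵀ * Y :=
      ⟨fun _ _ _ => by rw [transpose_add, Matrix.add_mul],
        fun _ _ _ => by rw [transpose_smul, smul_mul_assoc],
        fun _ _ _ => mul_add _ _ _, fun _ _ _ => mul_smul_comm _ _ _⟩
    exact ⟨_, isBilinearMap_mulVec.hasDerivAt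
      (hb.hasDerivAt (hd t ht).fst (hdd t ht).hasDerivAt.fst) hγ⟩
  obtain ⟨p', hp', hel⟩ := eulerLagrange_lift hev hw'
  have hpt := hpw t ht
  have hpd : HasDerivAt p p' t := hp'.congr_of_eventuallyEq (by
    filter_upwards [hJ.mem_nhds ht] with τ hτ using hpw τ hτ)
  have hpγ : ∀ τ ∈ J, B.proj (q τ) ⬝ᵥ p τ = 0 := fun τ hτ => by
    rw [dotProduct_comm]; exact (hp τ hτ).1
  have hε := B.ε_ne_zero
  -- The component along γ is found by differentiating (γ, p) = 0, the components orthogonal to γ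
  -- from the Lagrange-d'Alembert equations.
  have heq : p' = B.fieldp (B.proj (q t)) (p t) := by
    refine eq_of_dotProduct_eq (γ := B.proj (q t)) ?_ fun x hx => ?_
    · have h1 := isBilinearMap_dotProduct.hasDerivAt hγ hpd
      have h2 : HasDerivAt (fun τ => B.proj (q τ) ⬝ᵥ p τ) 0 t :=
        (hasDerivAt_const t (0 : ℝ)).congr_of_eventuallyEq (by
          filter_upwards [hJ.mem_nhds ht] with τ hτ using hpγ τ hτ)
      have h3 := h1.unique h2
      rw [dotProduct_sub, hpt, fieldp_momentum hγγ hwt]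
      rw [hpt] at h3
      have h4 : B.proj (q t) ⬝ᵥ w t = 0 := by rw [dotProduct_comm, hwt]
      simp only [smul_dotProduct, dotProduct_smul, dotProduct_sub, inertiaVec, smul_eq_mul, hγγ,
        dotProduct_a_mul_comm (B.proj (q t)) (w t)] at h3 ⊢
      field_simp at h3 ⊢
      linear_combination B.ε * h3
    · have h1 := hel x hx
      rw [hEL _ ((mem_distribution_iff hc _).2 ⟨x, hx, rfl⟩), ← hpt] at h1
      have := mul_eq_zero.1 h1.symm
      simpa [hε] using this
  refine ⟨⟨hγγ, hpγ t ht⟩, ?_, heq ▸ hpd⟩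
  refine hγ.congr_deriv ?_
  rw [hpt, fieldγ_momentum hγγ hwt]

theorem contDiffOn_one_of_hasDerivAt {E : Type*} [NormedAddCommGroup E] [NormedSpace ℝ E]
    {J : Set ℝ} (hJ : IsOpen J) {f f' : ℝ → E} (h : ∀ t ∈ J, HasDerivAt f (f' t) t)
    (hf' : ContinuousOn f' J) : ContDiffOn ℝ 1 f J := by
  rw [← zero_add (1 : WithTop ℕ∞)]
  refine (contDiffOn_succ_iff_deriv_of_isOpen hJ).2
    ⟨fun t ht => (h t ht).differentiableAt.differentiableWithinAt, by simp, ?_⟩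
  exact contDiffOn_zero.2 (hf'.congr fun t ht => (h t ht).deriv)

theorem contDiffOn_two_of_hasDerivAt {E : Type*} [NormedAddCommGroup E] [NormedSpace ℝ E]
    {J : Set ℝ} (hJ : IsOpen J) {f f' : ℝ → E} (h : ∀ t ∈ J, HasDerivAt f (f' t) t)
    (hf' : ContDiffOn ℝ 1 f' J) : ContDiffOn ℝ 2 f J := by
  rw [← one_add_one_eq_two]
  refine (contDiffOn_succ_iff_deriv_of_isOpen hJ).2
    ⟨fun t ht => (h t ht).differentiableAt.differentiableWithinAt, by simp, ?_⟩
  exact hf'.congr fun t ht => (h t ht).deriv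

/-- Bootstrap: a solution is continuous, so its velocity is continuous and the curve is C¹; then the
field along it is C¹ too. This makes the reconstructed motion C². -/
theorem contDiffOn_of_isSolutionOn {J : Set ℝ} {γ p : ℝ → Fin n → ℝ} (hJ : IsOpen J)
    (hγp : B.IsSolutionOn J γ p) :
    ContDiffOn ℝ 1 γ J ∧ ContDiffOn ℝ 1 (fun t => B.fieldγ (γ t) (p t)) J := by
  have hγ0 : ∀ t ∈ J, γ t ≠ 0 := fun t ht h => by
    have := (hγp t ht).1.1
    simp [h] at this
  have hc : ContinuousOn (fun t => (γ t, p t)) J := fun t ht =>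
    ((hγp t ht).2.1.continuousAt.prodMk (hγp t ht).2.2.continuousAt).continuousWithinAt
  have hF : ∀ t ∈ J, ContDiffAt ℝ 1 (fun z : (Fin n → ℝ) × (Fin n → ℝ) => B.fieldγ z.1 z.2)
      (γ t, p t) := fun t ht => contDiffAt_fieldγ (hγ0 t ht)
  have hG : ∀ t ∈ J, ContDiffAt ℝ 1 (fun z : (Fin n → ℝ) × (Fin n → ℝ) => B.fieldp z.1 z.2)
      (γ t, p t) := fun t ht => contDiffAt_fieldp (hγ0 t ht)
  have hγ : ContDiffOn ℝ 1 γ J := contDiffOn_one_of_hasDerivAt hJ (fun t ht => (hγp t ht).2.1)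
    fun t ht => (ContinuousAt.comp_continuousWithinAt (f := fun t => (γ t, p t))
      (hF t ht).continuousAt (hc t ht) :)
  have hp : ContDiffOn ℝ 1 p J := contDiffOn_one_of_hasDerivAt hJ (fun t ht => (hγp t ht).2.2)
    fun t ht => (ContinuousAt.comp_continuousWithinAt (f := fun t => (γ t, p t))
      (hG t ht).continuousAt (hc t ht) :)
  exact ⟨hγ, fun t ht => ((hF t ht).comp_contDiffWithinAt t ((hγ t ht).prodMk (hp t ht)) :)⟩

theorem exists_isMotionOn {J : Set ℝ} {γ p : ℝ → Fin n → ℝ} (hJ : IsOpen J)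
    (hJ' : J.OrdConnected) (hγp : B.IsSolutionOn J γ p) {t₀ : ℝ} (ht₀ : t₀ ∈ J) {q₀ : Amb n}
    (hq₀ : q₀ ∈ B.config) (hq₀γ : B.proj q₀ = γ t₀) :
    ∃ q : ℝ → Amb n, q t₀ = q₀ ∧ B.IsMotionOn J q ∧
      ∀ t ∈ J, B.proj (q t) = γ t ∧ B.IsReducedMomentum (q t) (deriv q t) (p t) := by
  have hε := B.ε_ne_zero
  have hR := B.ne_zero
  obtain ⟨hγ2, hF⟩ := contDiffOn_of_isSolutionOn hJ hγp
  let w : ℝ → Fin n → ℝ := fun t => -B.ε⁻¹ • B.fieldγ (γ t) (p t)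
  have hw : ContDiffOn ℝ 1 w J := hF.const_smul _
  have hwγ : ∀ t ∈ J, w t ⬝ᵥ γ t = 0 := fun t ht => by
    simp only [w]
    rw [smul_dotProduct, fieldγ_dotProduct (hγp t ht).1.1, smul_zero]
  have hω : ContDiffOn ℝ 1 (fun t => wedge (w t) (γ t)) J :=
    isBilinearMap_wedge.contDiff.comp_contDiffOn (hw.prodMk hγ2)
  obtain ⟨g, hg0, hgO, hg⟩ := exists_rotation hJ hJ' (ω := fun t => wedge (w t) (γ t))
    (fun t => wedge_transpose _ _) hω.continuousOn ht₀ hq₀.1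
  have hgg : ∀ t ∈ J, (g t)ᵀ * g t = 1 := fun t ht =>
    mul_eq_one_comm.1 ((mem_orthogonalGroup_iff _ _).1
      (mem_specialOrthogonalGroup_iff.1 (hgO t ht)).1)
  -- With ġ = g(w ∧ γ) the derivative of gγ is g(w + γ̇) = (1 - ε) gw, and (σ ± ρ)(1 - ε) = ±ρ; this
  -- is the no-slip constraint.
  let q : ℝ → Amb n := fun t => (g t, (B.σ + B.sgn * B.ρ) • g t *ᵥ γ t)
  have hqc : ∀ t ∈ J, q t ∈ B.config := fun t ht => by
    refine ⟨hgO t ht, ?_⟩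
    simp only [q]
    rw [smul_dotProduct, dotProduct_smul, dotProduct_mulVec, ← mulVec_transpose, mulVec_mulVec,
      hgg t ht, one_mulVec, (hγp t ht).1.1]
    simp only [smul_eq_mul]
    ring
  have hqp : ∀ t ∈ J, B.proj (q t) = γ t := fun t ht => by
    simp only [proj, Γ, q]
    rw [smul_smul, inv_mul_cancel₀ hR, one_smul, mulVec_mulVec, hgg t ht, one_mulVec]
  have hqd : ∀ t ∈ J, HasDerivAt q (g t * wedge (w t) (γ t), (B.sgn * B.ρ) • g t *ᵥ w t) t := by
    intro t ht
    refine (hg t ht).prodMk (((isBilinearMap_mulVec.hasDerivAt (hg t ht)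
      (hγp t ht).2.1).const_smul (B.σ + B.sgn * B.ρ)).congr_deriv ?_)
    have h1 : B.fieldγ (γ t) (p t) = -B.ε • w t := by
      simp only [w, smul_smul]
      rw [neg_mul_neg, mul_inv_cancel₀ hε, one_smul]
    rw [← mulVec_mulVec, wedge_mulVec, hwγ t ht, (hγp t ht).1.1, h1, one_smul, zero_smul,
      sub_zero, mulVec_smul, ← one_smul ℝ (g t *ᵥ w t), smul_smul, ← add_smul, smul_smul,
      smul_smul]
    congr 1
    have h2 := B.one_sub_ε
    field_simp at h2
    linarith
  have hql : ∀ t ∈ J, HasDerivAt q (B.lift (q t) (w t)) t := fun t ht => by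
    rw [lift, hqp t ht]
    exact hqd t ht
  have hg1 : ContDiffOn ℝ 1 g J := contDiffOn_one_of_hasDerivAt hJ hg
    ((isBilinearMap_matrixMul.contDiff (k := 0)).continuous.comp_continuousOn
      (ContinuousOn.prodMk (fun t ht => (hg t ht).continuousAt.continuousWithinAt)
        hω.continuousOn))
  have hq2 : ContDiffOn ℝ 2 q J := by
    refine contDiffOn_two_of_hasDerivAt hJ hqd (ContDiffOn.prodMk ?_ ?_)
    · exact isBilinearMap_matrixMul.contDiff.comp_contDiffOn (hg1.prodMk hω)
    · exact (isBilinearMap_mulVec.contDiff.comp_contDiffOn (hg1.prodMk hw)).const_smul _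
  have hmom : ∀ t ∈ J, -B.ε⁻¹ • B.inertiaVec (γ t) (w t) = p t := fun t ht =>
    momentum_fieldγ (hγp t ht).1.1 (hγp t ht).1.2
  have hwq : ∀ t ∈ J, w t ⬝ᵥ B.proj (q t) = 0 := fun t ht => by rw [hqp t ht, hwγ t ht]
  have hdq : ∀ t ∈ J, deriv q t = B.lift (q t) (w t) := fun t ht => (hql t ht).deriv
  refine ⟨q, Prod.ext hg0 ?_, ⟨hq2, fun t ht => ⟨hqc t ht, ?_, ?_⟩⟩, fun t ht => ⟨hqp t ht, ?_⟩⟩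
  · simp only [q]
    rw [hg0, ← hq₀γ, mulVec_proj hq₀, Γ, smul_smul, mul_inv_cancel₀ hR, one_smul]
  · rw [hdq t ht]
    exact (mem_distribution_iff (hqc t ht) _).2 ⟨w t, hwq t ht, rfl⟩
  · intro δ hδ
    obtain ⟨x, hx, rfl⟩ := (mem_distribution_iff (hqc t ht) _).1 hδ
    obtain ⟨p', hp', hel⟩ := eulerLagrange_lift (B := B) (q := q) (w := w) (t := t)
      (by filter_upwards [hJ.mem_nhds ht] with τ hτ using ⟨hqc τ hτ, hwq τ hτ, hql τ hτ⟩)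
      ((hw.differentiableOn (by norm_num)).differentiableAt (hJ.mem_nhds ht)).hasDerivAt
    have h1 : HasDerivAt p p' t := hp'.congr_of_eventuallyEq (by
      filter_upwards [hJ.mem_nhds ht] with τ hτ
      rw [hqp τ hτ, hmom τ hτ])
    rw [hel x hx, hqp t ht, hmom t ht, h1.unique (hγp t ht).2.2]
    simp
  · rw [hdq t ht]
    refine (isReducedMomentum_lift_iff (hqc t ht) (hwq t ht) _).2 ?_
    rw [hqp t ht, hmom t ht]

end RubberBall

/-! ### Divergence of sums of scalar multiples of linear fields -/

section Divergence

variable {E : Type*} [NormedAddCommGroup E] [NormedSpace ℝ E]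

theorem divergence_add {X Y : E → E} {z : E} (hX : DifferentiableAt ℝ X z)
    (hY : DifferentiableAt ℝ Y z) :
    divergence (fun z => X z + Y z) z = divergence X z + divergence Y z := by
  rw [divergence, fderiv_fun_add hX hY]
  simp [divergence]

theorem divergence_smul [FiniteDimensional ℝ E] {f : E → ℝ} {X : E → E} {z : E}
    (hf : DifferentiableAt ℝ f z) (hX : DifferentiableAt ℝ X z) :
    divergence (fun z => f z • X z) z = fderiv ℝ f z (X z) + f z * divergence X z := by
  rw [divergence, fderiv_fun_smul hf hX]
  have h : ((f z • fderiv ℝ X z + (fderiv ℝ f z).smulRight (X z) : E →L[ℝ] E) : E →ₗ[ℝ] E) =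
      f z • (fderiv ℝ X z : E →ₗ[ℝ] E) + (fderiv ℝ f z : E →ₗ[ℝ] ℝ).smulRight (X z) := rfl
  rw [h, map_add, map_smul, LinearMap.trace_smulRight, divergence, smul_eq_mul, add_comm]
  rfl

theorem divergence_eq_zero_of_eventuallyEq {X : E → E} {z : E}
    (h : X =ᶠ[nhds z] fun _ => 0) : divergence X z = 0 := by
  rw [divergence, h.fderiv_eq]
  simp

variable {n : ℕ}

/-- The linear field `(x, y) ↦ (b₁ x + b₂ y, b₃ x + b₄ y)`, with coordinatewise products. -/
noncomputable def blockMap (b₁ b₂ b₃ b₄ : Fin n → ℝ) :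
    (Fin n → ℝ) × (Fin n → ℝ) →L[ℝ] (Fin n → ℝ) × (Fin n → ℝ) :=
  LinearMap.toContinuousLinearMap
    { toFun := fun z => (b₁ * z.1 + b₂ * z.2, b₃ * z.1 + b₄ * z.2)
      map_add' := fun z z' => by ext <;> simp <;> ring
      map_smul' := fun c z => Prod.ext (by simp) (by simp) }

theorem blockMap_apply (b₁ b₂ b₃ b₄ : Fin n → ℝ) (z : (Fin n → ℝ) × (Fin n → ℝ)) :
    blockMap b₁ b₂ b₃ b₄ z = (b₁ * z.1 + b₂ * z.2, b₃ * z.1 + b₄ * z.2) := rfl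

/-- Only the diagonal blocks contribute to the trace. The divergence of the extended field thus
reduces to directional derivatives of its scalar coefficients. -/
theorem divergence_blockMap (b₁ b₂ b₃ b₄ : Fin n → ℝ) (z : (Fin n → ℝ) × (Fin n → ℝ)) :
    divergence (fun z => blockMap b₁ b₂ b₃ b₄ z) z = ∑ i, b₁ i + ∑ i, b₄ i := by
  rw [divergence_eq_sum ((Pi.basisFun ℝ (Fin n)).prod (Pi.basisFun ℝ (Fin n))),
    (blockMap b₁ b₂ b₃ b₄).hasFDerivAt.fderiv, Fintype.sum_sum_type]
  simp [blockMap_apply, Module.Basis.prod_apply]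

theorem divergence_smul_blockMap {f : (Fin n → ℝ) × (Fin n → ℝ) → ℝ} (b₁ b₂ b₃ b₄ : Fin n → ℝ)
    {z : (Fin n → ℝ) × (Fin n → ℝ)} (hf : DifferentiableAt ℝ f z) :
    divergence (fun z => f z • blockMap b₁ b₂ b₃ b₄ z) z =
      fderiv ℝ f z (blockMap b₁ b₂ b₃ b₄ z) + f z * (∑ i, b₁ i + ∑ i, b₄ i) := by
  rw [divergence_smul hf (blockMap b₁ b₂ b₃ b₄).differentiableAt, divergence_blockMap]

end Divergence

/-! ### Scalar functions of (x, y) and their derivatives -/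

namespace RubberBall

variable {n : ℕ} (B : RubberBall n)

section Scalars

variable (z v : (Fin n → ℝ) × (Fin n → ℝ))

/-- `(x, x)`. -/
noncomputable def sR : ℝ := z.1 ⬝ᵥ z.1
/-- `(x, y)`. -/
noncomputable def sS : ℝ := z.1 ⬝ᵥ z.2
/-- `(x, Ax)`. -/
noncomputable def sα : ℝ := z.1 ⬝ᵥ (B.a * z.1)
/-- `(x, A⁻¹x)`. -/
noncomputable def sβ : ℝ := z.1 ⬝ᵥ (B.a⁻¹ * z.1)
/-- `(x, A⁻¹y)`. -/
noncomputable def sc : ℝ := z.1 ⬝ᵥ (B.a⁻¹ * z.2)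
/-- `(y, A⁻¹y)`. -/
noncomputable def sd : ℝ := z.2 ⬝ᵥ (B.a⁻¹ * z.2)
/-- `(y', A⁻¹x)`, for the projection `y'` of `y` orthogonal to `x`. -/
noncomputable def sq : ℝ := B.sc z - sS z * B.sβ z / sR z
/-- `(y', A⁻¹y')`, for the projection `y'` of `y` orthogonal to `x`. -/
noncomputable def se : ℝ :=
  B.sd z - 2 * sS z * B.sc z / sR z + sS z ^ 2 * B.sβ z / sR z ^ 2

/-! The derivatives of these functions at `z` in the direction `v`. -/

noncomputable def dR : ℝ := 2 * (v.1 ⬝ᵥ z.1)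
noncomputable def dS : ℝ := v.1 ⬝ᵥ z.2 + v.2 ⬝ᵥ z.1
noncomputable def dα : ℝ := 2 * (v.1 ⬝ᵥ (B.a * z.1))
noncomputable def dβ : ℝ := 2 * (v.1 ⬝ᵥ (B.a⁻¹ * z.1))
noncomputable def dc : ℝ := v.1 ⬝ᵥ (B.a⁻¹ * z.2) + v.2 ⬝ᵥ (B.a⁻¹ * z.1)
noncomputable def dd : ℝ := 2 * (v.2 ⬝ᵥ (B.a⁻¹ * z.2))
noncomputable def dq : ℝ :=
  B.dc z v - (dS z v * B.sβ z + sS z * B.dβ z v) / sR z + sS z * B.sβ z * dR z v / sR z ^ 2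
noncomputable def de : ℝ :=
  B.dd z v - 2 * (dS z v * B.sc z + sS z * B.dc z v) / sR z +
    2 * sS z * B.sc z * dR z v / sR z ^ 2 +
    (2 * sS z * dS z v * B.sβ z + sS z ^ 2 * B.dβ z v) / sR z ^ 2 -
    2 * sS z ^ 2 * B.sβ z * dR z v / sR z ^ 3

variable {B z}

theorem sR_pos (hz : z.1 ≠ 0) : 0 < sR z :=
  lt_of_le_of_ne (show 0 ≤ z.1 ⬝ᵥ z.1 from Finset.sum_nonneg fun i _ => mul_self_nonneg (z.1 i))
    fun h =>
    hz (dotProduct_self_eq_zero.1 h.symm)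

theorem sα_pos (hz : z.1 ≠ 0) : 0 < B.sα z := B.dotProduct_a_mul_pos hz

theorem hasLineDerivAt_bilin (b : Fin n → ℝ) (f g : (Fin n → ℝ) × (Fin n → ℝ) →L[ℝ] (Fin n → ℝ)) :
    HasLineDerivAt ℝ (fun z => f z ⬝ᵥ (b * g z)) (f v ⬝ᵥ (b * g z) + g v ⬝ᵥ (b * f z)) z v := by
  have hl : HasDerivAt (fun τ : ℝ => z + τ • v) v 0 := by
    simpa using ((hasDerivAt_id (0 : ℝ)).smul_const v).const_add z
  have h := isBilinearMap_dotProduct.hasDerivAt (f.hasFDerivAt.comp_hasDerivAt 0 hl)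
    ((g.hasFDerivAt.comp_hasDerivAt 0 hl).const_mul b)
  refine HasDerivAt.congr_deriv h ?_
  simp only [Function.comp, zero_smul, add_zero]
  rw [add_comm, ← mul_dotProduct_left b (f z), dotProduct_comm (b * f z)]

theorem hasLineDerivAt_sR : HasLineDerivAt ℝ sR (dR z v) z v := by
  have h := hasLineDerivAt_bilin (z := z) v 1 (.fst ℝ _ _) (.fst ℝ _ _)
  simp only [one_mul] at h
  exact HasDerivAt.congr_deriv h (by simp [dR]; ring)

theorem hasLineDerivAt_sS : HasLineDerivAt ℝ sS (dS z v) z v := by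
  have h := hasLineDerivAt_bilin (z := z) v 1 (.fst ℝ _ _) (.snd ℝ _ _)
  simp only [one_mul] at h
  exact h

theorem hasLineDerivAt_sα : HasLineDerivAt ℝ B.sα (B.dα z v) z v :=
  HasDerivAt.congr_deriv (hasLineDerivAt_bilin (z := z) v B.a (.fst ℝ _ _) (.fst ℝ _ _))
    (by simp [dα]; ring)

theorem hasLineDerivAt_sβ : HasLineDerivAt ℝ B.sβ (B.dβ z v) z v :=
  HasDerivAt.congr_deriv (hasLineDerivAt_bilin (z := z) v B.a⁻¹ (.fst ℝ _ _) (.fst ℝ _ _))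
    (by simp [dβ]; ring)

theorem hasLineDerivAt_sc : HasLineDerivAt ℝ B.sc (B.dc z v) z v :=
  hasLineDerivAt_bilin (z := z) v B.a⁻¹ (.fst ℝ _ _) (.snd ℝ _ _)

theorem hasLineDerivAt_sd : HasLineDerivAt ℝ B.sd (B.dd z v) z v :=
  HasDerivAt.congr_deriv (hasLineDerivAt_bilin (z := z) v B.a⁻¹ (.snd ℝ _ _) (.snd ℝ _ _))
    (by simp [dd]; ring)

theorem hasLineDerivAt_sq (hz : z.1 ≠ 0) : HasLineDerivAt ℝ B.sq (B.dq z v) z v := by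
  have hR := (sR_pos hz).ne'
  have hR' : sR (z + (0 : ℝ) • v) ≠ 0 := by simpa using hR
  refine HasDerivAt.congr_deriv (HasDerivAt.sub (hasLineDerivAt_sc (B := B) v)
    (((hasLineDerivAt_sS v).mul (hasLineDerivAt_sβ (B := B) v)).div (hasLineDerivAt_sR v) hR')) ?_
  simp only [Pi.mul_apply, zero_smul, add_zero, dq]
  field_simp
  ring

theorem hasLineDerivAt_se (hz : z.1 ≠ 0) : HasLineDerivAt ℝ B.se (B.de z v) z v := by
  have hR := (sR_pos hz).ne'
  have hR' : sR (z + (0 : ℝ) • v) ≠ 0 := by simpa using hR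
  refine HasDerivAt.congr_deriv (HasDerivAt.add (HasDerivAt.sub (hasLineDerivAt_sd (B := B) v)
    ((((hasLineDerivAt_sS v).const_mul 2).mul (hasLineDerivAt_sc (B := B) v)).div
      (hasLineDerivAt_sR v) hR'))
    ((((hasLineDerivAt_sS v).pow 2).mul (hasLineDerivAt_sβ (B := B) v)).div
      ((hasLineDerivAt_sR v).pow 2) (pow_ne_zero 2 hR'))) ?_
  simp only [Pi.mul_apply, Pi.pow_apply, zero_smul, add_zero, de]
  field_simp
  ring

/-- Separates the two tasks: differentiability comes from `ContDiffAt`, the value from one-variable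
calculus along a line. -/
theorem fderiv_eq_of_hasLineDerivAt {E : Type*} [NormedAddCommGroup E] [NormedSpace ℝ E]
    {f : E → ℝ} {z v : E} {m : ℝ} (hf : DifferentiableAt ℝ f z) (h : HasLineDerivAt ℝ f m z v) :
    fderiv ℝ f z v = m :=
  HasDerivAt.unique (hf.hasFDerivAt.hasLineDerivAt v) h

variable {k : WithTop ℕ∞}

theorem contDiffAt_sR : ContDiffAt ℝ k sR z := by unfold sR; fun_prop
theorem contDiffAt_sS : ContDiffAt ℝ k sS z := by unfold sS; fun_prop
theorem contDiffAt_sα : ContDiffAt ℝ k B.sα z := by unfold sα; fun_prop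

theorem contDiffAt_sq (hz : z.1 ≠ 0) : ContDiffAt ℝ k B.sq z := by
  have hR : z.1 ⬝ᵥ z.1 ≠ 0 := (sR_pos hz).ne'
  unfold sq sc sβ sR sS
  fun_prop (disch := assumption)

theorem contDiffAt_se (hz : z.1 ≠ 0) : ContDiffAt ℝ k B.se z := by
  have hR : z.1 ⬝ᵥ z.1 ≠ 0 := (sR_pos hz).ne'
  have hR2 : (z.1 ⬝ᵥ z.1) ^ 2 ≠ 0 := pow_ne_zero 2 hR
  unfold se sd sc sβ sR sS
  fun_prop (disch := assumption)

end Scalars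

end RubberBall

/-! ### The extended field: conservation laws and divergence -/

namespace RubberBall

variable {n : ℕ} (B : RubberBall n)

section Coefficients

variable (z v : (Fin n → ℝ) × (Fin n → ℝ))

/-! The coefficients of `ambientField`. -/

noncomputable def coef₁ : ℝ := B.ε ^ 2 * sR z ^ 2 / B.sα z
noncomputable def coef₂ : ℝ := B.ε ^ 2 * (sR z * sS z) / B.sα z
noncomputable def coef₃ : ℝ := -B.ε ^ 2 * (sR z * B.sq z) / B.sα z
noncomputable def coef₄ : ℝ := B.ε * (1 - B.ε) * (sR z ^ 2 * B.se z) / B.sα z ^ 2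
noncomputable def coef₅ : ℝ := B.ε * (1 - B.ε) * (sR z * B.sq z) / B.sα z
noncomputable def coef₆ : ℝ := -B.ε * (sS z * B.sq z + sR z * B.se z) / B.sα z
noncomputable def coef₇ : ℝ := -B.ε ^ 2 * sS z ^ 2 / B.sα z

/-- The extension of the reduced field from `T*S^{n-1}` to the pairs `(x, y)` with `x ≠ 0` which is
invariant under the symplectic maps `(x, y) ↦ (r x, r⁻¹ (y + s x))`. -/
noncomputable def ambientField : (Fin n → ℝ) × (Fin n → ℝ) :=
  B.coef₁ z • blockMap 0 B.a⁻¹ 0 0 z + B.coef₂ z • blockMap (-B.a⁻¹) 0 0 B.a⁻¹ z +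
    B.coef₃ z • blockMap 1 0 0 0 z + B.coef₄ z • blockMap 0 0 B.a 0 z +
    B.coef₅ z • blockMap 0 0 0 1 z + B.coef₆ z • blockMap 0 0 1 0 z +
    B.coef₇ z • blockMap 0 0 B.a⁻¹ 0 z

/-- The energy, up to the factor `ε² / 2`. -/
noncomputable def energy : ℝ := sR z ^ 2 * B.se z / B.sα z

variable {B z} {k : WithTop ℕ∞}

theorem contDiffAt_coef (hz : z.1 ≠ 0) :
    ContDiffAt ℝ k B.coef₁ z ∧ ContDiffAt ℝ k B.coef₂ z ∧ ContDiffAt ℝ k B.coef₃ z ∧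
      ContDiffAt ℝ k B.coef₄ z ∧ ContDiffAt ℝ k B.coef₅ z ∧ ContDiffAt ℝ k B.coef₆ z ∧
      ContDiffAt ℝ k B.coef₇ z ∧ ContDiffAt ℝ k B.energy z := by
  have hα := (sα_pos (B := B) hz).ne'
  have hα2 := pow_ne_zero 2 hα
  have h1 := contDiffAt_sR (z := z) (k := k)
  have h2 := contDiffAt_sS (z := z) (k := k)
  have h3 := contDiffAt_sα (B := B) (z := z) (k := k)
  have h4 := contDiffAt_sq (B := B) (k := k) hz
  have h5 := contDiffAt_se (B := B) (k := k) hz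
  refine ⟨?_, ?_, ?_, ?_, ?_, ?_, ?_, ?_⟩
  · exact (contDiffAt_const.mul (h1.pow 2)).div h3 hα
  · exact (contDiffAt_const.mul (h1.mul h2)).div h3 hα
  · exact (contDiffAt_const.mul (h1.mul h4)).div h3 hα
  · exact (contDiffAt_const.mul ((h1.pow 2).mul h5)).div (h3.pow 2) hα2
  · exact (contDiffAt_const.mul (h1.mul h4)).div h3 hα
  · exact (contDiffAt_const.mul ((h2.mul h4).add (h1.mul h5))).div h3 hα
  · exact (contDiffAt_const.mul (h2.pow 2)).div h3 hα
  · exact ((h1.pow 2).mul h5).div h3 hα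

theorem contDiffAt_ambientField (hz : z.1 ≠ 0) : ContDiffAt ℝ k B.ambientField z := by
  obtain ⟨h1, h2, h3, h4, h5, h6, h7, -⟩ := contDiffAt_coef (B := B) (k := k) hz
  have hb : ∀ b₁ b₂ b₃ b₄ : Fin n → ℝ, ContDiffAt ℝ k (fun z => blockMap b₁ b₂ b₃ b₄ z) z :=
    fun _ _ _ _ => (blockMap _ _ _ _).contDiff.contDiffAt
  exact ((((((h1.smul (hb _ _ _ _)).add (h2.smul (hb _ _ _ _))).add (h3.smul (hb _ _ _ _))).add
    (h4.smul (hb _ _ _ _))).add (h5.smul (hb _ _ _ _))).add (h6.smul (hb _ _ _ _))).add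
    (h7.smul (hb _ _ _ _))

theorem hasLineDerivAt_coef (hz : z.1 ≠ 0) :
    HasLineDerivAt ℝ B.coef₁ (B.ε ^ 2 * (2 * sR z * dR z v / B.sα z -
      sR z ^ 2 * B.dα z v / B.sα z ^ 2)) z v ∧
    HasLineDerivAt ℝ B.coef₂ (B.ε ^ 2 * ((dR z v * sS z + sR z * dS z v) / B.sα z -
      sR z * sS z * B.dα z v / B.sα z ^ 2)) z v ∧
    HasLineDerivAt ℝ B.coef₃ (-B.ε ^ 2 * ((dR z v * B.sq z + sR z * B.dq z v) / B.sα z -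
      sR z * B.sq z * B.dα z v / B.sα z ^ 2)) z v ∧
    HasLineDerivAt ℝ B.coef₄ (B.ε * (1 - B.ε) * ((2 * sR z * dR z v * B.se z +
      sR z ^ 2 * B.de z v) / B.sα z ^ 2 - 2 * sR z ^ 2 * B.se z * B.dα z v / B.sα z ^ 3)) z v ∧
    HasLineDerivAt ℝ B.coef₅ (B.ε * (1 - B.ε) * ((dR z v * B.sq z + sR z * B.dq z v) / B.sα z -
      sR z * B.sq z * B.dα z v / B.sα z ^ 2)) z v ∧
    HasLineDerivAt ℝ B.coef₆ (-B.ε * ((dS z v * B.sq z + sS z * B.dq z v + dR z v * B.se z +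
      sR z * B.de z v) / B.sα z -
      (sS z * B.sq z + sR z * B.se z) * B.dα z v / B.sα z ^ 2)) z v ∧
    HasLineDerivAt ℝ B.coef₇ (-B.ε ^ 2 * (2 * sS z * dS z v / B.sα z -
      sS z ^ 2 * B.dα z v / B.sα z ^ 2)) z v ∧
    HasLineDerivAt ℝ B.energy ((2 * sR z * dR z v * B.se z +
      sR z ^ 2 * B.de z v) / B.sα z - sR z ^ 2 * B.se z * B.dα z v / B.sα z ^ 2) z v := by
  have hα := (sα_pos (B := B) hz).ne'
  have hα' : B.sα (z + (0 : ℝ) • v) ≠ 0 := by simpa using hα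
  have h1 := hasLineDerivAt_sR (z := z) v
  have h2 := hasLineDerivAt_sS (z := z) v
  have h3 := hasLineDerivAt_sα (B := B) (z := z) v
  have h4 := hasLineDerivAt_sq (B := B) v hz
  have h5 := hasLineDerivAt_se (B := B) v hz
  refine ⟨?_, ?_, ?_, ?_, ?_, ?_, ?_, ?_⟩
  · refine HasDerivAt.congr_deriv (((HasDerivAt.pow h1 2).const_mul (B.ε ^ 2)).div h3 hα') ?_
    simp only [Pi.pow_apply, zero_smul, add_zero]
    field_simp
    ring
  · refine HasDerivAt.congr_deriv (((HasDerivAt.mul h1 h2).const_mul (B.ε ^ 2)).div h3 hα') ?_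
    simp only [Pi.mul_apply, zero_smul, add_zero]
    field_simp
  · refine HasDerivAt.congr_deriv (((HasDerivAt.mul h1 h4).const_mul (-B.ε ^ 2)).div h3 hα') ?_
    simp only [Pi.mul_apply, zero_smul, add_zero]
    field_simp
    try ring
  · refine HasDerivAt.congr_deriv ((((HasDerivAt.pow h1 2).mul h5).const_mul
      (B.ε * (1 - B.ε))).div (HasDerivAt.pow h3 2) (pow_ne_zero 2 hα')) ?_
    simp only [Pi.mul_apply, Pi.pow_apply, zero_smul, add_zero]
    field_simp
    ring
  · refine HasDerivAt.congr_deriv (((HasDerivAt.mul h1 h4).const_mul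
      (B.ε * (1 - B.ε))).div h3 hα') ?_
    simp only [Pi.mul_apply, zero_smul, add_zero]
    field_simp
  · refine HasDerivAt.congr_deriv ((((HasDerivAt.mul h2 h4).add (HasDerivAt.mul h1 h5)).const_mul
      (-B.ε)).div h3 hα') ?_
    simp only [Pi.mul_apply, Pi.add_apply, zero_smul, add_zero]
    field_simp
    ring
  · refine HasDerivAt.congr_deriv (((HasDerivAt.pow h2 2).const_mul (-B.ε ^ 2)).div h3 hα') ?_
    simp only [Pi.pow_apply, zero_smul, add_zero]
    field_simp
    ring
  · refine HasDerivAt.congr_deriv (((HasDerivAt.pow h1 2).mul h5).div h3 hα') ?_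
    simp only [Pi.mul_apply, Pi.pow_apply, zero_smul, add_zero]
    field_simp
    ring

end Coefficients

section Products

variable {B} (u v : Fin n → ℝ)

theorem a_inv_mul_dotProduct_a_mul : (B.a⁻¹ * u) ⬝ᵥ (B.a * v) = u ⬝ᵥ v := by
  rw [mul_dotProduct_left, a_inv_mul]

theorem a_mul_dotProduct_a_inv_mul : (B.a * u) ⬝ᵥ (B.a⁻¹ * v) = u ⬝ᵥ v := by
  rw [mul_dotProduct_left, a_mul_inv]

theorem dotProduct_a_inv_mul_comm : u ⬝ᵥ (B.a⁻¹ * v) = v ⬝ᵥ (B.a⁻¹ * u) := by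
  rw [← mul_dotProduct_left, dotProduct_comm]

end Products

variable {B} {z : (Fin n → ℝ) × (Fin n → ℝ)}

theorem ambientField_fst : (B.ambientField z).1 =
    B.coef₁ z • (B.a⁻¹ * z.2) - B.coef₂ z • (B.a⁻¹ * z.1) + B.coef₃ z • z.1 := by
  simp [ambientField, blockMap_apply, sub_eq_add_neg]

theorem ambientField_snd : (B.ambientField z).2 =
    B.coef₂ z • (B.a⁻¹ * z.2) + B.coef₄ z • (B.a * z.1) + B.coef₅ z • z.2 + B.coef₆ z • z.1 +
      B.coef₇ z • (B.a⁻¹ * z.1) := by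
  simp [ambientField, blockMap_apply]

/-- With y' the part of y orthogonal to x, the x-component of the field is (ε²R²/α)(A⁻¹y' - (q/R)x),
and q = (x, A⁻¹y') makes it orthogonal to x. -/
theorem dR_ambientField (hz : z.1 ≠ 0) : dR z (B.ambientField z) = 0 := by
  have hα := (sα_pos (B := B) hz).ne'
  have hR := (sR_pos hz).ne'
  have h1 : (B.a⁻¹ * z.2) ⬝ᵥ z.1 = B.sc z := by rw [sc, dotProduct_comm]
  have h2 : (B.a⁻¹ * z.1) ⬝ᵥ z.1 = B.sβ z := by rw [sβ, dotProduct_comm]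
  have h3 : z.1 ⬝ᵥ z.1 = sR z := rfl
  rw [dR, ambientField_fst]
  simp only [add_dotProduct, sub_dotProduct, smul_dotProduct, h1, h2, h3, smul_eq_mul, coef₁,
    coef₂, coef₃, sq]
  field_simp
  ring

theorem dS_ambientField (hz : z.1 ≠ 0) : dS z (B.ambientField z) = 0 := by
  have hα := (sα_pos (B := B) hz).ne'
  have hR := (sR_pos hz).ne'
  have h1 : (B.a⁻¹ * z.2) ⬝ᵥ z.1 = B.sc z := by rw [sc, dotProduct_comm]
  have h2 : (B.a⁻¹ * z.1) ⬝ᵥ z.1 = B.sβ z := by rw [sβ, dotProduct_comm]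
  have h3 : z.1 ⬝ᵥ z.1 = sR z := rfl
  have h4 : (B.a⁻¹ * z.2) ⬝ᵥ z.2 = B.sd z := by rw [sd, dotProduct_comm]
  have h5 : (B.a⁻¹ * z.1) ⬝ᵥ z.2 = B.sc z := by rw [sc, mul_dotProduct_left]
  have h6 : z.1 ⬝ᵥ z.2 = sS z := rfl
  have h7 : z.2 ⬝ᵥ z.1 = sS z := by rw [sS, dotProduct_comm]
  have h8 : (B.a * z.1) ⬝ᵥ z.1 = B.sα z := by rw [sα, dotProduct_comm]
  rw [dS, ambientField_fst, ambientField_snd]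
  simp only [add_dotProduct, sub_dotProduct, smul_dotProduct, h1, h2, h3, h4, h5, h6, h7, h8,
    smul_eq_mul, coef₁, coef₂, coef₃, coef₄, coef₅, coef₆, coef₇, sq, se]
  field_simp
  ring

theorem dα_ambientField (hz : z.1 ≠ 0) :
    B.dα z (B.ambientField z) = -2 * B.ε ^ 2 * sR z * B.sq z := by
  have hα := (sα_pos (B := B) hz).ne'
  have hR := (sR_pos hz).ne'
  have h3 : z.1 ⬝ᵥ z.1 = sR z := rfl
  have h7 : z.2 ⬝ᵥ z.1 = sS z := by rw [sS, dotProduct_comm]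
  have h8 : z.1 ⬝ᵥ (B.a * z.1) = B.sα z := rfl
  rw [dα, ambientField_fst]
  simp only [add_dotProduct, sub_dotProduct, smul_dotProduct, a_inv_mul_dotProduct_a_mul, h3, h7,
    h8, smul_eq_mul, coef₁, coef₂, coef₃, sq]
  field_simp
  ring

theorem de_ambientField (hz : z.1 ≠ 0) :
    B.de z (B.ambientField z) = -2 * B.ε ^ 2 * sR z * B.sq z * B.se z / B.sα z := by
  have hα := (sα_pos (B := B) hz).ne'
  have hR := (sR_pos hz).ne'
  have h1 : z.2 ⬝ᵥ (B.a⁻¹ * z.1) = B.sc z := by rw [sc, dotProduct_a_inv_mul_comm]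
  have h2 : z.1 ⬝ᵥ (B.a⁻¹ * z.1) = B.sβ z := rfl
  have h3 : z.1 ⬝ᵥ z.1 = sR z := rfl
  have h4 : z.2 ⬝ᵥ (B.a⁻¹ * z.2) = B.sd z := rfl
  have h5 : z.1 ⬝ᵥ (B.a⁻¹ * z.2) = B.sc z := rfl
  have h6 : z.1 ⬝ᵥ z.2 = sS z := rfl
  have h9 : (B.a⁻¹ * z.2) ⬝ᵥ (B.a⁻¹ * z.1) = (B.a⁻¹ * z.1) ⬝ᵥ (B.a⁻¹ * z.2) :=
    dotProduct_comm _ _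
  rw [de, dR_ambientField hz, dS_ambientField hz, dd, dc, dβ, ambientField_fst, ambientField_snd]
  simp only [add_dotProduct, sub_dotProduct, smul_dotProduct, h1, h2, h3, h4, h5, h6, h9,
    a_mul_dotProduct_a_inv_mul, smul_eq_mul, coef₁, coef₂, coef₃, coef₄, coef₅, coef₆, coef₇,
    sq, se]
  field_simp
  ring

/-- Along the field e and α have the same logarithmic derivative -2ε²Rq/α, and R is constant. -/
theorem fderiv_energy_ambientField (hz : z.1 ≠ 0) :
    fderiv ℝ B.energy z (B.ambientField z) = 0 := by
  have hα := (sα_pos (B := B) hz).ne'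
  rw [fderiv_eq_of_hasLineDerivAt
    ((contDiffAt_coef (k := 1) hz).2.2.2.2.2.2.2.differentiableAt (by norm_num))
    (hasLineDerivAt_coef _ hz).2.2.2.2.2.2.2, dR_ambientField hz, dα_ambientField hz,
    de_ambientField hz]
  field_simp
  ring

theorem fderiv_sR_ambientField (hz : z.1 ≠ 0) :
    fderiv ℝ sR z (B.ambientField z) = 0 := by
  rw [fderiv_eq_of_hasLineDerivAt ((contDiffAt_sR (k := 1)).differentiableAt (by norm_num))
    (hasLineDerivAt_sR _), dR_ambientField hz]

theorem fderiv_sS_ambientField (hz : z.1 ≠ 0) :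
    fderiv ℝ sS z (B.ambientField z) = 0 := by
  rw [fderiv_eq_of_hasLineDerivAt ((contDiffAt_sS (k := 1)).differentiableAt (by norm_num))
    (hasLineDerivAt_sS _), dS_ambientField hz]

/-- The scalar blocks with `coef₃` and `coef₅` contribute n(-ε² + ε(1 - ε)) Rq/α. The traces of A⁻¹
cancel in the block with `coef₂`, and the derivatives of the coefficients account for the -2 in n -
2. -/
theorem divergence_ambientField (hz : z.1 ≠ 0) :
    divergence B.ambientField z =
      ((n : ℝ) - 2) * (B.ε - 2 * B.ε ^ 2) * (sR z * B.sq z / B.sα z) := by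
  have hα := (sα_pos (B := B) hz).ne'
  have hR := (sR_pos hz).ne'
  have hd := contDiffAt_coef (B := B) (k := 1) hz
  have hdiff : ∀ {f : (Fin n → ℝ) × (Fin n → ℝ) → ℝ}, ContDiffAt ℝ 1 f z →
      DifferentiableAt ℝ f z := fun h => h.differentiableAt (by norm_num)
  obtain ⟨d1, d2, d3, d4, d5, d6, d7, -⟩ := hd
  have hl := fun v => hasLineDerivAt_coef (B := B) v hz
  have hb : ∀ {f : (Fin n → ℝ) × (Fin n → ℝ) → ℝ}, ContDiffAt ℝ 1 f z →
      ∀ b₁ b₂ b₃ b₄ : Fin n → ℝ,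
      DifferentiableAt ℝ (fun z => f z • blockMap b₁ b₂ b₃ b₄ z) z :=
    fun h _ _ _ _ => (hdiff h).smul (blockMap _ _ _ _).differentiableAt
  have e1 := hb d1 0 B.a⁻¹ 0 0
  have e2 := hb d2 (-B.a⁻¹) 0 0 B.a⁻¹
  have e3 := hb d3 1 0 0 0
  have e4 := hb d4 0 0 B.a 0
  have e5 := hb d5 0 0 0 1
  have e6 := hb d6 0 0 1 0
  have e7 := hb d7 0 0 B.a⁻¹ 0
  have h1 : z.2 ⬝ᵥ (B.a⁻¹ * z.1) = B.sc z := by rw [sc, dotProduct_a_inv_mul_comm]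
  have h2 : z.1 ⬝ᵥ (B.a⁻¹ * z.1) = B.sβ z := rfl
  have h3 : z.1 ⬝ᵥ z.1 = sR z := rfl
  have h5 : z.1 ⬝ᵥ (B.a⁻¹ * z.2) = B.sc z := rfl
  have h6 : z.1 ⬝ᵥ z.2 = sS z := rfl
  have h7 : z.2 ⬝ᵥ z.1 = sS z := by rw [sS, dotProduct_comm]
  have h8 : z.1 ⬝ᵥ (B.a * z.1) = B.sα z := rfl
  have h10 : (B.a⁻¹ * z.2) ⬝ᵥ z.1 = B.sc z := by rw [sc, dotProduct_comm]
  have h11 : (B.a⁻¹ * z.1) ⬝ᵥ z.1 = B.sβ z := by rw [sβ, dotProduct_comm]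
  have h13 : (B.a⁻¹ * z.1) ⬝ᵥ z.2 = B.sc z := by rw [sc, mul_dotProduct_left]
  have h14 : (B.a * z.1) ⬝ᵥ z.1 = B.sα z := by rw [sα, dotProduct_comm]
  unfold ambientField
  rw [divergence_add (((((e1.fun_add e2).fun_add e3).fun_add e4).fun_add e5).fun_add e6) e7,
    divergence_add ((((e1.fun_add e2).fun_add e3).fun_add e4).fun_add e5) e6,
    divergence_add (((e1.fun_add e2).fun_add e3).fun_add e4) e5,
    divergence_add ((e1.fun_add e2).fun_add e3) e4, divergence_add (e1.fun_add e2) e3,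
    divergence_add e1 e2,
    divergence_smul_blockMap _ _ _ _ (hdiff d1), divergence_smul_blockMap _ _ _ _ (hdiff d2),
    divergence_smul_blockMap _ _ _ _ (hdiff d3), divergence_smul_blockMap _ _ _ _ (hdiff d4),
    divergence_smul_blockMap _ _ _ _ (hdiff d5), divergence_smul_blockMap _ _ _ _ (hdiff d6),
    divergence_smul_blockMap _ _ _ _ (hdiff d7),
    fderiv_eq_of_hasLineDerivAt (hdiff d1) (hl _).1,
    fderiv_eq_of_hasLineDerivAt (hdiff d2) (hl _).2.1,
    fderiv_eq_of_hasLineDerivAt (hdiff d3) (hl _).2.2.1,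
    fderiv_eq_of_hasLineDerivAt (hdiff d4) (hl _).2.2.2.1,
    fderiv_eq_of_hasLineDerivAt (hdiff d5) (hl _).2.2.2.2.1,
    fderiv_eq_of_hasLineDerivAt (hdiff d6) (hl _).2.2.2.2.2.1,
    fderiv_eq_of_hasLineDerivAt (hdiff d7) (hl _).2.2.2.2.2.2.1]
  simp only [blockMap_apply, zero_mul, one_mul, neg_mul, add_zero, zero_add, Pi.neg_apply,
    Pi.zero_apply, Pi.one_apply, Finset.sum_neg_distrib, Finset.sum_const_zero, Finset.sum_const,
    Finset.card_univ, Fintype.card_fin, nsmul_eq_mul, mul_one, neg_add_cancel, mul_zero,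
    dq, de, dR, dS, dα, dβ, dc, dd, neg_dotProduct, zero_dotProduct, a_inv_mul_dotProduct_a_mul,
    a_mul_dotProduct_a_inv_mul, h1, h2, h3, h5, h6, h7, h8, h10, h11, h13, h14,
    coef₁, coef₂, coef₃, coef₄, coef₅, coef₆, coef₇,
    sq, se]
  field_simp
  ring

end RubberBall

instance isAddHaarMeasure_volume_pairs (n : ℕ) :
    (volume : Measure ((Fin n → ℝ) × (Fin n → ℝ))).IsAddHaarMeasure :=
  Measure.prod.instIsAddHaarMeasure _ _

/-! ### Cutoff by the conserved quantities and the complete flow -/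

namespace RubberBall

variable {n : ℕ} (B : RubberBall n)

section Cutoff

/-- A smooth function which is `1` on `[c - r, c + r]` and `0` outside of `(c - s, c + s)`. -/
noncomputable def bump (c r s : ℝ) (hr : 0 < r) (hs : r < s) : ContDiffBump c := ⟨r, s, hr, hs⟩

/-- A compactly supported cutoff function of the conserved quantities. -/
noncomputable def cutoff (h : ℕ) (z : (Fin n → ℝ) × (Fin n → ℝ)) : ℝ :=
  -- This factor is one for (x, x) in [1, 9], which contains e²ʳ for 0 ≤ r ≤ 1, and zero for (x, x)
  -- ≤ 1/2, away from the singular set x = 0.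
  bump 5 4 (9 / 2) (by norm_num) (by norm_num) (sR z) *
    bump 0 1 2 (by norm_num) (by norm_num) (sS z) *
    bump 0 (h + 1) (h + 2) (by positivity) (by linarith) (B.energy z)

variable {B} {h : ℕ} {z : (Fin n → ℝ) × (Fin n → ℝ)}

theorem cutoff_eq_one (h1 : 1 ≤ sR z) (h2 : sR z ≤ 9) (h3 : |sS z| ≤ 1)
    (h4 : |B.energy z| ≤ h + 1) : B.cutoff h z = 1 := by
  rw [cutoff, ContDiffBump.one_of_mem_closedBall, ContDiffBump.one_of_mem_closedBall,
    ContDiffBump.one_of_mem_closedBall, one_mul, one_mul]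
  · simpa [bump] using h4
  · simpa [bump] using h3
  · rw [Metric.mem_closedBall, Real.dist_eq, abs_le]
    constructor <;> simp only [bump] <;> linarith

theorem cutoff_nonneg : 0 ≤ B.cutoff h z :=
  mul_nonneg (mul_nonneg (ContDiffBump.nonneg _) (ContDiffBump.nonneg _)) (ContDiffBump.nonneg _)

theorem of_cutoff_ne_zero (hz : B.cutoff h z ≠ 0) :
    1 / 2 < sR z ∧ sR z < 10 ∧ |sS z| < 2 ∧ |B.energy z| < h + 2 := by
  have key : ∀ {c : ℝ} (f : ContDiffBump c) {t : ℝ}, f t ≠ 0 → |t - c| < f.rOut := by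
    intro c f t ht
    by_contra hc
    exact ht (f.zero_of_le_dist (not_lt.1 hc))
  rw [cutoff] at hz
  have h1 := key _ (left_ne_zero_of_mul (left_ne_zero_of_mul hz))
  have h2 := key _ (right_ne_zero_of_mul (left_ne_zero_of_mul hz))
  have h3 := key _ (right_ne_zero_of_mul hz)
  simp only [bump, sub_zero] at h1 h2 h3
  rw [abs_lt] at h1
  exact ⟨by linarith, by linarith, h2, h3⟩

theorem ne_zero_of_sR_pos (hz : 0 < sR z) : z.1 ≠ 0 := fun h => by
  simp [sR, h] at hz

theorem ne_zero_of_cutoff_ne_zero (hz : B.cutoff h z ≠ 0) : z.1 ≠ 0 :=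
  ne_zero_of_sR_pos (by linarith [(of_cutoff_ne_zero hz).1])

theorem cutoff_eventuallyEq (hz : z.1 = 0) : B.cutoff h =ᶠ[nhds z] fun _ => 0 := by
  have hc : ContinuousAt sR z := (contDiffAt_sR (k := 0)).continuousAt
  have h0 : sR z < 1 / 2 := by simp [sR, hz]
  filter_upwards [hc.eventually_lt_const h0] with z' hz'
  by_contra hne
  linarith [(of_cutoff_ne_zero hne).1]

theorem contDiffAt_energy {k : WithTop ℕ∞} (hz : z.1 ≠ 0) : ContDiffAt ℝ k B.energy z :=
  (contDiffAt_coef hz).2.2.2.2.2.2.2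

theorem contDiffAt_cutoff : ContDiffAt ℝ 1 (B.cutoff h) z := by
  by_cases hz : z.1 = 0
  · exact contDiffAt_const.congr_of_eventuallyEq (cutoff_eventuallyEq hz)
  · exact (((ContDiffBump.contDiff _).contDiffAt.comp z contDiffAt_sR).mul
      ((ContDiffBump.contDiff _).contDiffAt.comp z contDiffAt_sS)).mul
      ((ContDiffBump.contDiff _).contDiffAt.comp z (contDiffAt_energy hz))

/-- The cutoff vanishes in a neighbourhood of each point with x = 0, so singularities of `f` there
do no harm. -/
theorem contDiff_cutoff_smul {F : Type*} [NormedAddCommGroup F] [NormedSpace ℝ F]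
    {f : (Fin n → ℝ) × (Fin n → ℝ) → F} (hf : ∀ z, z.1 ≠ 0 → ContDiffAt ℝ 1 f z) :
    ContDiff ℝ 1 fun z => B.cutoff h z • f z := by
  refine contDiff_iff_contDiffAt.2 fun z => ?_
  by_cases hz : z.1 = 0
  · refine contDiffAt_const (c := (0 : F)).congr_of_eventuallyEq ?_
    filter_upwards [cutoff_eventuallyEq (B := B) (h := h) hz] with z' hz'
    rw [hz', zero_smul]
  · exact contDiffAt_cutoff.smul (hf z hz)

theorem fderiv_cutoff_ambientField : fderiv ℝ (B.cutoff h) z (B.ambientField z) = 0 := by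
  by_cases hz : z.1 = 0
  · rw [(cutoff_eventuallyEq hz).fderiv_eq]
    simp
  · have hd : ∀ {f : (Fin n → ℝ) × (Fin n → ℝ) → ℝ} {c : ℝ} (g : ContDiffBump c),
        ContDiffAt ℝ 1 f z → fderiv ℝ f z (B.ambientField z) = 0 →
        ∃ f' : (Fin n → ℝ) × (Fin n → ℝ) →L[ℝ] ℝ,
          HasFDerivAt (fun z => g (f z)) f' z ∧ f' (B.ambientField z) = 0 := by
      intro f c g hf h0
      have hg : DifferentiableAt ℝ g (f z) :=
        (g.contDiff (n := 1) : ContDiff ℝ 1 g).differentiable (by norm_num) (f z)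
      refine ⟨_, hg.hasFDerivAt.comp z
        (hf.differentiableAt (by norm_num)).hasFDerivAt, ?_⟩
      rw [ContinuousLinearMap.comp_apply, h0, map_zero]
    obtain ⟨f₁, h1, h1'⟩ := hd (bump 5 4 (9 / 2) (by norm_num) (by norm_num)) contDiffAt_sR
      (fderiv_sR_ambientField hz)
    obtain ⟨f₂, h2, h2'⟩ := hd (bump 0 1 2 (by norm_num) (by norm_num)) contDiffAt_sS
      (fderiv_sS_ambientField hz)
    obtain ⟨f₃, h3, h3'⟩ := hd (bump 0 (h + 1) (h + 2) (by positivity) (by linarith))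
      (contDiffAt_energy hz) (fderiv_energy_ambientField hz)
    have := ((h1.mul h2).mul h3).fderiv
    unfold cutoff
    erw [this]
    simp [h1', h2', h3']

end Cutoff

section Weight

/-- The density of the invariant measure of `ambientField`. -/
noncomputable def weight (z : (Fin n → ℝ) × (Fin n → ℝ)) : ℝ :=
  (B.sα z / sR z) ^ (((n : ℝ) - 2) / (2 * B.ε) + 2 - n)

variable {B} {h : ℕ} {z : (Fin n → ℝ) × (Fin n → ℝ)}

theorem weight_nonneg : 0 ≤ B.weight z := by
  by_cases hz : z.1 = 0
  · simp only [weight, sα, sR, hz, mul_zero, zero_dotProduct, div_zero]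
    exact Real.rpow_nonneg le_rfl _
  · exact Real.rpow_nonneg (div_pos (sα_pos hz) (sR_pos hz)).le _

theorem contDiffAt_weight (hz : z.1 ≠ 0) : ContDiffAt ℝ 1 B.weight z :=
  (contDiffAt_sα.div contDiffAt_sR (sR_pos hz).ne').rpow_const_of_ne
    (div_pos (sα_pos hz) (sR_pos hz)).ne'

/-- This determines the exponent κ = (n-2)/(2ε) + 2 - n: the logarithmic derivative -2κε²Rq/α of the
weight has to be minus the divergence of the field. -/
theorem fderiv_weight_ambientField (hz : z.1 ≠ 0) :
    fderiv ℝ B.weight z (B.ambientField z) =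
      -(((n : ℝ) - 2) * (B.ε - 2 * B.ε ^ 2) * (sR z * B.sq z / B.sα z)) * B.weight z := by
  have hα := sα_pos (B := B) hz
  have hR := sR_pos hz
  have hε := B.ε_ne_zero
  have h1 : HasLineDerivAt ℝ B.weight _ z (B.ambientField z) :=
    HasDerivAt.rpow_const (HasDerivAt.div (hasLineDerivAt_sα (B.ambientField z))
      (hasLineDerivAt_sR (B.ambientField z)) (by simpa using hR.ne'))
      (Or.inl (by simpa using (div_pos hα hR).ne'))
  rw [fderiv_eq_of_hasLineDerivAt ((contDiffAt_weight hz).differentiableAt (by norm_num)) h1]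
  simp only [zero_smul, add_zero, dα_ambientField hz, dR_ambientField hz]
  rw [Real.rpow_sub_one (div_pos hα hR).ne', weight]
  field_simp
  ring

theorem divergence_weight_smul_ambientField (hz : z.1 ≠ 0) :
    divergence (fun z => B.weight z • B.ambientField z) z = 0 := by
  rw [divergence_smul ((contDiffAt_weight hz).differentiableAt (by norm_num))
    ((contDiffAt_ambientField (k := 1) hz).differentiableAt (by norm_num)),
    fderiv_weight_ambientField hz, divergence_ambientField hz]
  ring

theorem divergence_cutoff_smul : divergence (fun z => (B.cutoff h z • B.weight z) •
    (B.cutoff h z • B.ambientField z)) z = 0 := by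
  by_cases hz : z.1 = 0
  · refine divergence_eq_zero_of_eventuallyEq ?_
    filter_upwards [cutoff_eventuallyEq (B := B) (h := h) hz] with z' hz'
    rw [hz', zero_smul, zero_smul]
  · have hc : DifferentiableAt ℝ (B.cutoff h) z := contDiffAt_cutoff.differentiableAt (by norm_num)
    -- One cutoff belongs to the density and one to the field; their product is a first integral
    -- times a divergence-free field.
    have h1 : (fun z => (B.cutoff h z • B.weight z) • (B.cutoff h z • B.ambientField z)) =
        fun z => (B.cutoff h z * B.cutoff h z) • (B.weight z • B.ambientField z) := by
      funext z
      simp only [smul_smul, smul_eq_mul]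
      ring_nf
    have h2 : DifferentiableAt ℝ (fun z => B.weight z • B.ambientField z) z :=
      ((contDiffAt_weight hz).smul (contDiffAt_ambientField hz)).differentiableAt (by norm_num)
    rw [h1, divergence_smul (hc.fun_mul hc) h2,
      divergence_weight_smul_ambientField hz, fderiv_fun_mul hc hc]
    simp [fderiv_cutoff_ambientField]

end Weight

section Compactness

variable {B} {h : ℕ} {z : (Fin n → ℝ) × (Fin n → ℝ)}

theorem a_lt_sum (i : Fin n) : B.a i < 1 + ∑ j, B.a j := by
  have := Finset.single_le_sum (f := B.a) (fun j _ => (B.a_pos j).le) (Finset.mem_univ i)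
  linarith

theorem sα_le : B.sα z ≤ (1 + ∑ j, B.a j) * sR z := by
  simp only [sα, sR, dotProduct, Finset.mul_sum, Pi.mul_apply]
  refine Finset.sum_le_sum fun i _ => ?_
  nlinarith [mul_self_nonneg (z.1 i), a_lt_sum (B := B) i]

theorem se_eq (hz : z.1 ≠ 0) : B.se z =
    (z.2 - (sS z / sR z) • z.1) ⬝ᵥ (B.a⁻¹ * (z.2 - (sS z / sR z) • z.1)) := by
  have h1 : z.2 ⬝ᵥ (B.a⁻¹ * z.1) = B.sc z := by rw [sc, dotProduct_a_inv_mul_comm]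
  have h2 : z.1 ⬝ᵥ (B.a⁻¹ * z.1) = B.sβ z := rfl
  have h4 : z.2 ⬝ᵥ (B.a⁻¹ * z.2) = B.sd z := rfl
  have h5 : z.1 ⬝ᵥ (B.a⁻¹ * z.2) = B.sc z := rfl
  have hR := (sR_pos hz).ne'
  simp only [mul_sub, mul_smul_comm, sub_dotProduct, dotProduct_sub, dotProduct_smul,
    smul_dotProduct, h1, h2, h4, h5, smul_eq_mul, se]
  field_simp
  ring

theorem sq_le_se (hz : z.1 ≠ 0) (i : Fin n) :
    (z.2 i - sS z / sR z * z.1 i) ^ 2 ≤ (1 + ∑ j, B.a j) * B.se z := by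
  have hi := B.a_pos i
  have h1 : (B.a i)⁻¹ * (z.2 i - sS z / sR z * z.1 i) ^ 2 ≤ B.se z := by
    rw [se_eq hz, dotProduct]
    refine le_trans (le_of_eq ?_) (Finset.single_le_sum (fun j _ => ?_) (Finset.mem_univ i))
    · simp
      ring
    · have := B.a_pos j
      simp only [Pi.mul_apply, Pi.inv_apply]
      rw [mul_left_comm]
      exact mul_nonneg (inv_pos.2 this).le (mul_self_nonneg _)
  have h2 : 0 ≤ B.se z := le_trans (by positivity) h1
  calc (z.2 i - sS z / sR z * z.1 i) ^ 2
      = B.a i * ((B.a i)⁻¹ * (z.2 i - sS z / sR z * z.1 i) ^ 2) := by field_simp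
    _ ≤ B.a i * B.se z := by gcongr
    _ ≤ _ := by gcongr; exact (a_lt_sum i).le

theorem abs_le_of_sq_le {x c : ℝ} (hc : 0 ≤ c) (hx : x ^ 2 ≤ c) : |x| ≤ c + 1 := by
  rw [abs_le]
  constructor <;> nlinarith

variable (B h) in
-- (x, x) bounds x. The energy bounds e, a positive definite form in the part y' of y orthogonal to
-- x, hence bounds y'. Finally (x, y)/(x, x) bounds the part of y along x.
theorem hasCompactSupport_cutoff : HasCompactSupport (B.cutoff h) := by
  set M := 1 + ∑ j, B.a j with hM
  have hM0 : 0 < M := by have := Finset.sum_nonneg fun j (_ : j ∈ Finset.univ) => (B.a_pos j).le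
                         linarith
  -- Here e = energy · α/R² ≤ 40M(h + 2), from α ≤ 10M and R² ≥ 1/4. The bound of y' is Me + 1, and
  -- |S/R| · |x_i| ≤ 4 · 11 = 44.
  set C : ℝ := M * (40 * M * (h + 2)) + 1 + 44
  have hC : 0 ≤ C := by positivity
  refine HasCompactSupport.of_support_subset_isCompact (isCompact_closedBall 0 C) fun z hz => ?_
  have hz0 := ne_zero_of_cutoff_ne_zero hz
  obtain ⟨h1, h2, h3, h4⟩ := of_cutoff_ne_zero hz
  have hα := sα_pos (B := B) hz0
  have hx : ∀ i, |z.1 i| ≤ 11 := fun i => by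
    refine (abs_le_of_sq_le (by norm_num : (0 : ℝ) ≤ 10) ?_).trans (by norm_num)
    refine le_trans ?_ h2.le
    rw [pow_two, sR, dotProduct]
    exact Finset.single_le_sum (f := fun i => z.1 i * z.1 i)
      (fun j _ => mul_self_nonneg _) (Finset.mem_univ i)
  have he : B.se z ≤ 40 * M * (h + 2) := by
    have h5 : B.se z = B.energy z * B.sα z / sR z ^ 2 := by
      have := (sR_pos hz0).ne'
      rw [energy]
      field_simp
    have h6 : B.energy z * B.sα z ≤ (h + 2) * (M * 10) :=
      calc B.energy z * B.sα z ≤ (h + 2) * B.sα z := by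
            gcongr; exact (le_abs_self _).trans h4.le
        _ ≤ (h + 2) * (M * sR z) := by gcongr; exact sα_le
        _ ≤ _ := by gcongr
    rw [h5, div_le_iff₀ (by positivity)]
    have h7 : (1 : ℝ) / 4 ≤ sR z ^ 2 := by nlinarith
    have h8 : 0 ≤ 40 * M * ((h : ℝ) + 2) := by positivity
    nlinarith
  have hy : ∀ i, |z.2 i| ≤ C := fun i => by
    have h5 : |z.2 i - sS z / sR z * z.1 i| ≤ M * (40 * M * (h + 2)) + 1 :=
      abs_le_of_sq_le (by positivity) ((sq_le_se hz0 i).trans (by gcongr))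
    have h6 : |sS z / sR z * z.1 i| ≤ 4 * 11 := by
      rw [abs_mul, abs_div, abs_of_pos (sR_pos hz0)]
      gcongr
      · rw [div_le_iff₀ (sR_pos hz0)]
        linarith
      · exact hx i
    calc |z.2 i| = |(z.2 i - sS z / sR z * z.1 i) + sS z / sR z * z.1 i| := by ring_nf
      _ ≤ _ := (abs_add_le _ _).trans (by linarith)
  rw [mem_closedBall_zero_iff, Prod.norm_def]
  refine max_le ((pi_norm_le_iff_of_nonneg hC).2 fun i => ?_)
    ((pi_norm_le_iff_of_nonneg hC).2 hy)
  have : 0 ≤ M * (40 * M * ((h : ℝ) + 2)) := by positivity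
  exact (hx i).trans (by simp only [C]; linarith)

end Compactness

section Flow

variable (h : ℕ)

theorem exists_cutoffFlow : ∃ φ : ℝ → (Fin n → ℝ) × (Fin n → ℝ) → (Fin n → ℝ) × (Fin n → ℝ),
    (∀ z, φ 0 z = z) ∧
    (∀ z t, HasDerivAt (fun s => φ s z) (B.cutoff h (φ t z) • B.ambientField (φ t z)) t) ∧
    (∀ s t z, φ (s + t) z = φ s (φ t z)) ∧ (∀ t, Continuous (φ t)) ∧
    (∀ α : ℝ → (Fin n → ℝ) × (Fin n → ℝ),
      (∀ t, HasDerivAt α (B.cutoff h (α t) • B.ambientField (α t)) t) → ∀ t, α t = φ t (α 0)) ∧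
    ∀ t, MeasurePreserving (φ t)
      (volume.withDensity fun z => ENNReal.ofReal (B.cutoff h z • B.weight z))
      (volume.withDensity fun z => ENNReal.ofReal (B.cutoff h z • B.weight z)) := by
  have hY : ContDiff ℝ 1 fun z => B.cutoff h z • B.ambientField z :=
    contDiff_cutoff_smul fun z hz => contDiffAt_ambientField hz
  have hs : HasCompactSupport fun z => B.cutoff h z • B.ambientField z :=
    (B.hasCompactSupport_cutoff h).smul_right
  have hw : ContDiff ℝ 1 fun z => B.cutoff h z • B.weight z :=
    contDiff_cutoff_smul fun z hz => contDiffAt_weight hz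
  obtain ⟨K, hK⟩ := hY.lipschitzWith_of_hasCompactSupport hs (by norm_num)
  obtain ⟨L, hL⟩ := hs.exists_bound_of_continuous hY.continuous
  have hL' : ∀ z, ‖B.cutoff h z • B.ambientField z‖ ≤ L.toNNReal := fun z =>
    (hL z).trans (Real.le_coe_toNNReal L)
  obtain ⟨φ, h0, h1⟩ := exists_flow hK hL'
  refine ⟨φ, h0, h1, flow_add hK h0 h1, fun t => ?_, fun α hα t => ?_, fun t => ?_⟩
  · obtain ⟨C, hC⟩ := flow_lipschitzWith hK h0 h1 t
    exact hC.continuous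
  · exact congrFun (integralCurve_unique hK hα (h1 (α 0)) (t₀ := 0) (h0 _).symm) t
  · exact measurePreserving_flow hK hL' h0 h1 hw.continuous
      (fun z => mul_nonneg cutoff_nonneg weight_nonneg) (B.hasCompactSupport_cutoff h).smul_right
      (hw.smul hY) (fun z => divergence_cutoff_smul) t

/-- The flow of the cut off field `ambientField`. -/
noncomputable def cutoffFlow :
    ℝ → (Fin n → ℝ) × (Fin n → ℝ) → (Fin n → ℝ) × (Fin n → ℝ) := (B.exists_cutoffFlow h).choose

variable {B h} {z : (Fin n → ℝ) × (Fin n → ℝ)}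

theorem cutoffFlow_zero : B.cutoffFlow h 0 z = z := (B.exists_cutoffFlow h).choose_spec.1 z

theorem hasDerivAt_cutoffFlow (t : ℝ) : HasDerivAt (fun s => B.cutoffFlow h s z)
    (B.cutoff h (B.cutoffFlow h t z) • B.ambientField (B.cutoffFlow h t z)) t :=
  (B.exists_cutoffFlow h).choose_spec.2.1 z t

theorem cutoffFlow_add (s t : ℝ) :
    B.cutoffFlow h (s + t) z = B.cutoffFlow h s (B.cutoffFlow h t z) :=
  (B.exists_cutoffFlow h).choose_spec.2.2.1 s t z

theorem continuous_cutoffFlow (t : ℝ) : Continuous (B.cutoffFlow h t) :=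
  (B.exists_cutoffFlow h).choose_spec.2.2.2.1 t

theorem eq_cutoffFlow {α : ℝ → (Fin n → ℝ) × (Fin n → ℝ)}
    (hα : ∀ t, HasDerivAt α (B.cutoff h (α t) • B.ambientField (α t)) t) (t : ℝ) :
    α t = B.cutoffFlow h t (α 0) :=
  (B.exists_cutoffFlow h).choose_spec.2.2.2.2.1 α hα t

theorem measurePreserving_cutoffFlow (t : ℝ) : MeasurePreserving (B.cutoffFlow h t)
    (volume.withDensity fun z => ENNReal.ofReal (B.cutoff h z • B.weight z))
    (volume.withDensity fun z => ENNReal.ofReal (B.cutoff h z • B.weight z)) :=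
  (B.exists_cutoffFlow h).choose_spec.2.2.2.2.2 t

/-- A curve whose velocity is proportional to `ambientField` conserves `(x, x)`, `(x, y)` and the
energy. -/
theorem conserved {α : ℝ → (Fin n → ℝ) × (Fin n → ℝ)} {c : ℝ → ℝ} (h0 : ∀ t, (α t).1 = 0 → c t = 0)
    (hα : ∀ t, HasDerivAt α (c t • B.ambientField (α t)) t) (hz : (α 0).1 ≠ 0) (t : ℝ) :
    sR (α t) = sR (α 0) ∧ sS (α t) = sS (α 0) ∧ B.energy (α t) = B.energy (α 0) := by
  have key : ∀ {f : (Fin n → ℝ) × (Fin n → ℝ) → ℝ},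
      (∀ t, (α t).1 ≠ 0 → fderiv ℝ f (α t) (B.ambientField (α t)) = 0) →
      (∀ t, ContDiffAt ℝ 1 f (α t)) → ∀ t, f (α t) = f (α 0) := by
    intro f h1 h2 t
    have h3 : ∀ t, HasDerivAt (fun t => f (α t)) 0 t := fun t => by
      have h4 := ((h2 t).differentiableAt (by norm_num)).hasFDerivAt.comp_hasDerivAt t (hα t)
      refine h4.congr_deriv ?_
      rw [map_smul]
      by_cases hz : (α t).1 = 0
      · rw [h0 t hz, zero_smul]
      · rw [h1 t hz, smul_zero]
    exact is_const_of_deriv_eq_zero (fun t => (h3 t).differentiableAt) (fun t => (h3 t).deriv) t 0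
  have h1 := key (f := sR) (fun t ht => fderiv_sR_ambientField ht) (fun t => contDiffAt_sR)
  have h2 := key (f := sS) (fun t ht => fderiv_sS_ambientField ht) (fun t => contDiffAt_sS)
  have h3 : ∀ t, (α t).1 ≠ 0 := fun t => ne_zero_of_sR_pos (by rw [h1]; exact sR_pos hz)
  exact ⟨h1 t, h2 t, key (f := B.energy) (fun t ht => fderiv_energy_ambientField ht)
    (fun t => contDiffAt_energy (h3 t)) t⟩

theorem conserved_cutoffFlow (hz : z.1 ≠ 0) (t : ℝ) :
    sR (B.cutoffFlow h t z) = sR z ∧ sS (B.cutoffFlow h t z) = sS z ∧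
      B.energy (B.cutoffFlow h t z) = B.energy z := by
  have := conserved (α := fun t => B.cutoffFlow h t z) (fun t ht => by
    by_contra hne
    exact ne_zero_of_cutoff_ne_zero hne ht) hasDerivAt_cutoffFlow (by rwa [cutoffFlow_zero]) t
  rwa [cutoffFlow_zero] at this

theorem cutoff_cutoffFlow (hz : z.1 ≠ 0) (t : ℝ) :
    B.cutoff h (B.cutoffFlow h t z) = B.cutoff h z := by
  obtain ⟨h1, h2, h3⟩ := conserved_cutoffFlow (h := h) (B := B) hz t
  rw [cutoff, h1, h2, h3, cutoff]

/-- The cutoff is constant along its own flow, so a trajectory that starts where it is one follows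
the original field for all time; this is the completeness. -/
theorem hasDerivAt_cutoffFlow_of_eq_one (hz : B.cutoff h z = 1) (t : ℝ) :
    HasDerivAt (fun s => B.cutoffFlow h s z) (B.ambientField (B.cutoffFlow h t z)) t := by
  refine (hasDerivAt_cutoffFlow t).congr_deriv ?_
  rw [cutoff_cutoffFlow (ne_zero_of_cutoff_ne_zero (by rw [hz]; exact one_ne_zero)), hz, one_smul]

/-- The curves with velocity `ambientField` are given by the flows of the cut off fields. -/
theorem eq_cutoffFlow_of_hasDerivAt {α : ℝ → (Fin n → ℝ) × (Fin n → ℝ)}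
    (h1 : ∀ t, HasDerivAt α (B.ambientField (α t)) t) (h0 : ∀ t, (α t).1 ≠ 0)
    (hz : B.cutoff h (α 0) = 1) (t : ℝ) : α t = B.cutoffFlow h t (α 0) := by
  refine eq_cutoffFlow (fun t => ?_) t
  have h2 : B.cutoff h (α t) = 1 := by
    obtain ⟨e1, e2, e3⟩ := conserved (c := fun _ => 1) (fun t ht => absurd ht (h0 t))
      (fun t => by simpa using h1 t) (h0 0) t
    rw [← hz, cutoff, e1, e2, e3, cutoff]
  rw [h2, one_smul]
  exact h1 t

end Flow

end RubberBall

/-! ### Scalings and shears, and the flow on T*S^{n-1} -/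

namespace RubberBall

variable {n : ℕ} (B : RubberBall n)

/-- The symplectic map `(x, y) ↦ (eʳ x, e⁻ʳ (y + s x))`. -/
noncomputable def scaleShear (r s : ℝ) :
    (Fin n → ℝ) × (Fin n → ℝ) →L[ℝ] (Fin n → ℝ) × (Fin n → ℝ) :=
  (Real.exp r • ContinuousLinearMap.fst ℝ _ _).prod
    ((Real.exp r)⁻¹ • (ContinuousLinearMap.snd ℝ _ _ + s • ContinuousLinearMap.fst ℝ _ _))

section Transport

variable {B} (r s : ℝ) (z : (Fin n → ℝ) × (Fin n → ℝ))

theorem scaleShear_apply :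
    scaleShear r s z = (Real.exp r • z.1, (Real.exp r)⁻¹ • (z.2 + s • z.1)) := rfl

theorem sR_scaleShear : sR (scaleShear r s z) = Real.exp r ^ 2 * sR z := by
  simp only [sR, scaleShear_apply, smul_dotProduct, dotProduct_smul, smul_eq_mul]
  ring

theorem sS_scaleShear : sS (scaleShear r s z) = sS z + s * sR z := by
  have := (Real.exp_pos r).ne'
  simp only [sS, sR, scaleShear_apply, smul_dotProduct, dotProduct_smul, dotProduct_add,
    smul_eq_mul]
  field_simp

theorem sα_scaleShear : B.sα (scaleShear r s z) = Real.exp r ^ 2 * B.sα z := by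
  simp only [sα, scaleShear_apply, smul_dotProduct, dotProduct_smul, mul_smul_comm, smul_eq_mul]
  ring

theorem sβ_scaleShear : B.sβ (scaleShear r s z) = Real.exp r ^ 2 * B.sβ z := by
  simp only [sβ, scaleShear_apply, smul_dotProduct, dotProduct_smul, mul_smul_comm, smul_eq_mul]
  ring

theorem sc_scaleShear : B.sc (scaleShear r s z) = B.sc z + s * B.sβ z := by
  have := (Real.exp_pos r).ne'
  simp only [sc, sβ, scaleShear_apply, smul_dotProduct, dotProduct_smul, mul_smul_comm, mul_add,
    dotProduct_add, smul_eq_mul]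
  field_simp

theorem sd_scaleShear : B.sd (scaleShear r s z) =
    (B.sd z + 2 * s * B.sc z + s ^ 2 * B.sβ z) / Real.exp r ^ 2 := by
  have := (Real.exp_pos r).ne'
  have h1 : z.2 ⬝ᵥ (B.a⁻¹ * z.1) = B.sc z := by rw [sc, dotProduct_a_inv_mul_comm]
  have h2 : z.1 ⬝ᵥ (B.a⁻¹ * z.1) = B.sβ z := rfl
  have h4 : z.2 ⬝ᵥ (B.a⁻¹ * z.2) = B.sd z := rfl
  have h5 : z.1 ⬝ᵥ (B.a⁻¹ * z.2) = B.sc z := rfl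
  rw [sd]
  simp only [scaleShear_apply, smul_dotProduct, dotProduct_smul, mul_smul_comm, mul_add,
    dotProduct_add, add_dotProduct, smul_eq_mul, h1, h2, h4, h5]
  field_simp
  ring

variable {z}

theorem sq_scaleShear (hz : z.1 ≠ 0) : B.sq (scaleShear r s z) = B.sq z := by
  have := (Real.exp_pos r).ne'
  have := (sR_pos hz).ne'
  rw [sq, sc_scaleShear, sS_scaleShear, sβ_scaleShear, sR_scaleShear, sq]
  field_simp
  ring

theorem se_scaleShear (hz : z.1 ≠ 0) : B.se (scaleShear r s z) = B.se z / Real.exp r ^ 2 := by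
  have := (Real.exp_pos r).ne'
  have := (sR_pos hz).ne'
  rw [se, sc_scaleShear, sS_scaleShear, sβ_scaleShear, sR_scaleShear, sd_scaleShear, se]
  field_simp
  ring

theorem energy_scaleShear (hz : z.1 ≠ 0) : B.energy (scaleShear r s z) = B.energy z := by
  have := (Real.exp_pos r).ne'
  have := (sα_pos (B := B) hz).ne'
  rw [energy, sR_scaleShear, se_scaleShear r s hz, sα_scaleShear, energy]
  field_simp

theorem weight_scaleShear : B.weight (scaleShear r s z) = B.weight z := by
  have := (Real.exp_pos r).ne'
  rw [weight, sR_scaleShear, sα_scaleShear, mul_div_mul_left _ _ (pow_ne_zero 2 this), weight]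

theorem scaleShear_fst_ne_zero (hz : z.1 ≠ 0) : (scaleShear r s z).1 ≠ 0 := by
  rw [scaleShear_apply]
  exact smul_ne_zero (Real.exp_pos r).ne' hz

/-- Every (x, y) with x ≠ 0 is the image of a point of T*S^{n-1} under such a map, so this
equivariance dictates the extension, including its terms with S. -/
theorem ambientField_scaleShear (hz : z.1 ≠ 0) :
    B.ambientField (scaleShear r s z) = scaleShear r s (B.ambientField z) := by
  have := (Real.exp_pos r).ne'
  have := (sα_pos (B := B) hz).ne'
  refine Prod.ext ?_ ?_
  · rw [ambientField_fst, scaleShear_apply, scaleShear_apply, ambientField_fst]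
    simp only [← scaleShear_apply, coef₁, coef₂, coef₃, sR_scaleShear, sS_scaleShear,
      sα_scaleShear, sq_scaleShear r s hz]
    ext i
    simp only [Pi.add_apply, Pi.sub_apply, Pi.smul_apply, Pi.mul_apply, Pi.inv_apply, smul_eq_mul]
    field_simp
    ring
  · rw [ambientField_snd, scaleShear_apply, scaleShear_apply, ambientField_fst, ambientField_snd]
    simp only [← scaleShear_apply, coef₁, coef₂, coef₃, coef₄, coef₅, coef₆, coef₇, sR_scaleShear,
      sS_scaleShear, sα_scaleShear, sq_scaleShear r s hz, se_scaleShear r s hz]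
    ext i
    simp only [Pi.add_apply, Pi.sub_apply, Pi.smul_apply, Pi.mul_apply, Pi.inv_apply, smul_eq_mul]
    field_simp
    ring

end Transport

section CotSphere

variable {B} {z : (Fin n → ℝ) × (Fin n → ℝ)}

theorem mem_cotSphere_iff : z ∈ cotSphere n ↔ sR z = 1 ∧ sS z = 0 := Iff.rfl

theorem fst_ne_zero_of_mem_cotSphere (hz : z ∈ cotSphere n) : z.1 ≠ 0 :=
  ne_zero_of_sR_pos (by rw [(mem_cotSphere_iff.1 hz).1]; exact one_pos)

theorem ambientField_eq (hz : z ∈ cotSphere n) :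
    B.ambientField z = (B.fieldγ z.1 z.2, B.fieldp z.1 z.2) := by
  obtain ⟨h1, h2⟩ := mem_cotSphere_iff.1 hz
  have hα := (sα_pos (B := B) (fst_ne_zero_of_mem_cotSphere hz)).ne'
  have e1 : z.2 ⬝ᵥ (B.a⁻¹ * z.1) = B.sc z := by rw [sc, dotProduct_a_inv_mul_comm]
  have e2 : z.1 ⬝ᵥ (B.a * z.1) = B.sα z := rfl
  have e3 : (B.a⁻¹ * z.2) ⬝ᵥ z.2 = B.sd z := by rw [sd, dotProduct_comm]
  have e4 : (B.a * z.1) ⬝ᵥ z.1 = B.sα z := by rw [sα, dotProduct_comm]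
  have e5 : z.2 ⬝ᵥ (B.a⁻¹ * z.2) = B.sd z := rfl
  have e6 : B.sq z = B.sc z := by simp [sq, h2]
  have e7 : B.se z = B.sd z := by simp [se, h2]
  have ha : ∀ i, B.a i ≠ 0 := fun i => (B.a_pos i).ne'
  refine Prod.ext ?_ ?_
  · rw [ambientField_fst]
    simp only [fieldγ, A_mulVec, A_inv_mulVec, e1, e2, coef₁, coef₂, coef₃, h1, h2, e6]
    ext i
    simp only [Pi.add_apply, Pi.sub_apply, Pi.smul_apply, Pi.mul_apply, Pi.inv_apply, smul_eq_mul]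
    field_simp
    ring
  · rw [ambientField_snd]
    simp only [fieldp, A_mulVec, A_inv_mulVec, e1, e2, e3, e4, e5, coef₂, coef₄, coef₅, coef₆,
      coef₇, h1, h2, e6, e7]
    ext i
    have := ha i
    simp only [Pi.add_apply, Pi.sub_apply, Pi.smul_apply, Pi.mul_apply, Pi.inv_apply, smul_eq_mul]
    field_simp
    ring

theorem cutoff_eq_one_of_mem {k : ℕ} (hz : z ∈ cotSphere n) (hk : |B.energy z| ≤ k + 1) {r s : ℝ}
    (hr : r ∈ Set.Icc (0 : ℝ) 1) (hs : s ∈ Set.Icc (0 : ℝ) 1) :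
    B.cutoff k (scaleShear r s z) = 1 := by
  obtain ⟨h1, h2⟩ := mem_cotSphere_iff.1 hz
  have h3 := Real.one_le_exp hr.1
  have h4 : Real.exp r ≤ 3 := by
    have := Real.exp_le_exp.2 hr.2
    linarith [Real.exp_one_lt_d9]
  refine cutoff_eq_one ?_ ?_ ?_ ?_
  · rw [sR_scaleShear, h1]; nlinarith
  · rw [sR_scaleShear, h1]; nlinarith
  · rw [sS_scaleShear, h1, h2, abs_le]
    constructor <;> linarith [hs.1, hs.2]
  · rwa [energy_scaleShear _ _ (fst_ne_zero_of_mem_cotSphere hz)]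

theorem scaleShear_zero_zero : scaleShear 0 0 z = z := by simp [scaleShear_apply]

variable (B) in
/-- An integer bound of the energy. -/
noncomputable def level (z : (Fin n → ℝ) × (Fin n → ℝ)) : ℕ := ⌈|B.energy z|⌉₊

theorem abs_energy_le_level : |B.energy z| ≤ B.level z := Nat.le_ceil _

theorem cutoff_level (hz : z ∈ cotSphere n) : B.cutoff (B.level z) z = 1 := by
  have := cutoff_eq_one_of_mem (B := B) (k := B.level z) hz
    (abs_energy_le_level.trans (by linarith)) (r := 0) (s := 0) (by simp) (by simp)
  rwa [scaleShear_zero_zero] at this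

theorem cutoffFlow_mem_cotSphere (hz : z ∈ cotSphere n) (k : ℕ) (t : ℝ) :
    B.cutoffFlow k t z ∈ cotSphere n := by
  obtain ⟨h1, h2, -⟩ := conserved_cutoffFlow (B := B) (h := k) (fst_ne_zero_of_mem_cotSphere hz) t
  rw [mem_cotSphere_iff, h1, h2]
  exact mem_cotSphere_iff.1 hz

variable (B) in
/-- The flow of the explicit equations on `T*S^{n-1}`. -/
noncomputable def flow (t : ℝ) (z : cotSphere n) : cotSphere n :=
  -- The cutoff level depends on the point and is high enough for the cutoff to be one along its
  -- trajectory; energy conservation keeps the level constant there.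
  ⟨B.cutoffFlow (B.level z) t z, cutoffFlow_mem_cotSphere z.2 _ t⟩

theorem hasDerivAt_flow (z : cotSphere n) (t : ℝ) :
    HasDerivAt (fun t => (B.flow t z : (Fin n → ℝ) × (Fin n → ℝ)))
      (B.ambientField (B.flow t z)) t :=
  hasDerivAt_cutoffFlow_of_eq_one (cutoff_level z.2) t

theorem flow_zero (z : cotSphere n) : B.flow 0 z = z := Subtype.ext cutoffFlow_zero

variable (B) in
theorem isFlow_flow : B.IsFlow B.flow := by
  refine fun z => ⟨flow_zero z, fun t _ => ⟨(B.flow t z).2, ?_⟩⟩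
  have h := hasDerivAt_flow (B := B) z t
  rw [ambientField_eq (B.flow t z).2] at h
  exact ⟨(ContinuousLinearMap.fst ℝ (Fin n → ℝ) (Fin n → ℝ)).hasFDerivAt.comp_hasDerivAt t h,
    (ContinuousLinearMap.snd ℝ (Fin n → ℝ) (Fin n → ℝ)).hasFDerivAt.comp_hasDerivAt t h⟩

theorem energy_flow (t : ℝ) (z : cotSphere n) : B.energy (B.flow t z) = B.energy z :=
  (conserved_cutoffFlow (fst_ne_zero_of_mem_cotSphere z.2) t).2.2

theorem flow_flow (s t : ℝ) (z : cotSphere n) : B.flow (s + t) z = B.flow s (B.flow t z) := by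
  refine Subtype.ext ?_
  have h : B.level (B.flow t z) = B.level z := by rw [level, energy_flow, level]
  change B.cutoffFlow (B.level z) (s + t) z = B.cutoffFlow (B.level (B.flow t z)) s (B.flow t z)
  rw [cutoffFlow_add, h]
  rfl

theorem measurable_abs_energy : Measurable fun z : cotSphere n => |B.energy z| := by
  refine (continuous_abs.comp (continuous_iff_continuousAt.2 fun z => ?_)).measurable
  exact ContinuousAt.comp (g := B.energy) (contDiffAt_energy (k := 0)
    (fst_ne_zero_of_mem_cotSphere z.2)).continuousAt continuous_subtype_val.continuousAt

theorem measurable_comp_nat {X Y Z : Type*} [MeasurableSpace X] [MeasurableSpace Y]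
    [MeasurableSpace Z] {f : ℕ → Y → Z} (hf : ∀ k, Measurable (f k)) {l : X → ℕ} (hl : Measurable l)
    {g : X → Y} (hg : Measurable g) : Measurable fun x => f (l x) (g x) :=
  (measurable_from_prod_countable_right (f := fun q : ℕ × Y => f q.1 q.2) hf).comp
    (hl.prodMk hg)

theorem measurable_level : Measurable fun z : cotSphere n => B.level z := by
  unfold level
  exact Nat.measurable_ceil.comp measurable_abs_energy

/-- The level is an integer-valued measurable function, so the flow is glued from countably many
continuous maps. -/
theorem measurable_flow (t : ℝ) : Measurable (B.flow t) := by
  have h : B.flow t = fun z => ⟨B.cutoffFlow (B.level z) t z, cutoffFlow_mem_cotSphere z.2 _ t⟩ :=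
    rfl
  rw [h]
  exact (measurable_comp_nat (f := fun k => B.cutoffFlow k t)
    (fun k => (continuous_cutoffFlow (B := B) (h := k) t).measurable)
    (measurable_level (B := B)) measurable_subtype_coe).subtype_mk

/-- The maps `scaleShear r s`, `0 < r, s < 1`, intertwine the flow and the cut off flows. -/
theorem scaleShear_flow {k : ℕ} (z : cotSphere n) (hk : |B.energy z| ≤ k + 1) {r s : ℝ}
    (hr : r ∈ Set.Icc (0 : ℝ) 1) (hs : s ∈ Set.Icc (0 : ℝ) 1) (t : ℝ) :
    scaleShear r s (B.flow t z) = B.cutoffFlow k t (scaleShear r s z) := by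
  have h0 : ∀ t, (B.flow t z : (Fin n → ℝ) × (Fin n → ℝ)).1 ≠ 0 := fun t =>
    fst_ne_zero_of_mem_cotSphere (B.flow t z).2
  have := eq_cutoffFlow_of_hasDerivAt (B := B) (h := k)
    (α := fun t => scaleShear r s (B.flow t z)) (fun t => ?_)
    (fun t => scaleShear_fst_ne_zero r s (h0 t)) ?_ t
  · simpa only [flow_zero] using this
  · rw [ambientField_scaleShear r s (h0 t)]
    exact (scaleShear r s).hasFDerivAt.comp_hasDerivAt t (hasDerivAt_flow z t)
  · simpa only [flow_zero] using cutoff_eq_one_of_mem z.2 hk hr hs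

end CotSphere

/-! ### The invariant measure induced by the tube -/

section TubeMeasure

/-- The parametrization of a neighbourhood of `T*S^{n-1}` by the symplectic maps `scaleShear`. -/
noncomputable def tube (q : cotSphere n × ℝ × ℝ) : (Fin n → ℝ) × (Fin n → ℝ) :=
  scaleShear q.2.1 q.2.2 q.1

theorem continuous_tube : Continuous (tube (n := n)) := by
  unfold tube
  simp only [scaleShear_apply]
  have h := (Real.continuous_exp.comp (continuous_fst.comp (continuous_snd (X := cotSphere n)
    (Y := ℝ × ℝ))))
  have h' := h.inv₀ fun q => (Real.exp_pos _).ne'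
  exact (h.smul (by fun_prop)).prodMk (h'.smul (by fun_prop))

/-- The parameters are read off from the image: (x, x) = e²ʳ and (x, y) = s. -/
theorem tube_injective : Function.Injective (tube (n := n)) := by
  rintro ⟨⟨z, hz⟩, r, s⟩ ⟨⟨z', hz'⟩, r', s'⟩ h
  obtain ⟨h1, h2⟩ := mem_cotSphere_iff.1 hz
  obtain ⟨h1', h2'⟩ := mem_cotSphere_iff.1 hz'
  change scaleShear r s z = scaleShear r' s' z' at h
  have hr : r = r' := by
    have := congrArg sR h
    rw [sR_scaleShear, sR_scaleShear, h1, h1', mul_one, mul_one] at this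
    exact Real.exp_injective ((pow_left_inj₀ (Real.exp_pos _).le (Real.exp_pos _).le
      two_ne_zero).1 this)
  have hs : s = s' := by
    have := congrArg sS h
    rwa [sS_scaleShear, sS_scaleShear, h1, h1', h2, h2', zero_add, zero_add, mul_one,
      mul_one] at this
  subst hr hs
  have he := (Real.exp_pos r).ne'
  rw [scaleShear_apply, scaleShear_apply, Prod.mk.injEq] at h
  have e1 : z.1 = z'.1 := smul_right_injective _ he h.1
  have e2 := smul_right_injective _ (inv_ne_zero he) h.2
  rw [e1] at e2
  simp only [Prod.mk.injEq, Subtype.mk.injEq, and_true]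
  exact Prod.ext e1 (add_right_cancel e2)

theorem isClosed_cotSphere : IsClosed (cotSphere n) :=
  (isClosed_eq (continuous_fst.dotProduct continuous_fst) continuous_const).inter
    (isClosed_eq (continuous_fst.dotProduct continuous_snd) continuous_const)

/-- Lusin–Souslin: an injective Borel map on a standard Borel space is a measurable embedding, so no
inverse has to be constructed. -/
theorem measurableEmbedding_tube : MeasurableEmbedding (tube (n := n)) := by
  have : StandardBorelSpace (cotSphere n) := isClosed_cotSphere.measurableSet.standardBorel
  exact continuous_tube.measurable.measurableEmbedding tube_injective

/-- The measure on `T*S^{n-1}` induced by the density `weight` near it. -/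
noncomputable def tubeMeasure : Measure (cotSphere n) :=
  (((volume.withDensity fun z => ENNReal.ofReal (B.weight z)).comap tube).restrict
    (Set.univ ×ˢ Set.Ioo 0 1 ×ˢ Set.Ioo 0 1)).map Prod.fst

variable {B}

theorem tube_flow {k : ℕ} {z : cotSphere n} (hk : |B.energy z| ≤ k + 1) {r s : ℝ}
    (hr : r ∈ Set.Ioo (0 : ℝ) 1) (hs : s ∈ Set.Ioo (0 : ℝ) 1) (t : ℝ) :
    B.cutoffFlow k t (tube (z, r, s)) = tube (B.flow t z, r, s) :=
  (scaleShear_flow z hk (Set.Ioo_subset_Icc_self hr) (Set.Ioo_subset_Icc_self hs) t).symm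

/-- The flow fixes r and s, and any point that reaches the tube over `T` is found by flowing
backwards. The energy bound on `T` passes to its preimage by conservation. -/
theorem preimage_tube {T : Set (cotSphere n)} {k : ℕ} (hk : ∀ z ∈ T, |B.energy z| ≤ k + 1) (t : ℝ) :
    B.cutoffFlow k t ⁻¹' (tube '' (T ×ˢ Set.Ioo (0 : ℝ) 1 ×ˢ Set.Ioo (0 : ℝ) 1)) =
      tube '' ((B.flow t ⁻¹' T) ×ˢ Set.Ioo (0 : ℝ) 1 ×ˢ Set.Ioo (0 : ℝ) 1) := by
  ext w
  rw [Set.mem_preimage]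
  constructor
  · rintro ⟨⟨z, r, s⟩, ⟨hz, hr, hs⟩, hw⟩
    refine ⟨⟨B.flow (-t) z, r, s⟩, ⟨?_, hr, hs⟩, ?_⟩
    · rw [Set.mem_preimage, ← flow_flow, add_neg_cancel, flow_zero]
      exact hz
    · rw [← tube_flow (hk z hz) hr hs, hw, ← cutoffFlow_add, neg_add_cancel, cutoffFlow_zero]
  · rintro ⟨⟨z, r, s⟩, ⟨hz, hr, hs⟩, rfl⟩
    have hk' : |B.energy z| ≤ k + 1 := by
      have := hk _ hz
      rwa [energy_flow] at this
    rw [tube_flow hk' hr hs]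
    exact Set.mem_image_of_mem _ ⟨hz, hr, hs⟩

theorem cutoff_tube {k : ℕ} {z : cotSphere n} (hk : |B.energy z| ≤ k + 1) {r s : ℝ}
    (hr : r ∈ Set.Ioo (0 : ℝ) 1) (hs : s ∈ Set.Ioo (0 : ℝ) 1) :
    B.cutoff k (tube (z, r, s)) = 1 :=
  cutoff_eq_one_of_mem z.2 hk (Set.Ioo_subset_Icc_self hr) (Set.Ioo_subset_Icc_self hs)

theorem tubeMeasure_apply {T : Set (cotSphere n)} (hT : MeasurableSet T) :
    B.tubeMeasure T = (volume.withDensity fun z => ENNReal.ofReal (B.weight z))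
      (tube '' (T ×ˢ Set.Ioo 0 1 ×ˢ Set.Ioo 0 1)) := by
  rw [tubeMeasure, Measure.map_apply measurable_fst hT,
    Measure.restrict_apply (measurable_fst hT), measurableEmbedding_tube.comap_apply]
  congr 2
  ext q
  simp

/-- On the tubes over `T` and its preimage the cutoff is one, so both measures are computed with the
density that the cutoff flow preserves. -/
theorem tubeMeasure_preimage_flow {T : Set (cotSphere n)} (hT : MeasurableSet T) {k : ℕ}
    (hk : ∀ z ∈ T, |B.energy z| ≤ k + 1) (t : ℝ) :
    B.tubeMeasure (B.flow t ⁻¹' T) = B.tubeMeasure T := by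
  have hm : ∀ {T : Set (cotSphere n)}, MeasurableSet T →
      MeasurableSet (tube '' (T ×ˢ Set.Ioo (0 : ℝ) 1 ×ˢ Set.Ioo (0 : ℝ) 1)) := fun hT =>
    measurableEmbedding_tube.measurableSet_image.2
      (hT.prod (measurableSet_Ioo.prod measurableSet_Ioo))
  have hw : ∀ {T : Set (cotSphere n)}, MeasurableSet T → (∀ z ∈ T, |B.energy z| ≤ k + 1) →
      B.tubeMeasure T = (volume.withDensity fun z => ENNReal.ofReal (B.cutoff k z • B.weight z))
        (tube '' (T ×ˢ Set.Ioo 0 1 ×ˢ Set.Ioo 0 1)) := by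
    intro T hT hk
    rw [tubeMeasure_apply hT, withDensity_apply _ (hm hT), withDensity_apply _ (hm hT)]
    refine setLIntegral_congr_fun (hm hT) ?_
    rintro _ ⟨⟨z, r, s⟩, ⟨hz, hr, hs⟩, rfl⟩
    beta_reduce
    rw [cutoff_tube (hk z hz) hr hs, one_smul]
  have hT' := measurable_flow (B := B) t hT
  have hk' : ∀ z ∈ B.flow t ⁻¹' T, |B.energy z| ≤ k + 1 := fun z hz => by
    simpa only [energy_flow] using hk _ hz
  rw [hw hT hk, hw hT' hk',
    ← (measurePreserving_cutoffFlow (B := B) (h := k) t).measure_preimage (hm hT).nullMeasurableSet]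
  rw [preimage_tube hk]

theorem measurePreserving_explicitFlow (t : ℝ) :
    MeasurePreserving (B.flow t) B.tubeMeasure B.tubeMeasure := by
  refine ⟨measurable_flow t, Measure.ext fun T hT => ?_⟩
  rw [Measure.map_apply (measurable_flow t) hT]
  -- No single cutoff level serves a general `T`; it is exhausted by energy sublevel sets, with
  -- continuity of the measure from below.
  set M : ℕ → Set (cotSphere n) := fun k => T ∩ {z | |B.energy z| ≤ k + 1}
  have hM : ∀ k, MeasurableSet (M k) := fun k =>
    hT.inter (measurableSet_le measurable_abs_energy measurable_const)
  have hmono : Monotone M := fun k l hkl z hz => ⟨hz.1, le_trans (b := (k : ℝ) + 1) hz.2 (by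
    have : (k : ℝ) ≤ l := by exact_mod_cast hkl
    linarith)⟩
  have hU : ⋃ k, M k = T := by
    refine Set.Subset.antisymm (Set.iUnion_subset fun k => Set.inter_subset_left) fun z hz => ?_
    refine Set.mem_iUnion.2 ⟨B.level z, hz, ?_⟩
    exact le_trans (abs_energy_le_level (B := B)) (le_add_of_nonneg_right (zero_le_one (α := ℝ)))
  have h1 := tendsto_measure_iUnion_atTop (μ := B.tubeMeasure) hmono
  have h2 := tendsto_measure_iUnion_atTop (μ := B.tubeMeasure)
    (s := fun k => B.flow t ⁻¹' M k) fun k l hkl => Set.preimage_mono (hmono hkl)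
  rw [← Set.preimage_iUnion, hU] at h2
  rw [hU] at h1
  refine tendsto_nhds_unique h2 (h1.congr fun k => ?_)
  exact (tubeMeasure_preimage_flow (hM k) (fun z hz => hz.2) t).symm

end TubeMeasure

end RubberBall

/-! ### Powers of two-forms and determinants of symplectic maps -/

section FormPow

variable {E : Type*} [AddCommGroup E] [Module ℝ E] {k : ℕ}

/-- The multilinear map whose antisymmetrization is the exterior power of a two-form. -/
def pairProd (β : E →ₗ[ℝ] E →ₗ[ℝ] ℝ) (k : ℕ) : MultilinearMap ℝ (fun _ : Fin k × Fin 2 => E) ℝ :=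
  MultilinearMap.mk' (fun v => ∏ i : Fin k, β (v (i, 0)) (v (i, 1)))
    (by
      rintro v ⟨i, c⟩ x y
      have h : ∀ w : E, ∀ j ∈ Finset.univ.erase i,
          β (Function.update v (i, c) w (j, 0)) (Function.update v (i, c) w (j, 1)) =
            β (v (j, 0)) (v (j, 1)) := fun w j hj => by
        have hj' : j ≠ i := Finset.ne_of_mem_erase hj
        rw [Function.update_of_ne (by simp [hj']), Function.update_of_ne (by simp [hj'])]
      simp only [← Finset.mul_prod_erase _ _ (Finset.mem_univ i), Finset.prod_congr rfl (h _)]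
      fin_cases c <;> simp [Function.update, add_mul])
    (by
      rintro v ⟨i, c⟩ r x
      have h : ∀ w : E, ∀ j ∈ Finset.univ.erase i,
          β (Function.update v (i, c) w (j, 0)) (Function.update v (i, c) w (j, 1)) =
            β (v (j, 0)) (v (j, 1)) := fun w j hj => by
        have hj' : j ≠ i := Finset.ne_of_mem_erase hj
        rw [Function.update_of_ne (by simp [hj']), Function.update_of_ne (by simp [hj'])]
      simp only [← Finset.mul_prod_erase _ _ (Finset.mem_univ i), Finset.prod_congr rfl (h _)]
      fin_cases c <;> simp [Function.update, mul_assoc])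

theorem formPow_eq_alternatization (β : E →ₗ[ℝ] E →ₗ[ℝ] ℝ) (v : Fin k × Fin 2 → E) :
    formPow (fun x y => β x y) k v =
      ((2 : ℝ) ^ k)⁻¹ * MultilinearMap.alternatization (pairProd β k) v := by
  rw [formPow, MultilinearMap.alternatization_apply]
  congr 1
  refine Finset.sum_congr rfl fun s _ => ?_
  rw [Units.smul_def, zsmul_eq_mul]
  rfl

/-- The top exterior power of a two-form is multiplied by the determinant. -/
theorem formPow_comp (β : (Fin k × Fin 2 → ℝ) →ₗ[ℝ] (Fin k × Fin 2 → ℝ) →ₗ[ℝ] ℝ)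
    (P : (Fin k × Fin 2 → ℝ) →ₗ[ℝ] (Fin k × Fin 2 → ℝ)) :
    formPow (fun x y => β x y) k (fun i => P (Pi.single i 1)) =
      LinearMap.det P * formPow (fun x y => β x y) k fun i => Pi.single i 1 := by
  have hb : (fun i => Pi.single i 1) = ⇑(Pi.basisFun ℝ (Fin k × Fin 2)) :=
    funext fun i => (Pi.basisFun_apply ℝ _ i).symm
  have hP : (fun i => P (Pi.single i 1)) = P ∘ ⇑(Pi.basisFun ℝ (Fin k × Fin 2)) := by
    rw [← hb]; rfl
  rw [formPow_eq_alternatization, formPow_eq_alternatization, hP, hb,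
    (MultilinearMap.alternatization (pairProd β k)).eq_smul_basis_det (Pi.basisFun ℝ _)]
  simp only [AlternatingMap.smul_apply, Module.Basis.det_comp, Module.Basis.det_self, smul_eq_mul]
  ring

end FormPow

section Symplectic

variable {n : ℕ}

theorem canonicalForm_eq (v w : (Fin n → ℝ) × (Fin n → ℝ)) :
    canonicalForm v w = v.2 ⬝ᵥ w.1 - v.1 ⬝ᵥ w.2 := by
  simp [canonicalForm, dotProduct, Finset.sum_sub_distrib]

/-- The canonical symplectic form as a bilinear map. -/
def symplecticForm (n : ℕ) :
    (Fin n → ℝ) × (Fin n → ℝ) →ₗ[ℝ] (Fin n → ℝ) × (Fin n → ℝ) →ₗ[ℝ] ℝ :=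
  LinearMap.mk₂ ℝ canonicalForm
    (fun _ _ _ => by simp only [canonicalForm_eq, Prod.fst_add, Prod.snd_add, add_dotProduct]; ring)
    (fun _ _ _ => by
      simp only [canonicalForm_eq, Prod.smul_fst, Prod.smul_snd, smul_dotProduct, smul_eq_mul]
      ring)
    (fun _ _ _ => by simp only [canonicalForm_eq, Prod.fst_add, Prod.snd_add, dotProduct_add]; ring)
    (fun _ _ _ => by
      simp only [canonicalForm_eq, Prod.smul_fst, Prod.smul_snd, dotProduct_smul, smul_eq_mul]
      ring)

theorem separatingLeft_symplecticForm : (symplecticForm n).SeparatingLeft := by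
  intro v hv
  have h1 := hv (v.2, -v.1)
  simp only [symplecticForm, LinearMap.mk₂_apply, canonicalForm_eq, dotProduct_neg] at h1
  have h2 : 0 ≤ v.1 ⬝ᵥ v.1 := Finset.sum_nonneg fun i _ => mul_self_nonneg (v.1 i)
  have h3 : 0 ≤ v.2 ⬝ᵥ v.2 := Finset.sum_nonneg fun i _ => mul_self_nonneg (v.2 i)
  exact Prod.ext (dotProduct_self_eq_zero.1 (by linarith)) (dotProduct_self_eq_zero.1 (by linarith))

/-- From TᵀJT = J with det J ≠ 0 it follows that (det T)² = 1. -/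
theorem abs_det_of_symplectic {T : (Fin n → ℝ) × (Fin n → ℝ) →ₗ[ℝ] (Fin n → ℝ) × (Fin n → ℝ)}
    (hT : ∀ v w, canonicalForm (T v) (T w) = canonicalForm v w) : |LinearMap.det T| = 1 := by
  set b := (Pi.basisFun ℝ (Fin n)).prod (Pi.basisFun ℝ (Fin n))
  have h1 : (symplecticForm n).compl₁₂ T T = symplecticForm n :=
    LinearMap.ext₂ fun v w => hT v w
  have h2 := congrArg Matrix.det (LinearMap.toMatrix₂_compl₁₂ b b b b (symplecticForm n) T T)
  have h3 := (LinearMap.separatingLeft_iff_det_ne_zero b).1 (separatingLeft_symplecticForm (n := n))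
  rw [h1, Matrix.det_mul, Matrix.det_mul, Matrix.det_transpose, LinearMap.det_toMatrix] at h2
  have h4 : LinearMap.det T ^ 2 = 1 := by
    refine mul_left_cancel₀ h3 ?_
    linear_combination -h2
  rw [← sq_abs] at h4
  exact (pow_eq_one_iff_of_nonneg (abs_nonneg _) two_ne_zero).1 h4

end Symplectic

/-! ### A symplectic frame adapted to T*S^{n-1} -/

section Frame

variable {m : ℕ}

/-- Linear coordinates on the space of pairs: the first components of `x` and `y` are split off. -/
def splitting (m : ℕ) :
    ((Fin m × Fin 2 → ℝ) × ℝ × ℝ) ≃ₗ[ℝ] (Fin (m + 1) → ℝ) × (Fin (m + 1) → ℝ) where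
  toFun q := (Fin.cons q.2.1 fun j => q.1 (j, 0), Fin.cons q.2.2 fun j => q.1 (j, 1))
  map_add' q q' := by
    refine Prod.ext ?_ ?_ <;> ext i <;> refine Fin.cases ?_ (fun j => ?_) i <;> simp
  map_smul' c q := by
    refine Prod.ext ?_ ?_ <;> ext i <;> refine Fin.cases ?_ (fun j => ?_) i <;> simp
  invFun v := (fun i => ![v.1 i.1.succ, v.2 i.1.succ] i.2, v.1 0, v.2 0)
  left_inv q := by
    refine Prod.ext ?_ ?_
    · ext ⟨j, c⟩
      fin_cases c <;> simp
    · simp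
  right_inv v := by
    refine Prod.ext ?_ ?_ <;> ext i <;> refine Fin.cases ?_ (fun j => ?_) i <;> simp

theorem splitting_apply (q : (Fin m × Fin 2 → ℝ) × ℝ × ℝ) : splitting m q =
    (Fin.cons q.2.1 fun j => q.1 (j, 0), Fin.cons q.2.2 fun j => q.1 (j, 1)) := rfl

theorem splitting_symm_snd (v : (Fin (m + 1) → ℝ) × (Fin (m + 1) → ℝ)) :
    ((splitting m).symm v).2 = (v.1 0, v.2 0) := rfl

/-- The reflection that maps the first basis vector to the unit vector `γ`. -/
noncomputable def householder (γ v : Fin (m + 1) → ℝ) : Fin (m + 1) → ℝ :=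
  -- If `γ` is the first basis vector the quotient is 0/0 = 0 and the map is the identity.
  v - (2 * ((γ - Pi.single 0 1) ⬝ᵥ v) / ((γ - Pi.single 0 1) ⬝ᵥ (γ - Pi.single 0 1))) •
    (γ - Pi.single 0 1)

variable {γ : Fin (m + 1) → ℝ}

theorem householder_single (hγ : γ ⬝ᵥ γ = 1) : householder γ (Pi.single 0 1) = γ := by
  rw [householder]
  by_cases h : γ = Pi.single 0 1
  · simp [h]
  · have h1 : (γ - Pi.single 0 1) ⬝ᵥ (γ - Pi.single 0 1) ≠ 0 := fun h0 =>
      h (sub_eq_zero.1 (dotProduct_self_eq_zero.1 h0))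
    have h2 : 2 * ((γ - Pi.single 0 1) ⬝ᵥ Pi.single 0 1) =
        -((γ - Pi.single 0 1) ⬝ᵥ (γ - Pi.single 0 1)) := by
      simp only [sub_dotProduct, dotProduct_sub, hγ, dotProduct_single, single_dotProduct]
      simp
      ring
    rw [h2, neg_div, div_self h1]
    module

theorem householder_dotProduct (v w : Fin (m + 1) → ℝ) :
    householder γ v ⬝ᵥ householder γ w = v ⬝ᵥ w := by
  rw [householder, householder]
  set u := γ - Pi.single 0 1
  by_cases h : u = 0
  · simp [h]
  · have h1 : u ⬝ᵥ u ≠ 0 := fun h0 => h (dotProduct_self_eq_zero.1 h0)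
    simp only [sub_dotProduct, dotProduct_sub, smul_dotProduct, dotProduct_smul, smul_eq_mul]
    rw [dotProduct_comm v u]
    field_simp
    ring

theorem householder_add (v w : Fin (m + 1) → ℝ) :
    householder γ (v + w) = householder γ v + householder γ w := by
  simp only [householder, dotProduct_add, mul_add, add_div, add_smul]
  abel

theorem householder_smul (c : ℝ) (v : Fin (m + 1) → ℝ) :
    householder γ (c • v) = c • householder γ v := by
  simp only [householder, dotProduct_smul, smul_sub, smul_smul, smul_eq_mul]
  ring_nf

/-- A symplectic map adapted to the tangent space of `T*S^{n-1}` at `z`. -/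
noncomputable def adaptedMap (z : (Fin (m + 1) → ℝ) × (Fin (m + 1) → ℝ)) :
    (Fin (m + 1) → ℝ) × (Fin (m + 1) → ℝ) →ₗ[ℝ] (Fin (m + 1) → ℝ) × (Fin (m + 1) → ℝ) where
  -- The reflection on both factors is followed by the shear with the symmetric matrix xyᵀ + yxᵀ.
  -- The shear sends the images of the two first basis vectors to (x, -y) and (0, x), the velocities
  -- of the scaling and the shear at r = s = 0.
  toFun v := (householder z.1 v.1, householder z.1 v.2 -
    (z.2 ⬝ᵥ householder z.1 v.1) • z.1 - (z.1 ⬝ᵥ householder z.1 v.1) • z.2)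
  map_add' v w := by
    refine Prod.ext ?_ ?_
    · simp only [Prod.fst_add, householder_add]
    · simp only [Prod.fst_add, Prod.snd_add, householder_add, dotProduct_add, add_smul]
      abel
  map_smul' c v := by
    refine Prod.ext ?_ ?_
    · simp only [Prod.smul_fst, householder_smul, RingHom.id_apply]
    · simp only [Prod.smul_fst, Prod.smul_snd, householder_smul, dotProduct_smul, RingHom.id_apply,
        smul_sub, smul_smul, smul_eq_mul]

variable {z : (Fin (m + 1) → ℝ) × (Fin (m + 1) → ℝ)}

theorem canonicalForm_adaptedMap (v w : (Fin (m + 1) → ℝ) × (Fin (m + 1) → ℝ)) :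
    canonicalForm (adaptedMap z v) (adaptedMap z w) = canonicalForm v w := by
  simp only [canonicalForm_eq, adaptedMap, LinearMap.coe_mk, AddHom.coe_mk, sub_dotProduct,
    dotProduct_sub, smul_dotProduct, dotProduct_smul, householder_dotProduct, smul_eq_mul]
  rw [dotProduct_comm _ z.1, dotProduct_comm _ z.2]
  ring

theorem adaptedMap_single_fst (hz : z ∈ cotSphere (m + 1)) :
    adaptedMap z (Pi.single 0 1, 0) = (z.1, -z.2) := by
  have h2 : z.2 ⬝ᵥ z.1 = 0 := by rw [dotProduct_comm]; exact hz.2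
  have h0 : householder z.1 0 = 0 := by simp [householder]
  simp [adaptedMap, householder_single hz.1, h0, hz.1, h2]

theorem adaptedMap_single_snd (hz : z ∈ cotSphere (m + 1)) :
    adaptedMap z (0, Pi.single 0 1) = (0, z.1) := by
  have h0 : householder z.1 0 = 0 := by simp [householder]
  simp [adaptedMap, householder_single hz.1, h0]

/-- The differential at `r = s = 0` of `(u, r, s) ↦ (eʳ x, e⁻ʳ (y + s x))`, where `(x, y)` depends
on `u` with differential `D`, read in the coordinates `splitting`. -/
noncomputable def tubeDeriv (z : (Fin (m + 1) → ℝ) × (Fin (m + 1) → ℝ))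
    (D : (Fin m × Fin 2 → ℝ) →L[ℝ] (Fin (m + 1) → ℝ) × (Fin (m + 1) → ℝ)) :
    (Fin (m + 1) → ℝ) × (Fin (m + 1) → ℝ) →L[ℝ] (Fin (m + 1) → ℝ) × (Fin (m + 1) → ℝ) :=
  (D.comp (.fst ℝ _ _) + ((ContinuousLinearMap.fst ℝ ℝ ℝ).comp (.snd ℝ _ _)).smulRight (z.1, -z.2) +
    ((ContinuousLinearMap.snd ℝ ℝ ℝ).comp (.snd ℝ _ _)).smulRight (0, z.1)).comp
    ((splitting m).symm.toContinuousLinearEquiv :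
      (Fin (m + 1) → ℝ) × (Fin (m + 1) → ℝ) →L[ℝ] (Fin m × Fin 2 → ℝ) × ℝ × ℝ)

/-- The two-form on the coordinate space which corresponds to the canonical one. -/
def coordForm (m : ℕ) : (Fin m × Fin 2 → ℝ) →ₗ[ℝ] (Fin m × Fin 2 → ℝ) →ₗ[ℝ] ℝ :=
  (symplecticForm (m + 1)).compl₁₂ ((splitting m).toLinearMap ∘ₗ LinearMap.inl ℝ _ _)
    ((splitting m).toLinearMap ∘ₗ LinearMap.inl ℝ _ _)

/-- The tangent space is the symplectic complement of (x, -y) and (0, x), so the inverse of the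
adapted map sends it to the pairs with vanishing first components. There the Jacobian has the block
form P ⊕ id, and both sides are |det P| times the same constant. -/
theorem abs_det_tubeDeriv (hz : z ∈ cotSphere (m + 1))
    {D : (Fin m × Fin 2 → ℝ) →L[ℝ] (Fin (m + 1) → ℝ) × (Fin (m + 1) → ℝ)}
    (h1 : ∀ w, (D w).1 ⬝ᵥ z.1 = 0) (h2 : ∀ w, (D w).1 ⬝ᵥ z.2 + (D w).2 ⬝ᵥ z.1 = 0) :
    |(tubeDeriv z D).det| * |formPow (fun x y => coordForm m x y) m fun i => Pi.single i 1| =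
      |formPow canonicalForm m fun i => D (Pi.single i 1)| := by
  have hdet := abs_det_of_symplectic (canonicalForm_adaptedMap (z := z))
  have hdet0 : LinearMap.det (adaptedMap z) ≠ 0 := fun h => by simp [h] at hdet
  set K := (adaptedMap z).equivOfDetNeZero hdet0
  have hK : ∀ v, K v = adaptedMap z v := fun v => rfl
  have hKs : ∀ v w, canonicalForm (K.symm v) w = canonicalForm v (K w) := fun v w => by
    rw [← canonicalForm_adaptedMap (z := z), ← hK, ← hK, K.apply_symm_apply]
  have hE0 : K (Pi.single 0 1, 0) = (z.1, -z.2) := adaptedMap_single_fst hz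
  have hE1 : K (0, Pi.single 0 1) = (0, z.1) := adaptedMap_single_snd hz
  set P : (Fin m × Fin 2 → ℝ) →ₗ[ℝ] (Fin m × Fin 2 → ℝ) :=
    LinearMap.fst ℝ _ _ ∘ₗ (splitting m).symm.toLinearMap ∘ₗ K.symm.toLinearMap ∘ₗ D.toLinearMap
  -- The first components of `K.symm (D w)` are, up to sign, its symplectic products with the two
  -- first basis vectors; moved through `K`, these become `h1` and `h2`.
  have hP : ∀ w, splitting m (P w, 0) = K.symm (D w) := fun w => by
    rw [← LinearEquiv.eq_symm_apply]
    refine Prod.ext rfl ?_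
    have e1 := hKs (D w) (Pi.single 0 1, 0)
    have e2 := hKs (D w) (0, Pi.single 0 1)
    rw [hE0, canonicalForm_eq, canonicalForm_eq] at e1
    rw [hE1, canonicalForm_eq, canonicalForm_eq] at e2
    have := h1 w
    have := h2 w
    simp only [dotProduct_single, dotProduct_neg, dotProduct_zero, mul_one] at e1 e2
    rw [splitting_symm_snd]
    exact Prod.ext (by simp only [Prod.fst_zero]; linarith) (by simp only [Prod.snd_zero]; linarith)
  have hA : (tubeDeriv z D : _ →ₗ[ℝ] (Fin (m + 1) → ℝ) × (Fin (m + 1) → ℝ)) =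
      adaptedMap z ∘ₗ ((splitting m).toLinearMap ∘ₗ (P.prodMap LinearMap.id) ∘ₗ
        (splitting m).symm.toLinearMap) := by
    refine LinearMap.ext fun v => ?_
    obtain ⟨⟨w, a, b⟩, rfl⟩ := (splitting m).surjective v
    have e1 : splitting m (P w, a, b) =
        splitting m (P w, 0) + a • (Pi.single 0 1, 0) + b • (0, Pi.single 0 1) := by
      simp only [splitting_apply]
      refine Prod.ext ?_ ?_ <;> ext i <;> refine Fin.cases ?_ (fun j => ?_) i <;> simp
    have e2 : tubeDeriv z D (splitting m (w, a, b)) = D w + a • (z.1, -z.2) + b • (0, z.1) := by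
      change D ((splitting m).symm (splitting m (w, a, b))).1 +
        ((splitting m).symm (splitting m (w, a, b))).2.1 • (z.1, -z.2) +
        ((splitting m).symm (splitting m (w, a, b))).2.2 • (0, z.1) = _
      rw [LinearEquiv.symm_apply_apply]
    change tubeDeriv z D (splitting m (w, a, b)) = adaptedMap z (splitting m
      ((P.prodMap LinearMap.id) ((splitting m).symm (splitting m (w, a, b)))))
    rw [LinearEquiv.symm_apply_apply, e2]
    change _ = adaptedMap z (splitting m (P w, a, b))
    rw [e1, hP, ← hK, map_add, map_add, map_smul, map_smul, hE0, hE1, K.apply_symm_apply]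
  have hd : |(tubeDeriv z D).det| = |LinearMap.det P| := by
    change |LinearMap.det (tubeDeriv z D : _ →ₗ[ℝ] (Fin (m + 1) → ℝ) × (Fin (m + 1) → ℝ))| = _
    rw [hA, LinearMap.det_comp, abs_mul, hdet, one_mul, LinearMap.det_conj, LinearMap.det_prodMap,
      LinearMap.det_id, mul_one]
  rw [hd, ← abs_mul, ← formPow_comp]
  congr 1
  have e : ∀ i j, canonicalForm (D (Pi.single i 1)) (D (Pi.single j 1)) =
      coordForm m (P (Pi.single i 1)) (P (Pi.single j 1)) := fun i j => by
    change _ = canonicalForm (splitting m (P (Pi.single i 1), 0))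
      (splitting m (P (Pi.single j 1), 0))
    rw [hP, hP, hKs, K.apply_symm_apply]
  simp only [formPow, e]

end Frame

/-! ### The Jacobian of the tube and the measure of the volume form -/

namespace RubberBall

section TubeDerivative

/-- The symplectic part of the differential of `(u, r, s) ↦ scaleShear r s (x u)`. -/
noncomputable def tubeMap {n : ℕ} (r s : ℝ) (z : (Fin n → ℝ) × (Fin n → ℝ)) :
    (Fin n → ℝ) × (Fin n → ℝ) →L[ℝ] (Fin n → ℝ) × (Fin n → ℝ) :=
  (scaleShear r s).comp (LinearMap.toContinuousLinearMap
    -- The r-derivative at (r, s) is the image under `scaleShear` of (x, -y - 2sx) rather than of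
    -- (x, -y). The correction is zero on the s-direction and on tangent vectors, whose first part
    -- is orthogonal to x.
    { toFun := fun v => (v.1, v.2 - (2 * s * (z.1 ⬝ᵥ v.1)) • z.1)
      map_add' := fun v w => by
        refine Prod.ext rfl ?_
        simp only [Prod.fst_add, Prod.snd_add, dotProduct_add, mul_add, add_smul]
        abel
      map_smul' := fun c v => by
        refine Prod.ext rfl ?_
        simp only [Prod.smul_fst, Prod.smul_snd, dotProduct_smul, smul_sub, smul_smul, smul_eq_mul,
          RingHom.id_apply]
        ring_nf })

theorem tubeMap_apply {n : ℕ} (r s : ℝ) (z v : (Fin n → ℝ) × (Fin n → ℝ)) :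
    tubeMap r s z v = scaleShear r s (v.1, v.2 - (2 * s * (z.1 ⬝ᵥ v.1)) • z.1) := rfl

theorem abs_det_tubeMap {n : ℕ} (r s : ℝ) (z : (Fin n → ℝ) × (Fin n → ℝ)) :
    |(tubeMap r s z).det| = 1 := by
  refine abs_det_of_symplectic fun v w => ?_
  have := (Real.exp_pos r).ne'
  change canonicalForm (tubeMap r s z v) (tubeMap r s z w) = _
  simp only [canonicalForm_eq, tubeMap_apply, scaleShear_apply, smul_dotProduct, dotProduct_smul,
    add_dotProduct, dotProduct_add, sub_dotProduct, dotProduct_sub, smul_eq_mul]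
  rw [dotProduct_comm v.1 z.1]
  field_simp
  ring

variable {m : ℕ} {x : (Fin m × Fin 2 → ℝ) → (Fin (m + 1) → ℝ) × (Fin (m + 1) → ℝ)}
  {D : (Fin m × Fin 2 → ℝ) →L[ℝ] (Fin (m + 1) → ℝ) × (Fin (m + 1) → ℝ)} {u : Fin m × Fin 2 → ℝ}

theorem tubeDeriv_splitting (z : (Fin (m + 1) → ℝ) × (Fin (m + 1) → ℝ))
    (q : (Fin m × Fin 2 → ℝ) × ℝ × ℝ) :
    tubeDeriv z D (splitting m q) = D q.1 + q.2.1 • (z.1, -z.2) + q.2.2 • (0, z.1) := by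
  change D ((splitting m).symm (splitting m q)).1 +
    ((splitting m).symm (splitting m q)).2.1 • (z.1, -z.2) +
    ((splitting m).symm (splitting m q)).2.2 • (0, z.1) = _
  rw [LinearEquiv.symm_apply_apply]

/-- All dependence on r and s is put into a symplectic factor of determinant ±1; what remains is the
differential at r = s = 0. -/
theorem hasFDerivAt_tube (hx : HasFDerivAt x D u) (hz : x u ∈ cotSphere (m + 1))
    (h1 : ∀ w, (D w).1 ⬝ᵥ (x u).1 = 0) (r s : ℝ) :
    HasFDerivAt (fun q : (Fin m × Fin 2 → ℝ) × ℝ × ℝ => scaleShear q.2.1 q.2.2 (x q.1))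
      (((tubeMap r s (x u)).comp (tubeDeriv (x u) D)).comp
        ((splitting m).toContinuousLinearEquiv : (Fin m × Fin 2 → ℝ) × ℝ × ℝ →L[ℝ] _))
      (u, r, s) := by
  have hr : HasFDerivAt (fun q : (Fin m × Fin 2 → ℝ) × ℝ × ℝ => q.2.1)
      ((ContinuousLinearMap.fst ℝ ℝ ℝ).comp (.snd ℝ _ _)) (u, r, s) :=
    ((ContinuousLinearMap.fst ℝ ℝ ℝ).comp (.snd ℝ (Fin m × Fin 2 → ℝ) (ℝ × ℝ))).hasFDerivAt
  have hs : HasFDerivAt (fun q : (Fin m × Fin 2 → ℝ) × ℝ × ℝ => q.2.2)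
      ((ContinuousLinearMap.snd ℝ ℝ ℝ).comp (.snd ℝ _ _)) (u, r, s) :=
    ((ContinuousLinearMap.snd ℝ ℝ ℝ).comp (.snd ℝ (Fin m × Fin 2 → ℝ) (ℝ × ℝ))).hasFDerivAt
  have hx' : HasFDerivAt (fun q : (Fin m × Fin 2 → ℝ) × ℝ × ℝ => x q.1)
      (D.comp (.fst ℝ _ _)) (u, r, s) := hx.comp (u, r, s)
    (ContinuousLinearMap.fst ℝ (Fin m × Fin 2 → ℝ) (ℝ × ℝ)).hasFDerivAt
  have hx1 := hx'.fst
  have hx2 := hx'.snd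
  have he := hr.exp
  have he' : HasFDerivAt (fun q : (Fin m × Fin 2 → ℝ) × ℝ × ℝ => (Real.exp q.2.1)⁻¹) _ (u, r, s) :=
    (hasDerivAt_inv (Real.exp_pos r).ne').comp_hasFDerivAt (u, r, s) he
  refine ((he.smul hx1).prodMk (he'.smul (hx2.add (hs.smul hx1)))).congr_fderiv ?_
  refine ContinuousLinearMap.ext fun q => ?_
  have e : (((tubeMap r s (x u)).comp (tubeDeriv (x u) D)).comp
      ((splitting m).toContinuousLinearEquiv : (Fin m × Fin 2 → ℝ) × ℝ × ℝ →L[ℝ] _)) q =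
      tubeMap r s (x u) (D q.1 + q.2.1 • ((x u).1, -(x u).2) + q.2.2 • (0, (x u).1)) := by
    rw [← tubeDeriv_splitting]; rfl
  have h2 : (x u).1 ⬝ᵥ (D q.1).1 = 0 := by rw [dotProduct_comm]; exact h1 q.1
  have h3 : (x u).1 ⬝ᵥ (x u).1 = 1 := hz.1
  have h4 := (Real.exp_pos r).ne'
  rw [e, tubeMap_apply, scaleShear_apply]
  refine Prod.ext ?_ ?_ <;> ext i
  · simp
    ring
  · simp [dotProduct_add, dotProduct_smul, h2, h3]
    field_simp
    ring

theorem continuous_tubeDeriv : Continuous fun q : ((Fin (m + 1) → ℝ) × (Fin (m + 1) → ℝ)) ×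
    ((Fin m × Fin 2 → ℝ) →L[ℝ] (Fin (m + 1) → ℝ) × (Fin (m + 1) → ℝ)) => tubeDeriv q.1 q.2 := by
  unfold tubeDeriv
  fun_prop

theorem tangent_of_mapsTo {n : ℕ} {W : Type*} [NormedAddCommGroup W] [NormedSpace ℝ W]
    {x : W → (Fin n → ℝ) × (Fin n → ℝ)} {D : W →L[ℝ] (Fin n → ℝ) × (Fin n → ℝ)} {U : Set W}
    (hU : IsOpen U) (hxU : Set.MapsTo x U (cotSphere n)) {u : W} (hu : u ∈ U)
    (hx : HasFDerivAt x D u) (w : W) :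
    (D w).1 ⬝ᵥ (x u).1 = 0 ∧ (D w).1 ⬝ᵥ (x u).2 + (D w).2 ⬝ᵥ (x u).1 = 0 := by
  have key : ∀ {f : (Fin n → ℝ) × (Fin n → ℝ) → ℝ} {c d : ℝ}, ContDiffAt ℝ 1 f (x u) →
      (∀ z ∈ cotSphere n, f z = c) → HasLineDerivAt ℝ f d (x u) (D w) → d = 0 := by
    intro f c d hf hc hd
    have h1 := hf.differentiableAt (by norm_num)
    have h2 := h1.hasFDerivAt.comp u hx
    have h3 : f ∘ x =ᶠ[nhds u] fun _ => c := by
      filter_upwards [hU.mem_nhds hu] with v hv using hc _ (hxU hv)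
    have h4 := h2.unique ((hasFDerivAt_const c u).congr_of_eventuallyEq h3)
    rw [← fderiv_eq_of_hasLineDerivAt h1 hd]
    exact DFunLike.congr_fun h4 w
  have h1 := key contDiffAt_sR (fun z hz => (mem_cotSphere_iff.1 hz).1) (hasLineDerivAt_sR _)
  have h2 := key contDiffAt_sS (fun z hz => (mem_cotSphere_iff.1 hz).2) (hasLineDerivAt_sS _)
  rw [dR] at h1
  rw [dS] at h2
  exact ⟨by linarith, h2⟩

end TubeDerivative

section VolumeForm

theorem setLIntegral_prod_fst {X Y : Type*} [MeasurableSpace X] [MeasurableSpace Y] {μ : Measure X}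
    {ν : Measure Y} [SFinite μ] [SFinite ν] {S : Set X} {T : Set Y} (hT : ν T = 1)
    {H : X → ENNReal} (hH : AEMeasurable H (μ.restrict S)) :
    ∫⁻ q in S ×ˢ T, H q.1 ∂(μ.prod ν) = ∫⁻ u in S, H u ∂μ := by
  have h1 : ((μ.restrict S).prod (ν.restrict T)).map Prod.fst = μ.restrict S := by
    rw [Measure.map_fst_prod, Measure.restrict_apply_univ, hT, one_smul]
  rw [← Measure.prod_restrict]
  conv_rhs => rw [← h1]
  rw [lintegral_map' (by rwa [h1]) measurable_fst.aemeasurable]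

variable {m : ℕ} {B : RubberBall (m + 1)}

theorem density_eq_weight {z : (Fin (m + 1) → ℝ) × (Fin (m + 1) → ℝ)} (hz : z ∈ cotSphere (m + 1)) :
    B.density z.1 = B.weight z := by
  rw [density, weight, (mem_cotSphere_iff.1 hz).1, div_one, A_mulVec, dotProduct_comm]
  rfl

variable {U : Set (Fin m × Fin 2 → ℝ)}
  {x : (Fin m × Fin 2 → ℝ) → (Fin (m + 1) → ℝ) × (Fin (m + 1) → ℝ)}

variable (B x) in
/-- The density of `tubeMeasure` in the local parametrization `x`, up to a constant. -/
noncomputable def tubeDensity (u : Fin m × Fin 2 → ℝ) : ENNReal :=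
  ENNReal.ofReal |(tubeDeriv (x u) (fderiv ℝ x u)).det| * ENNReal.ofReal (B.weight (x u))

theorem continuousOn_tubeDensity (hU : IsOpen U) (hx : ContDiffOn ℝ 1 x U)
    (hM : Set.MapsTo x U (cotSphere (m + 1))) : ContinuousOn (B.tubeDensity x) U := by
  have h1 : ContinuousOn (fun u => tubeDeriv (x u) (fderiv ℝ x u)) U :=
    continuous_tubeDeriv.comp_continuousOn (f := fun u => (x u, fderiv ℝ x u))
      (hx.continuousOn.prodMk (hx.continuousOn_fderiv_of_isOpen hU le_rfl))
  have h2 : ContinuousOn (fun u => B.weight (x u)) U := fun u hu =>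
    ContinuousAt.comp_continuousWithinAt (g := B.weight) (contDiffAt_weight
      (fst_ne_zero_of_mem_cotSphere (hM hu))).continuousAt (hx.continuousOn u hu)
  have h3 : ContinuousOn (fun u => ENNReal.ofReal |(tubeDeriv (x u) (fderiv ℝ x u)).det|) U :=
    ENNReal.continuous_ofReal.comp_continuousOn
      (continuous_abs.comp_continuousOn (ContinuousLinearMap.continuous_det.comp_continuousOn h1))
  have h4 : ContinuousOn (fun u => ENNReal.ofReal (B.weight (x u))) U :=
    ENNReal.continuous_ofReal.comp_continuousOn h2
  exact fun u hu => ENNReal.Tendsto.mul (h3 u hu) (Or.inr ENNReal.ofReal_ne_top) (h4 u hu)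
    (Or.inr ENNReal.ofReal_ne_top)

/-- Change of variables in the tube over x(S). The Jacobian and the weight do not depend on r, s,
and the unit square has area one, so an integral over `S` remains. -/
theorem exists_isMeasureOfForm (B : RubberBall (m + 1)) : ∃ c : ENNReal,
    IsMeasureOfForm (cotSphere (m + 1))
      (fun z (v : Fin m × Fin 2 → _) => B.density z.1 * formPow canonicalForm m v)
      (c • B.tubeMeasure) := by
  set L := (splitting m).toContinuousLinearEquiv with hL
  set κ := |formPow (fun x y => coordForm m x y) m fun i => Pi.single i 1| with hκ
  have hV : (volume : Measure ((Fin m × Fin 2 → ℝ) × ℝ × ℝ)).IsAddHaarMeasure := by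
    have : (volume : Measure (ℝ × ℝ)).IsAddHaarMeasure := Measure.prod.instIsAddHaarMeasure _ _
    exact Measure.prod.instIsAddHaarMeasure _ _
  have hLV : (Measure.map L volume).IsAddHaarMeasure := L.isAddHaarMeasure_map _
  -- Uniqueness of Haar measure provides the factor by which the coordinates change Lebesgue
  -- measure; its value is immaterial.
  obtain ⟨c, hc0, hc⟩ : ∃ c : NNReal, c ≠ 0 ∧
      (volume : Measure ((Fin (m + 1) → ℝ) × (Fin (m + 1) → ℝ))) = c • Measure.map L volume :=
    ⟨_, (Measure.addHaarScalarFactor_pos_of_isAddHaarMeasure _ _).ne',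
      Measure.isAddLeftInvariant_eq_smul _ _⟩
  -- `κ` converts the determinant into the power of the symplectic form, and `c` undoes the change
  -- of Lebesgue measure.
  refine ⟨ENNReal.ofReal κ / c, ?_⟩
  intro U x hU hx hinj hM _ S hS hSU
  have hD : ∀ u ∈ U, HasFDerivAt x (fderiv ℝ x u) u := fun u hu =>
    ((hx.differentiableOn (by norm_num)).differentiableAt (hU.mem_nhds hu)).hasFDerivAt
  have htan := fun u (hu : u ∈ U) => tangent_of_mapsTo hU hM hu (hD u hu)
  set I : Set (ℝ × ℝ) := Set.Ioo 0 1 ×ˢ Set.Ioo 0 1 with hI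
  have hIm : MeasurableSet I := measurableSet_Ioo.prod measurableSet_Ioo
  have hI1 : (volume : Measure (ℝ × ℝ)) I = 1 := by
    rw [Measure.volume_eq_prod, hI, Measure.prod_prod]
    simp
  set H := B.tubeDensity x with hH
  have hHc : ContinuousOn H U := continuousOn_tubeDensity hU hx hM
  have hHm : AEMeasurable H (volume.restrict S) :=
    (hHc.mono hSU).aemeasurable hS
  set G : (Fin m × Fin 2 → ℝ) × ℝ × ℝ → (Fin (m + 1) → ℝ) × (Fin (m + 1) → ℝ) := fun q =>
    scaleShear q.2.1 q.2.2 (x q.1) with hG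
  have himg : tube '' ((Subtype.val ⁻¹' (x '' S) : Set (cotSphere (m + 1))) ×ˢ I) =
      (G ∘ L.symm) '' (L '' (S ×ˢ I)) := by
    rw [← Set.image_comp, Function.comp_assoc, L.symm_comp_self, Function.comp_id]
    ext e
    constructor
    · rintro ⟨⟨z, r, s⟩, ⟨⟨u, hu, huz⟩, hrs⟩, rfl⟩
      refine ⟨(u, r, s), ⟨hu, hrs⟩, ?_⟩
      simp only [hG, huz, tube]
    · rintro ⟨⟨u, r, s⟩, ⟨hu, hrs⟩, rfl⟩
      exact ⟨(⟨x u, hM (hSU hu)⟩, r, s), ⟨⟨u, hu, rfl⟩, hrs⟩, rfl⟩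
  have hLm : MeasurableEmbedding L := L.toHomeomorph.measurableEmbedding
  have hinj' : Set.InjOn (G ∘ L.symm) (L '' (S ×ˢ I)) := by
    rintro _ ⟨⟨u, r, s⟩, ⟨hu, -⟩, rfl⟩ _ ⟨⟨u', r', s'⟩, ⟨hu', -⟩, rfl⟩ h
    simp only [Function.comp, L.symm_apply_apply] at h
    have h1 := tube_injective (a₁ := (⟨x u, hM (hSU hu)⟩, r, s))
      (a₂ := (⟨x u', hM (hSU hu')⟩, r', s')) h
    simp only [Prod.mk.injEq, Subtype.mk.injEq] at h1
    have h2 : u = u' := hinj (hSU hu) (hSU hu') h1.1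
    rw [h2, h1.2.1, h1.2.2]
  have hder : ∀ e ∈ L '' (S ×ˢ I), HasFDerivWithinAt (G ∘ L.symm)
      ((tubeMap (L.symm e).2.1 (L.symm e).2.2 (x (L.symm e).1)).comp
        (tubeDeriv (x (L.symm e).1) (fderiv ℝ x (L.symm e).1))) (L '' (S ×ˢ I)) e := by
    rintro _ ⟨⟨u, r, s⟩, ⟨hu, -⟩, rfl⟩
    have h1 := hasFDerivAt_tube (hD u (hSU hu)) (hM (hSU hu))
      (fun w => (htan u (hSU hu) w).1) r s
    have h2 : HasFDerivAt G (((tubeMap r s (x u)).comp (tubeDeriv (x u) (fderiv ℝ x u))).comp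
        (L : (Fin m × Fin 2 → ℝ) × ℝ × ℝ →L[ℝ] (Fin (m + 1) → ℝ) × (Fin (m + 1) → ℝ)))
        (L.symm (L (u, r, s))) := by
      rw [L.symm_apply_apply]; exact h1
    refine ((h2.comp _ L.symm.hasFDerivAt).congr_fderiv ?_).hasFDerivWithinAt
    rw [L.symm_apply_apply]
    refine ContinuousLinearMap.ext fun v => ?_
    change tubeMap r s (x u) (tubeDeriv (x u) (fderiv ℝ x u) (L (L.symm v))) = _
    rw [L.apply_symm_apply]
    rfl
  have hSm : MeasurableSet (Subtype.val ⁻¹' (x '' S) : Set (cotSphere (m + 1))) :=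
    measurable_subtype_coe
      (hS.image_of_continuousOn_injOn (hx.continuousOn.mono hSU) (hinj.mono hSU))
  have hmain : B.tubeMeasure (Subtype.val ⁻¹' (x '' S)) = c * ∫⁻ u in S, H u := by
    rw [tubeMeasure_apply hSm, withDensity_apply', ← hI, himg,
      lintegral_image_eq_lintegral_abs_det_fderiv_mul volume
        (hLm.measurableSet_image.2 (hS.prod hIm)) hder hinj', hc, Measure.restrict_smul,
      lintegral_smul_measure, hLm.restrict_map, hLm.lintegral_map,
      Set.preimage_image_eq _ L.injective,
      ← setLIntegral_prod_fst hI1 hHm]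
    congr 1
    refine setLIntegral_congr_fun (hS.prod hIm) ?_
    rintro ⟨u, r, s⟩ -
    have h1 : |((tubeMap r s (x u)).comp (tubeDeriv (x u) (fderiv ℝ x u))).det| =
        |(tubeDeriv (x u) (fderiv ℝ x u)).det| := by
      have : ((tubeMap r s (x u)).comp (tubeDeriv (x u) (fderiv ℝ x u))).det =
        (tubeMap r s (x u)).det * (tubeDeriv (x u) (fderiv ℝ x u)).det := LinearMap.det_comp _ _
      rw [this, abs_mul, abs_det_tubeMap, one_mul]
    simp only [Function.comp, L.symm_apply_apply, h1, hG, hH, tubeDensity, weight_scaleShear]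
  rw [Measure.smul_apply, hmain, smul_eq_mul, ← mul_assoc, ENNReal.div_mul_cancel
    (by simpa using hc0) ENNReal.coe_ne_top, ← lintegral_const_mul' _ _ ENNReal.ofReal_ne_top]
  refine setLIntegral_congr_fun hS fun u hu => ?_
  have h1 := abs_det_tubeDeriv (hM (hSU hu)) (fun w => (htan u (hSU hu) w).1)
    (fun w => (htan u (hSU hu) w).2)
  simp only [hH, tubeDensity]
  rw [← ENNReal.ofReal_mul (abs_nonneg _), ← ENNReal.ofReal_mul (abs_nonneg _),
    density_eq_weight (hM (hSU hu)), abs_mul, ← h1, abs_of_nonneg weight_nonneg]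
  congr 1
  ring

end VolumeForm

end RubberBall

theorem mainTheorem4 (n : ℕ) (B : RubberBall n) :
    -- each admissible state has exactly one reduced momentum
    (∀ q ∈ B.config, ∀ u ∈ B.distribution q, ∃! p : Fin n → ℝ, B.IsReducedMomentum q u p) ∧
    -- the motions of the ball project to solutions of the explicit equations
    (∀ (J : Set ℝ) (q : ℝ → Amb n) (p : ℝ → Fin n → ℝ), IsOpen J → B.IsMotionOn J q →
      (∀ t ∈ J, B.IsReducedMomentum (q t) (deriv q t) (p t)) →
      B.IsSolutionOn J (fun t => B.proj (q t)) p) ∧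
    -- each solution of the explicit equations is the projection of a motion of the ball
    (∀ (J : Set ℝ) (γ p : ℝ → Fin n → ℝ), IsOpen J → J.OrdConnected → B.IsSolutionOn J γ p →
      ∀ t₀ ∈ J, ∀ q₀ ∈ B.config, B.proj q₀ = γ t₀ →
        ∃ q : ℝ → Amb n, q t₀ = q₀ ∧ B.IsMotionOn J q ∧
          ∀ t ∈ J, B.proj (q t) = γ t ∧ B.IsReducedMomentum (q t) (deriv q t) (p t)) ∧
    -- the flow exists and preserves the measure of the volume form
    (∃ (Φ : ℝ → cotSphere n → cotSphere n) (ν : Measure (cotSphere n)),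
      B.IsFlow Φ ∧ IsMeasureOfForm (cotSphere n) B.volumeForm ν ∧
        ∀ t, MeasurePreserving (Φ t) ν ν) := by
  refine ⟨fun q hq u hu => B.existsUnique_reducedMomentum hq hu,
    fun J q p hJ hq hp => B.isSolutionOn_of_isMotionOn hJ hq hp,
    fun J γ p hJ hJ' h t₀ ht₀ q₀ hq₀ hq₀γ => B.exists_isMotionOn hJ hJ' h ht₀ hq₀ hq₀γ, ?_⟩
  cases n with
  | zero =>
    -- In dimension zero the sphere is empty, so every parametrization has an empty domain and the
    -- truncated exponent n - 1 = 0 plays no role.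
    refine ⟨B.flow, B.tubeMeasure, B.isFlow_flow, ?_, RubberBall.measurePreserving_explicitFlow⟩
    intro U x _ _ _ hM _ S _ hSU
    have hS : S = ∅ := Set.eq_empty_of_forall_notMem fun u hu => by
      simpa [cotSphere] using hM (hSU hu)
    simp [hS]
  | succ m =>
    obtain ⟨c, hc⟩ := RubberBall.exists_isMeasureOfForm B
    exact ⟨B.flow, c • B.tubeMeasure, B.isFlow_flow, hc, fun t =>
      (RubberBall.measurePreserving_explicitFlow t).smul_measure c⟩
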